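/- Let $m\ge 1$, $N,p\ge 0$ be integers, let $\Lambda\subset\mathbb{R}^p$ be open, and consider the semilinear parabolic systems $$u_t=-(\mathrm{i}\partial_x)^{2m}u+f(u,\partial_xu,\ldots,\partial_x^{2m-1}u;\mu),\qquad u\in\mathbb{R}^N,\ x\in\mathbb{R},\ \mu\in\Lambda,$$ where $f:\mathbb{R}^{2mN}\times\Lambda\to\mathbb{R}^N$ is $C^\infty$ and reflection symmetric, $f(u_0,-u_1,u_2,\ldots,-u_{2m-1};\mu)=f(u_0,u_1,u_2,\ldots,u_{2m-1};\mu)$. A *stripe* with wavenumber $k>0$ is a nonconstant, even, $2\pi$-periodic function $v\in C^{2m}(\mathbb{R},\mathbb{R}^N)$ such that $u(x)=v(kx)$ is an equilibrium. Its Bloch operators, for $\ell\in\mathbb{R}$, are $$\mathcal{L}_\ell w=-(\mathrm{i}(k\partial_\xi+\mathrm{i}\ell))^{2m}w+\sum_{j=0}^{2m-1}\partial_{u_j}f(v,kv',\ldots,k^{2m-1}v^{(2m-1)};\mu)\,(k\partial_\xi+\mathrm{i}\ell)^{j}w,$$ acting on $2\pi$-periodic $\mathbb{C}^N$-valued functions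 of $\xi=kx$. The stripe is *stable* if every eigenvalue $\lambda$ of $\mathcal{L}_\ell$, $\ell\in\mathbb{R}$, satisfies $\operatorname{Re}\lambda<0$, except for the eigenvalue $\lambda=0$ when $\ell\in k\mathbb{Z}$; the eigenvalue $0$ of $\mathcal{L}_0$ is algebraically simple, with eigenfunction $v'$; and the smooth real branch $\lambda(\ell)$ of eigenvalues of $\mathcal{L}_\ell$ near $\ell=0$ with $\lambda(0)=0$ satisfies $\lambda''(0)<0$. Fix $\mu_0\in\Lambda$. 1. Let $v_0$ be a stable stripe with wavenumber $k_0$ at $\mu=\mu_0$. Then there are $\varepsilon>0$ and functions $u(\cdot\,;k)$, $|k-k_0|<\varepsilon$, such that $u(\cdot\,;k_0)=v_0$, $u(\xi;k)$ is $C^\infty$ in $(\xi,k)$, and every $u(\cdot\,;k)$ is a stable stripe with wavenumber $k$ at $\mu=\mu_0$. 2. Let $0<k_{\min}<k_{\max}<\infty$, $J=(k_{\min},k_{\max})$, and let $v(\cdot\,;k)$, $k\in J$, be a family of stable stripes with wavenumbers $k$ at $\mu=\mu_0$ that depends continuously on $k\in J$ in the space $C^{2m}_{\mathrm{per}}$ of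 $2\pi$-periodic $C^{2m}$ functions. Then there are an open set $W\subset J\times\Lambda$ that contains $J\times\{\mu_0\}$, whose slices $J_\mu=\{k:(k,\mu)\in W\}$ are (possibly empty) intervals, and functions $u(\cdot\,;k,\mu)$, $(k,\mu)\in W$, such that $u(\cdot\,;k,\mu_0)=v(\cdot\,;k)$ for $k\in J$, $u(\xi;k,\mu)$ is $C^\infty$ in $(\xi,k,\mu)$, and every $u(\cdot\,;k,\mu)$ is a stable stripe with wavenumber $k$ at the parameter $\mu$. In particular, for every compact subinterval of $J$ the family over it persists for all $\mu$ near $\mu_0$. -/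

import Mathlib

open scoped ContDiff

namespace Stripes

noncomputable section

/-- Reflection of a jet: `(u₀, u₁, u₂, …) ↦ (u₀, -u₁, u₂, …)`. -/
def reflectJet {m N : ℕ} (U : Fin (2 * m) → Fin N → ℝ) : Fin (2 * m) → Fin N → ℝ :=
  fun j => (-1 : ℝ) ^ (j : ℕ) • U j

/-- The jet `(u, ∂ₓ u, …, ∂ₓ^(2m-1) u)` of the pattern `u(x) = v(k x)`, as a function of `ξ = k x`;
here `∂ₓ = k ∂_ξ`. -/
def jet {N : ℕ} (m : ℕ) (k : ℝ) (v : ℝ → Fin N → ℝ) (ξ : ℝ) : Fin (2 * m) → Fin N → ℝ :=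
  fun j => k ^ (j : ℕ) • iteratedDeriv (j : ℕ) v ξ

/-- `u(x) = v(k x)` is an equilibrium of `u_t = -(i ∂ₓ)^(2m) u + f(u, ∂ₓ u, …, ∂ₓ^(2m-1) u)`,
written in `ξ = k x`; note `-(i ∂ₓ)^(2m) = -(-1)^m k^(2m) ∂_ξ^(2m)`. -/
def IsStationary {m N : ℕ} (f : (Fin (2 * m) → Fin N → ℝ) → Fin N → ℝ) (k : ℝ)
    (v : ℝ → Fin N → ℝ) : Prop :=
  ∀ ξ : ℝ, (-(-1 : ℝ) ^ m * k ^ (2 * m)) • iteratedDeriv (2 * m) v ξ + f (jet m k v ξ) = 0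

/-- A stripe with wavenumber `k > 0`: a nonconstant, even, `2π`-periodic (in `ξ`) classical profile
`v` such that `u(x) = v(k x)` is an equilibrium. -/
structure IsStripe {m N : ℕ} (f : (Fin (2 * m) → Fin N → ℝ) → Fin N → ℝ) (k : ℝ)
    (v : ℝ → Fin N → ℝ) : Prop where
  wavenumber_pos : 0 < k
  contDiff : ContDiff ℝ ((2 * m : ℕ) : WithTop ℕ∞) v
  periodic : Function.Periodic v (2 * Real.pi)
  even : Function.Even v
  nonconstant : ∃ ξ, v ξ ≠ v 0
  stationary : IsStationary f k v

/-- The operator `k ∂_ξ + i ℓ`. -/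
def blochDeriv {N : ℕ} (k ℓ : ℝ) (w : ℝ → Fin N → ℂ) : ℝ → Fin N → ℂ :=
  fun ξ => (k : ℂ) • deriv w ξ + (Complex.I * (ℓ : ℂ)) • w ξ

/-- The Jacobian matrix (with complex entries) of `f` in its `j`-th slot, at the jet of `v`. -/
def coeff {m N : ℕ} (f : (Fin (2 * m) → Fin N → ℝ) → Fin N → ℝ) (k : ℝ)
    (v : ℝ → Fin N → ℝ) (j : Fin (2 * m)) (ξ : ℝ) : Matrix (Fin N) (Fin N) ℂ :=
  Matrix.of fun a b => ((fderiv ℝ f (jet m k v ξ) (Pi.single j (Pi.single b (1 : ℝ))) a : ℝ) : ℂ)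

/-- The Bloch operator
`w ↦ -(i (k ∂_ξ + i ℓ))^(2m) w + ∑ j, ∂ⱼ f(u, ∂ₓ u, …) (k ∂_ξ + i ℓ)^j w`,
as a differential expression. -/
def blochOp {m N : ℕ} (f : (Fin (2 * m) → Fin N → ℝ) → Fin N → ℝ) (k : ℝ)
    (v : ℝ → Fin N → ℝ) (ℓ : ℝ) (w : ℝ → Fin N → ℂ) (ξ : ℝ) : Fin N → ℂ :=
  (-Complex.I ^ (2 * m)) • (blochDeriv k ℓ)^[2 * m] w ξ
    + ∑ j : Fin (2 * m), (coeff f k v j ξ).mulVec ((blochDeriv k ℓ)^[(j : ℕ)] w ξ)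

/-- Classical `2π`-periodic functions in the domain of the Bloch operators. Since the Bloch
operators are ordinary differential operators with continuous coefficients and constant
invertible leading coefficient, their `L²` periodic eigenfunctions are of this kind. -/
def IsBlochFunction {N : ℕ} (m : ℕ) (w : ℝ → Fin N → ℂ) : Prop :=
  ContDiff ℝ ((2 * m : ℕ) : WithTop ℕ∞) w ∧ Function.Periodic w (2 * Real.pi)

/-- `z` is in the (point) spectrum of the Bloch operator with Floquet-Bloch wavenumber `ℓ`. -/
def IsBlochEigenvalue {m N : ℕ} (f : (Fin (2 * m) → Fin N → ℝ) → Fin N → ℝ) (k : ℝ)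
    (v : ℝ → Fin N → ℝ) (ℓ : ℝ) (z : ℂ) : Prop :=
  ∃ w : ℝ → Fin N → ℂ, IsBlochFunction m w ∧ w ≠ 0 ∧ ∀ ξ, blochOp f k v ℓ w ξ = z • w ξ

/-- The translation mode `∂_ξ v`, as a complex-valued function. -/
def translationMode {N : ℕ} (v : ℝ → Fin N → ℝ) : ℝ → Fin N → ℂ :=
  fun ξ a => ((deriv v ξ a : ℝ) : ℂ)

/-- A stable stripe. The spectrum of the linearization, which is the union over `ℓ` of the
point spectra of the Bloch operators, lies in `Re z < 0`, except for the eigenvalue `0` at `ℓ = 0`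
(equivalently at `ℓ ∈ k ℤ`, as the Bloch operators for `ℓ` and `ℓ + k` are conjugate). That
eigenvalue is algebraically simple (its eigenspace is spanned by the translation mode, and there
are no generalized eigenfunctions), and the critical branch `z(ℓ)` of eigenvalues that emanates
from it satisfies `z''(0) < 0`. -/
structure IsStableStripe {m N : ℕ} (f : (Fin (2 * m) → Fin N → ℝ) → Fin N → ℝ) (k : ℝ)
    (v : ℝ → Fin N → ℝ) : Prop where
  isStripe : IsStripe f k v
  spectrum : ∀ (ℓ : ℝ) (z : ℂ), IsBlochEigenvalue f k v ℓ z →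
    z.re < 0 ∨ (z = 0 ∧ ∃ n : ℤ, ℓ = n * k)
  kernel : ∀ w : ℝ → Fin N → ℂ, IsBlochFunction m w → (∀ ξ, blochOp f k v 0 w ξ = 0) →
    ∃ c : ℂ, w = c • translationMode v
  simple : ¬ ∃ w : ℝ → Fin N → ℂ, IsBlochFunction m w ∧
    ∀ ξ, blochOp f k v 0 w ξ = translationMode v ξ
  branch : ∃ z : ℝ → ℝ, ContDiffAt ℝ ∞ z 0 ∧ z 0 = 0 ∧
    (∀ᶠ ℓ in nhds (0 : ℝ), IsBlochEigenvalue f k v ℓ ((z ℓ : ℝ) : ℂ)) ∧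
    iteratedDeriv 2 z 0 < 0

/-- A family of stable stripes `u k` with wavenumbers `k ∈ (kmin, kmax)`, `0 < kmin < kmax < ∞`,
that depends continuously on `k` in the space of `2π`-periodic functions of class `C^(2m)`
(by periodicity, this is joint continuity of the `ξ`-derivatives of order at most `2m`). -/
structure IsStableFamily {m N : ℕ} (f : (Fin (2 * m) → Fin N → ℝ) → Fin N → ℝ)
    (kmin kmax : ℝ) (u : ℝ → ℝ → Fin N → ℝ) : Prop where
  pos : 0 < kmin
  lt : kmin < kmax
  stable : ∀ k ∈ Set.Ioo kmin kmax, IsStableStripe f k (u k)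
  continuousOn : ∀ j ≤ 2 * m, ContinuousOn (fun q : ℝ × ℝ => iteratedDeriv j (u q.1) q.2)
    (Set.Ioo kmin kmax ×ˢ Set.univ)

end

end Stripes

/-!
Equilibria of the parabolic system are the solutions of the ordinary differential equation
`u⁽²ᵐ⁾ = (-1)ᵐ f(u, …, u⁽²ᵐ⁻¹⁾; μ)`, a first order system for jets with a smooth flow, which is
reversible because `f` is reflection symmetric. An even solution is a stripe with wavenumber `k`
if its derivatives of odd order vanish at the half period `π / k`. Stripes are therefore zeros of a
shooting problem for the `m` even derivatives at `0`, with as many equations as unknowns. A zero of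
its linearization is an even periodic function in the kernel of the linearization at the stripe. At
a stable stripe the kernel is spanned by the translation mode, which is odd, so the implicit
function theorem yields a locally unique zero that depends smoothly on `(k, μ)`
(`exists_smooth_zeros`).

It remains to see that stability is an open condition (`eventually_isStableStripe`). The Floquet
transform identifies the eigenvalues `z` of the Bloch operator `L_ℓ` with the `z` for which the
linear first order system along the stripe has a solution with Floquet multiplier
`exp(2πiℓ/k)` over a period (`isBlochEigenvalue_iff`). This is a finite dimensional problem,
`nullMap = 0`, that is smooth in all parameters. Three facts control its solutions.

* The simple eigenvalue `0` at `ℓ = 0` continues to a smooth branch of eigenvalues that contains all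
  eigenvalues near `0` (`exists_simple_branch`). By this uniqueness, reflection makes the branch
  even in `ℓ`, complex conjugation makes it real, and the translation mode keeps its value zero at
  `ℓ = 0`. Strict concavity at `ℓ = 0`, an open condition, then makes it negative for `ℓ ≠ 0`
  (`eventually_neg_of_even`).
* Near any other point `(ℓ, z)` with `0 ≤ Re z` no eigenvalues appear (`eventually_no_unstable`).
* Eigenvalues with `0 ≤ Re z` are bounded in terms of a bound for the coefficients, by Parseval's
  identity (`norm_le_of_isBlochEigenvalue`). As the multiplier only depends on `ℓ / k` modulo `1`,
  this leaves a compact set of `(ℓ, z)` to consider.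

For the persistence of a family `v(·; k)`, `k ∈ J`, the local branches through its members are glued
by selecting the zero of the shooting problem that is closest to the data of `v(·; k)`. Near `μ₀`
this zero is the one on the local branch (`eventually_isNearestZero_iff`), so the selection is
smooth on a neighborhood of `J × {μ₀}`, which is then shrunk to one whose slices are intervals
(`exists_isOpen_ordConnected_slices`). The flow is only considered for nonlinearities that are
smooth for all parameters; this is no restriction, by a cutoff in `μ` (`exists_cutoff`).

Smoothness of flows is itself derived here, from the implicit function theorem for the Picard map on
`C([0, 1])`: its derivative in the solution is the identity minus a Volterra operator
(`isInvertible_fderiv_picardMap`). Smooth dependence on the system and spectral parameters follows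
by appending trivial equations for them to the systems (`jetField`, `augField`).
-/

namespace Stripes

open Set Filter Topology MeasureTheory

/-! ### Superposition operators -/

section Superposition

variable {K : Type} [TopologicalSpace K] [CompactSpace K]
  {E G : Type} [NormedAddCommGroup E] [NormedSpace ℝ E] [NormedAddCommGroup G] [NormedSpace ℝ G]

/-- The pointwise application `(A, h) ↦ (t ↦ A t (h t))`, as a bounded bilinear map. -/
noncomputable def pointwiseApply (K E G : Type) [TopologicalSpace K] [CompactSpace K]
    [NormedAddCommGroup E] [NormedSpace ℝ E] [NormedAddCommGroup G] [NormedSpace ℝ G] :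
    C(K, E →L[ℝ] G) →L[ℝ] C(K, E) →L[ℝ] C(K, G) :=
  LinearMap.mkContinuous₂
    (LinearMap.mk₂ ℝ
      (fun (A : C(K, E →L[ℝ] G)) (h : C(K, E)) =>
        (⟨fun t => A t (h t), by fun_prop⟩ : C(K, G)))
      (fun A B h => by ext t; simp) (fun c A h => by ext t; simp)
      (fun A h h' => by ext t; simp) (fun c A h => by ext t; simp)) 1
    (fun A h => by
      rw [ContinuousMap.norm_le _ (by positivity)]
      intro t
      rw [one_mul]
      exact ((A t).le_opNorm (h t)).trans (by
        gcongr
        · exact A.norm_coe_le_norm t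
        · exact h.norm_coe_le_norm t))

@[simp] theorem pointwiseApply_apply (A : C(K, E →L[ℝ] G)) (h : C(K, E)) (t : K) :
    pointwiseApply K E G A h t = A t (h t) := rfl

/-- The superposition operator `u ↦ F ∘ u` on continuous functions is differentiable if `F` is
continuously differentiable. -/
theorem hasFDerivAt_superposition {F : E → G} (hF : ContDiff ℝ 1 F)
    (u : C(K, E)) :
    HasFDerivAt (fun u : C(K, E) => (⟨F, hF.continuous⟩ : C(E, G)).comp u)
      (pointwiseApply K E G ((⟨fderiv ℝ F, hF.continuous_fderiv one_ne_zero⟩ :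
        C(E, E →L[ℝ] G)).comp u)) u := by
  set D : C(E, E →L[ℝ] G) := ⟨fderiv ℝ F, hF.continuous_fderiv one_ne_zero⟩ with hD
  rw [hasFDerivAt_iff_isLittleO_nhds_zero, Asymptotics.isLittleO_iff]
  intro ε hε
  have hcont : ContinuousAt (fun u : C(K, E) => D.comp u) u :=
    (ContinuousMap.continuous_postcomp D).continuousAt
  obtain ⟨δ, hδ, hδ'⟩ := (Metric.continuousAt_iff (α := C(K, E))
    (β := C(K, E →L[ℝ] G))).1 hcont ε hε
  filter_upwards [Metric.ball_mem_nhds (0 : C(K, E)) hδ] with h hh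
  rw [mem_ball_zero_iff] at hh
  rw [ContinuousMap.norm_le _ (by positivity)]
  intro t
  have key := Convex.norm_image_sub_le_of_norm_hasFDerivWithin_le' (f := F) (f' := fderiv ℝ F)
    (φ := fderiv ℝ F (u t)) (C := ε) (s := segment ℝ (u t) (u t + h t)) (x := u t)
    (y := u t + h t)
    (fun x _ => ((hF.differentiable one_ne_zero) x).hasFDerivAt.hasFDerivWithinAt) ?_
    (convex_segment _ _) (left_mem_segment _ _ _) (right_mem_segment _ _ _)
  · simp only [add_sub_cancel_left] at key
    calc _ = ‖F (u t + h t) - F (u t) - fderiv ℝ F (u t) (h t)‖ := by simp [hD]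
      _ ≤ ε * ‖h t‖ := key
      _ ≤ ε * ‖h‖ := by gcongr; exact h.norm_coe_le_norm t
  · intro x hx
    rw [segment_eq_image'] at hx
    obtain ⟨θ, hθ, rfl⟩ := hx
    have h1 : dist (u + θ • h) u < δ := by
      rw [dist_eq_norm, add_sub_cancel_left, norm_smul, Real.norm_of_nonneg hθ.1]
      exact (mul_le_of_le_one_left (norm_nonneg _) hθ.2).trans_lt hh
    have h2 := hδ' h1
    have h3 := ((D.comp (u + θ • h)).dist_apply_le_dist (g := D.comp u) t).trans h2.le
    simpa [dist_eq_norm, hD] using h3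

theorem contDiff_superposition {F : E → G} (hF : ContDiff ℝ ∞ F) :
    ContDiff ℝ ∞ (fun u : C(K, E) => (⟨F, hF.continuous⟩ : C(E, G)).comp u) := by
  rw [contDiff_infty]
  intro n
  induction n generalizing G with
  | zero =>
    exact contDiff_zero.2 (ContinuousMap.continuous_postcomp _)
  | succ n ih =>
    have h1 : ContDiff ℝ 1 F := hF.of_le (by exact_mod_cast le_top)
    have hD : ContDiff ℝ ∞ (fderiv ℝ F) := hF.fderiv_right (by simp)
    rw [Nat.cast_add, Nat.cast_one, contDiff_succ_iff_hasFDerivAt]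
    have hL : ContDiff ℝ n (pointwiseApply K E G) := ContinuousLinearMap.contDiff _
    exact ⟨fun u => pointwiseApply K E G ((⟨fderiv ℝ F, hD.continuous⟩ : C(E, E →L[ℝ] G)).comp u),
      hL.comp (ih hD), fun u => hasFDerivAt_superposition h1 u⟩

end Superposition

/-! ### Volterra operators -/

section Volterra

variable {E : Type} [NormedAddCommGroup E]

/-- A continuous function on `[0, 1]`, extended by constants to the real line. -/
noncomputable def extendUnit (u : C(Icc (0 : ℝ) 1, E)) : ℝ → E :=
  fun t => u (projIcc 0 1 zero_le_one t)

theorem continuous_extendUnit (u : C(Icc (0 : ℝ) 1, E)) : Continuous (extendUnit u) :=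
  u.continuous.comp continuous_projIcc

theorem extendUnit_of_mem (u : C(Icc (0 : ℝ) 1, E)) {t : ℝ} (ht : t ∈ Icc (0 : ℝ) 1) :
    extendUnit u t = u ⟨t, ht⟩ := by
  rw [extendUnit, projIcc_of_mem]

theorem norm_extendUnit_le (u : C(Icc (0 : ℝ) 1, E)) (t : ℝ) : ‖extendUnit u t‖ ≤ ‖u‖ :=
  u.norm_coe_le_norm _

variable [NormedSpace ℝ E]

/-- The integration operator `u ↦ (t ↦ ∫₀ᵗ u)` on continuous functions on `[0, 1]`. -/
noncomputable def integrationOp (E : Type) [NormedAddCommGroup E] [NormedSpace ℝ E] :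
    C(Icc (0 : ℝ) 1, E) →L[ℝ] C(Icc (0 : ℝ) 1, E) :=
  LinearMap.mkContinuous
    { toFun := fun u => ⟨fun t => ∫ s in (0 : ℝ)..t, extendUnit u s,
        (intervalIntegral.continuous_primitive
          (fun _ _ => (continuous_extendUnit u).intervalIntegrable _ _) 0).comp
          continuous_subtype_val⟩
      map_add' := fun u v => by
        ext t
        exact intervalIntegral.integral_add ((continuous_extendUnit u).intervalIntegrable _ _)
          ((continuous_extendUnit v).intervalIntegrable _ _)
      map_smul' := fun c u => by
        ext t
        exact intervalIntegral.integral_smul c _ } 1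
    (fun u => by
      rw [ContinuousMap.norm_le _ (by positivity)]
      intro t
      refine (intervalIntegral.norm_integral_le_of_norm_le_const
        (fun s _ => norm_extendUnit_le u s)).trans ?_
      rw [sub_zero, abs_of_nonneg t.2.1, one_mul]
      exact mul_le_of_le_one_right (norm_nonneg _) t.2.2)

theorem integrationOp_apply (u : C(Icc (0 : ℝ) 1, E)) (t : Icc (0 : ℝ) 1) :
    integrationOp E u t = ∫ s in (0 : ℝ)..t, extendUnit u s := rfl

/-- The iterated kernels of a Volterra operator on `[0, 1]` decay factorially. -/
theorem norm_volterra_pow_apply_le (A : C(Icc (0 : ℝ) 1, E →L[ℝ] E)) (n : ℕ)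
    (h : C(Icc (0 : ℝ) 1, E)) (t : Icc (0 : ℝ) 1) :
    ‖((integrationOp E ∘L pointwiseApply _ E E A) ^ n) h t‖
      ≤ ‖A‖ ^ n * (t : ℝ) ^ n / n.factorial * ‖h‖ := by
  induction n generalizing t with
  | zero => simpa using h.norm_coe_le_norm t
  | succ n ih =>
    rw [pow_succ', mul_apply_eq_comp]
    set g := ((integrationOp E ∘L pointwiseApply _ E E A) ^ n) h with hg
    have h1 : ∀ s ∈ Ioc (0 : ℝ) t, ‖extendUnit (pointwiseApply _ E E A g) s‖ ≤
        ‖A‖ ^ (n + 1) / n.factorial * ‖h‖ * s ^ n := by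
      intro s hs
      have hs' : s ∈ Icc (0 : ℝ) 1 := ⟨hs.1.le, hs.2.trans t.2.2⟩
      rw [extendUnit_of_mem _ hs', pointwiseApply_apply]
      calc _ ≤ ‖A ⟨s, hs'⟩‖ * ‖g ⟨s, hs'⟩‖ := (A _).le_opNorm _
        _ ≤ ‖A‖ * (‖A‖ ^ n * s ^ n / n.factorial * ‖h‖) := by
          gcongr
          · exact A.norm_coe_le_norm _
          · exact ih ⟨s, hs'⟩
        _ = _ := by ring
    change ‖∫ s in (0 : ℝ)..t, extendUnit (pointwiseApply _ E E A g) s‖ ≤ _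
    refine (intervalIntegral.norm_integral_le_of_norm_le t.2.1
      (Eventually.of_forall h1)
      ((continuous_const.mul (continuous_pow n)).intervalIntegrable _ _)).trans ?_
    rw [intervalIntegral.integral_const_mul, integral_pow, Nat.factorial_succ]
    simp only [Nat.cast_mul, Nat.cast_add, Nat.cast_one, ne_eq, Nat.add_eq_zero_iff, one_ne_zero,
      and_false, not_false_eq_true, zero_pow, sub_zero]
    apply le_of_eq
    field_simp

/-- Volterra operators are quasinilpotent, whence `1 - K` is invertible. -/
theorem isUnit_one_sub_volterra [CompleteSpace E] (A : C(Icc (0 : ℝ) 1, E →L[ℝ] E)) :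
    IsUnit (1 - integrationOp E ∘L pointwiseApply _ E E A) := by
  set T := integrationOp E ∘L pointwiseApply _ E E A with hT
  obtain ⟨n, hn⟩ : ∃ n : ℕ, ‖A‖ ^ n / n.factorial < 1 :=
    ((FloorSemiring.tendsto_pow_div_factorial_atTop ‖A‖).eventually
      (gt_mem_nhds zero_lt_one)).exists
  have hTn : ‖T ^ n‖ < 1 := by
    refine lt_of_le_of_lt (ContinuousLinearMap.opNorm_le_bound _ (by positivity) fun h => ?_) hn
    rw [ContinuousMap.norm_le _ (by positivity)]
    intro t
    refine (norm_volterra_pow_apply_le A n h t).trans ?_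
    gcongr
    exact mul_le_of_le_one_right (by positivity) (pow_le_one₀ t.2.1 t.2.2)
  -- `1 - T` divides `1 - T ^ n`, which is invertible by the Neumann series.
  have hu : IsUnit ((1 - T) * ∑ i ∈ Finset.range n, T ^ i) := by
    rw [mul_neg_geom_sum]
    exact (Units.oneSub (R := C(Icc (0 : ℝ) 1, E) →L[ℝ] C(Icc (0 : ℝ) 1, E)) (T ^ n) hTn).isUnit
  have hcomm : Commute (1 - T) (∑ i ∈ Finset.range n, T ^ i) := by
    refine Commute.sum_right _ _ _ fun i _ => ?_
    exact ((Commute.one_left _).sub_left ((Commute.refl T).pow_right i))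
  exact (hcomm.isUnit_mul_iff.1 hu).1

end Volterra

/-! ### Flows of smooth vector fields -/

section Flow

variable {E : Type} [NormedAddCommGroup E] [NormedSpace ℝ E]

/-- `u` solves `u' = τ F(u)` on `[0, 1]`. -/
def IsUnitSol (F : E → E) (τ : ℝ) (u : ℝ → E) : Prop :=
  ∀ s ∈ Icc (0 : ℝ) 1, HasDerivWithinAt u (τ • F (u s)) (Icc 0 1) s

/-- The set of `(t, x)` such that the solution of `u' = F(u)`, `u(0) = x` exists up to the time
`t`, which may be negative. The time is rescaled to `[0, 1]`. -/
def flowDomain (F : E → E) : Set (ℝ × E) :=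
  {q | ∃ u : ℝ → E, u 0 = q.2 ∧ IsUnitSol F q.1 u}

open Classical in
/-- The flow of the vector field `F`: the value at time `t` of the solution of `u' = F(u)`,
`u(0) = x`, if it exists up to the time `t`, and `x` otherwise. -/
noncomputable def flow (F : E → E) (q : ℝ × E) : E :=
  if h : q ∈ flowDomain F then h.choose 1 else q.2

theorem IsUnitSol.continuousOn {F : E → E} {τ : ℝ} {u : ℝ → E} (hu : IsUnitSol F τ u) :
    ContinuousOn u (Icc 0 1) := fun s hs => (hu s hs).continuousWithinAt

theorem IsUnitSol.eqOn [ProperSpace E] {F : E → E} (hF : ContDiff ℝ ∞ F) {τ : ℝ} {u v : ℝ → E}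
    (hu : IsUnitSol F τ u) (hv : IsUnitSol F τ v) (h0 : u 0 = v 0) : EqOn u v (Icc 0 1) := by
  obtain ⟨R, hR⟩ := ((isCompact_Icc.image_of_continuousOn hu.continuousOn).union
    (isCompact_Icc.image_of_continuousOn hv.continuousOn)).isBounded.subset_closedBall (0 : E)
  obtain ⟨K, hK⟩ := (ContDiff.contDiffOn (s := Metric.closedBall (0 : E) R)
    (contDiff_const.smul hF : ContDiff ℝ ∞ fun x => τ • F x)).exists_lipschitzOnWith
    (by simp) (convex_closedBall _ _) (isCompact_closedBall _ _)
  have aux : ∀ w : ℝ → E, IsUnitSol F τ w → ∀ s ∈ Ico (0 : ℝ) 1,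
      HasDerivWithinAt w (τ • F (w s)) (Ici s) s := by
    intro w hw s hs
    refine (hw s (Ico_subset_Icc_self hs)).mono_of_mem_nhdsWithin ?_
    exact mem_of_superset (Icc_mem_nhdsGE hs.2) (Icc_subset_Icc_left hs.1)
  exact ODE_solution_unique_of_mem_Icc_right (v := fun _ x => τ • F x) (K := K)
    (s := fun _ => Metric.closedBall (0 : E) R) (fun _ _ => hK) hu.continuousOn (aux u hu)
    (fun s hs => hR (Or.inl (mem_image_of_mem u (Ico_subset_Icc_self hs)))) hv.continuousOn
    (aux v hv) (fun s hs => hR (Or.inr (mem_image_of_mem v (Ico_subset_Icc_self hs)))) h0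

theorem IsUnitSol.flow_eq [ProperSpace E] {F : E → E} (hF : ContDiff ℝ ∞ F) {τ : ℝ} {u : ℝ → E}
    (hu : IsUnitSol F τ u) : (τ, u 0) ∈ flowDomain F ∧ flow F (τ, u 0) = u 1 := by
  have h : (τ, u 0) ∈ flowDomain F := ⟨u, rfl, hu⟩
  refine ⟨h, ?_⟩
  rw [flow, dif_pos h]
  exact h.choose_spec.2.eqOn hF hu h.choose_spec.1 (right_mem_Icc.2 zero_le_one)

theorem exists_isUnitSol_of_mem [ProperSpace E] {F : E → E} (hF : ContDiff ℝ ∞ F) {q : ℝ × E}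
    (hq : q ∈ flowDomain F) : ∃ u : ℝ → E, u 0 = q.2 ∧ IsUnitSol F q.1 u ∧ u 1 = flow F q := by
  obtain ⟨u, h0, hu⟩ := hq
  refine ⟨u, h0, hu, ?_⟩
  have := (hu.flow_eq hF).2
  rw [h0] at this
  exact this.symm

theorem IsUnitSol.rescale {F : E → E} {τ : ℝ} {u : ℝ → E}
    (hu : IsUnitSol F τ u) {r : ℝ} (hr : r ∈ Icc (0 : ℝ) 1) :
    IsUnitSol F (r * τ) (fun s => u (r * s)) := by
  intro s hs
  have hmaps : MapsTo (fun s : ℝ => r * s) (Icc 0 1) (Icc 0 1) := fun y hy =>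
    ⟨mul_nonneg hr.1 hy.1, mul_le_one₀ hr.2 hy.1 hy.2⟩
  have h1 : HasDerivWithinAt (fun s : ℝ => r * s) r (Icc 0 1) s := by
    simpa using ((hasDerivAt_id s).const_mul r).hasDerivWithinAt
  have := (hu (r * s) (hmaps hs)).scomp s h1 hmaps
  rw [smul_smul] at this
  exact this

/-- Intermediate values of a solution with time scale `τ` are values of the flow at smaller times. -/
theorem flow_rescale [ProperSpace E] {F : E → E} (hF : ContDiff ℝ ∞ F) {τ : ℝ} {u : ℝ → E}
    (hu : IsUnitSol F τ u) {r : ℝ} (hr : r ∈ Icc (0 : ℝ) 1) :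
    (r * τ, u 0) ∈ flowDomain F ∧ flow F (r * τ, u 0) = u r := by
  simpa using (hu.rescale hr).flow_eq hF

theorem mem_flowDomain_mul [ProperSpace E] {F : E → E} (hF : ContDiff ℝ ∞ F) {t : ℝ} {x : E}
    (h : (t, x) ∈ flowDomain F) {r : ℝ} (hr : r ∈ Icc (0 : ℝ) 1) : (r * t, x) ∈ flowDomain F := by
  obtain ⟨u, h0, hu⟩ := h
  have := (flow_rescale hF hu hr).1
  rwa [h0] at this

/-- A solution that exists up to the time `t` is given by the flow. -/
theorem flow_eq_of_hasDerivAt [ProperSpace E] {F : E → E} (hF : ContDiff ℝ ∞ F) {t : ℝ}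
    {u : ℝ → E} (hu : ∀ s ∈ uIcc 0 t, HasDerivAt u (F (u s)) s) :
    (t, u 0) ∈ flowDomain F ∧ flow F (t, u 0) = u t := by
  have : IsUnitSol F t (fun s => u (t * s)) := by
    intro s hs
    have h1 : HasDerivAt (fun s : ℝ => t * s) t s := by
      simpa using (hasDerivAt_id s).const_mul t
    have h2 : t * s ∈ uIcc 0 t := by
      rcases le_total 0 t with ht | ht
      · rw [uIcc_of_le ht]
        exact ⟨mul_nonneg ht hs.1, mul_le_of_le_one_right ht hs.2⟩
      · rw [uIcc_of_ge ht]
        exact ⟨by nlinarith [hs.2], mul_nonpos_of_nonpos_of_nonneg ht hs.1⟩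
    exact ((hu _ h2).scomp s h1).hasDerivWithinAt
  simpa using this.flow_eq hF

theorem flow_zero [ProperSpace E] {F : E → E} (hF : ContDiff ℝ ∞ F) (x : E) :
    ((0 : ℝ), x) ∈ flowDomain F ∧ flow F (0, x) = x :=
  IsUnitSol.flow_eq hF (u := fun _ => x) (fun s _ => by
    simpa using (hasDerivWithinAt_const s (Icc (0 : ℝ) 1) x))

/-- The Picard map, whose zeros `U` are the solutions of `u' = τ F(u)`, `u(0) = x` on `[0, 1]`. -/
noncomputable def picardMap (F : C(E, E)) (q : (ℝ × E) × C(Icc (0 : ℝ) 1, E)) :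
    C(Icc (0 : ℝ) 1, E) :=
  q.2 - ContinuousMap.const _ q.1.2 - q.1.1 • integrationOp E (F.comp q.2)

/-- Zeros of the Picard map solve the differential equation. -/
theorem isUnitSol_of_picardMap_eq_zero [CompleteSpace E] {F : C(E, E)}
    {q : (ℝ × E) × C(Icc (0 : ℝ) 1, E)} (h : picardMap F q = 0) :
    extendUnit q.2 0 = q.1.2 ∧ IsUnitSol F q.1.1 (extendUnit q.2) := by
  have h1 : ∀ t ∈ Icc (0 : ℝ) 1, extendUnit q.2 t =
      q.1.2 + q.1.1 • ∫ s in (0 : ℝ)..t, F (extendUnit q.2 s) := by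
    intro t ht
    have h2 := DFunLike.congr_fun h ⟨t, ht⟩
    simp only [picardMap, ContinuousMap.sub_apply, ContinuousMap.const_apply,
      ContinuousMap.smul_apply, ContinuousMap.zero_apply, integrationOp_apply] at h2
    rw [extendUnit_of_mem _ ht]
    rw [sub_sub, sub_eq_zero] at h2
    exact h2
  have hcont : Continuous fun s => F (extendUnit q.2 s) :=
    F.continuous.comp (continuous_extendUnit _)
  refine ⟨by simpa using h1 0 (by simp), fun s hs => ?_⟩
  refine HasDerivWithinAt.congr_of_mem ?_ h1 hs
  exact (((intervalIntegral.integral_hasDerivAt_right (hcont.intervalIntegrable _ _)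
    (hcont.stronglyMeasurableAtFilter _ _) hcont.continuousAt).const_smul
      q.1.1).const_add _).hasDerivWithinAt

theorem picardMap_eq_zero_of_isUnitSol [CompleteSpace E] {F : C(E, E)} {τ : ℝ} {u : ℝ → E}
    (hu : IsUnitSol F τ u) :
    picardMap F ((τ, u 0), ⟨(Icc (0 : ℝ) 1).domRestrict u, hu.continuousOn.domRestrict⟩) = 0 := by
  ext t
  set U : C(Icc (0 : ℝ) 1, E) := ⟨(Icc (0 : ℝ) 1).domRestrict u, hu.continuousOn.domRestrict⟩ with hU
  have hUu : ∀ s ∈ Icc (0 : ℝ) 1, extendUnit U s = u s := fun s hs => by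
    rw [extendUnit_of_mem _ hs, hU]; rfl
  have hcont : Continuous fun s => τ • F (extendUnit U s) :=
    (F.continuous.comp (continuous_extendUnit _)).const_smul τ
  have h1 := intervalIntegral.integral_eq_sub_of_hasDerivAt_of_le (f := u)
    (f' := fun s => τ • F (extendUnit U s)) t.2.1
    (hu.continuousOn.mono (Icc_subset_Icc_right t.2.2))
    (fun s hs => by
      have hs' : s ∈ Icc (0 : ℝ) 1 := ⟨hs.1.le, hs.2.le.trans t.2.2⟩
      simp only [hUu s hs']
      exact (hu s hs').hasDerivAt (Icc_mem_nhds hs.1 (hs.2.trans_le t.2.2)))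
    (hcont.intervalIntegrable _ _)
  rw [intervalIntegral.integral_smul] at h1
  simp only [picardMap, ContinuousMap.sub_apply, ContinuousMap.const_apply,
      ContinuousMap.smul_apply, ContinuousMap.zero_apply, integrationOp_apply]
  rw [sub_sub, sub_eq_zero]
  change u t = u 0 + τ • ∫ s in (0 : ℝ)..t, F (extendUnit U s)
  rw [h1]
  abel

theorem contDiff_picardMap {F : E → E} (hF : ContDiff ℝ ∞ F) :
    ContDiff ℝ ∞ (picardMap (⟨F, hF.continuous⟩ : C(E, E))) := by
  have hc : ContDiff ℝ ∞ (fun x : E => ContinuousMap.const (Icc (0 : ℝ) 1) x) :=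
    (ContinuousLinearMap.const ℝ (Icc (0 : ℝ) 1) : E →L[ℝ] C(Icc (0 : ℝ) 1, E)).contDiff
  have hJ : ContDiff ℝ ∞ (integrationOp E) := ContinuousLinearMap.contDiff _
  have hN := contDiff_superposition (K := Icc (0 : ℝ) 1) hF
  unfold picardMap
  exact (contDiff_snd.sub (hc.comp (contDiff_snd.comp contDiff_fst))).sub
    ((contDiff_fst.comp contDiff_fst).smul (hJ.comp (hN.comp contDiff_snd)))

/-- The derivative of the Picard map in the solution is the identity minus a Volterra operator. -/
theorem isInvertible_fderiv_picardMap [CompleteSpace E] {F : E → E} (hF : ContDiff ℝ ∞ F)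
    (q : (ℝ × E) × C(Icc (0 : ℝ) 1, E)) :
    (fderiv ℝ (picardMap (⟨F, hF.continuous⟩ : C(E, E))) q ∘L
      ContinuousLinearMap.inr ℝ (ℝ × E) C(Icc (0 : ℝ) 1, E)).IsInvertible := by
  have hF1 : ContDiff ℝ 1 F := hF.of_le (by exact_mod_cast le_top)
  have h1 : HasFDerivAt (fun U : C(Icc (0 : ℝ) 1, E) =>
      picardMap (⟨F, hF.continuous⟩ : C(E, E)) (q.1, U))
      (fderiv ℝ (picardMap (⟨F, hF.continuous⟩ : C(E, E))) q ∘L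
        ContinuousLinearMap.inr ℝ (ℝ × E) C(Icc (0 : ℝ) 1, E)) q.2 := by
    refine HasFDerivAt.comp q.2 (g := picardMap (⟨F, hF.continuous⟩ : C(E, E)))
      (f := fun U => (q.1, U)) ?_ (hasFDerivAt_prodMk_right q.1 q.2)
    exact ((contDiff_picardMap hF).differentiable (by simp) q).hasFDerivAt
  set A : C(Icc (0 : ℝ) 1, E →L[ℝ] E) := q.1.1 •
    (⟨fderiv ℝ F, hF1.continuous_fderiv one_ne_zero⟩ : C(E, E →L[ℝ] E)).comp q.2 with hA
  have h2 : HasFDerivAt (fun U : C(Icc (0 : ℝ) 1, E) =>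
      picardMap (⟨F, hF.continuous⟩ : C(E, E)) (q.1, U))
      (1 - integrationOp E ∘L pointwiseApply _ E E A) q.2 := by
    have h3 := ((integrationOp E).hasFDerivAt.comp q.2
      (hasFDerivAt_superposition hF1 q.2)).const_smul q.1.1
    have h4 := ((hasFDerivAt_id q.2).sub_const (ContinuousMap.const _ q.1.2)).sub h3
    refine h4.congr_fderiv ?_
    rw [hA, map_smul, ContinuousLinearMap.comp_smul]
    rfl
  rw [h1.unique h2]
  obtain ⟨w, hw⟩ := isUnit_one_sub_volterra A
  exact ⟨ContinuousLinearEquiv.unitsEquiv ℝ _ w, by ext1 x; rw [← hw]; rfl⟩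

/-- Smooth dependence of solutions on time and initial data. -/
theorem mem_nhds_flowDomain_and_contDiffAt_flow [ProperSpace E] {F : E → E}
    (hF : ContDiff ℝ ∞ F) {q : ℝ × E} (hq : q ∈ flowDomain F) :
    flowDomain F ∈ 𝓝 q ∧ ContDiffAt ℝ ∞ (flow F) q := by
  obtain ⟨u, h0, hu⟩ := hq
  have hz := picardMap_eq_zero_of_isUnitSol (F := (⟨F, hF.continuous⟩ : C(E, E))) hu
  rw [h0] at hz
  set U : C(Icc (0 : ℝ) 1, E) := ⟨(Icc (0 : ℝ) 1).domRestrict u, hu.continuousOn.domRestrict⟩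
  have hcd : ContDiffAt ℝ ∞ (picardMap (⟨F, hF.continuous⟩ : C(E, E))) (q, U) :=
    (contDiff_picardMap hF).contDiffAt
  have hinv := isInvertible_fderiv_picardMap hF (q, U)
  have hev := hcd.eventually_apply_implicitFunction (by simp) hinv
  have hcψ := hcd.contDiffAt_implicitFunction (by simp) hinv
  set ψ := hcd.implicitFunction (by simp) hinv
  have key : ∀ᶠ p in 𝓝 q, p ∈ flowDomain F ∧ flow F p = ψ p ⟨1, by simp⟩ := by
    filter_upwards [hev] with p hp
    have h1 : picardMap (⟨F, hF.continuous⟩ : C(E, E)) (p, ψ p) = 0 := hp.trans hz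
    obtain ⟨h2, h3⟩ := isUnitSol_of_picardMap_eq_zero h1
    have h4 := IsUnitSol.flow_eq hF h3
    dsimp only at h2 h4
    rw [h2] at h4
    refine ⟨h4.1, h4.2.trans ?_⟩
    rw [extendUnit_of_mem _ (right_mem_Icc.2 zero_le_one)]
  refine ⟨key.mono fun p hp => hp.1, ?_⟩
  have hc : ContDiffAt ℝ ∞ (fun p => ψ p ⟨1, by simp⟩) q :=
    ((ContinuousMap.evalCLM ℝ (⟨1, by simp⟩ : Icc (0 : ℝ) 1) :
      C(Icc (0 : ℝ) 1, E) →L[ℝ] E).contDiff.contDiffAt).comp q hcψ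
  exact hc.congr_of_eventuallyEq (key.mono fun p hp => hp.2)

theorem isOpen_flowDomain [ProperSpace E] {F : E → E} (hF : ContDiff ℝ ∞ F) :
    IsOpen (flowDomain F) :=
  isOpen_iff_mem_nhds.2 fun _ hq => (mem_nhds_flowDomain_and_contDiffAt_flow hF hq).1

theorem contDiffAt_flow [ProperSpace E] {F : E → E} (hF : ContDiff ℝ ∞ F) {q : ℝ × E}
    (hq : q ∈ flowDomain F) : ContDiffAt ℝ ∞ (flow F) q :=
  (mem_nhds_flowDomain_and_contDiffAt_flow hF hq).2

/-- The flow solves the differential equation. On the domain of the flow it is differentiable, so that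
only its derivative has to be identified, for which one-sided derivatives suffice. -/
theorem hasDerivAt_flow [ProperSpace E] {F : E → E} (hF : ContDiff ℝ ∞ F) {t : ℝ} {x : E}
    (h : (t, x) ∈ flowDomain F) :
    HasDerivAt (fun s => flow F (s, x)) (F (flow F (t, x))) t := by
  have hd : DifferentiableAt ℝ (fun s => flow F (s, x)) t :=
    DifferentiableAt.comp (g := flow F) (f := fun s => (s, x)) t
      ((contDiffAt_flow hF h).differentiableAt (by simp))
      (differentiableAt_id.prodMk (differentiableAt_const x))
  -- The solution `u` with the time scale `τ` is compared with the flow at the time `r τ`.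
  have key : ∀ τ r : ℝ, τ ≠ 0 → r ∈ Icc (0 : ℝ) 1 → r * τ = t → (τ, x) ∈ flowDomain F →
      HasDerivAt (fun s => flow F (s, x)) (F (flow F (t, x))) t := by
    intro τ r hτ hr hrt hmem
    obtain ⟨u, h0, hu⟩ := hmem
    dsimp only at h0 hu
    have h1 : ∀ s ∈ Icc (0 : ℝ) 1, flow F (s * τ, x) = u s := fun s hs => by
      rw [← h0]; exact (flow_rescale hF hu hs).2
    have h2 : HasDerivWithinAt (fun s : ℝ => flow F (s * τ, x)) (τ • F (u r)) (Icc 0 1) r :=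
      (hu r hr).congr_of_mem h1 hr
    have h3 : HasDerivAt (fun s : ℝ => s * τ) τ r := by simpa using (hasDerivAt_id r).mul_const τ
    have h4 : HasDerivWithinAt (fun s : ℝ => flow F (s * τ, x))
        (τ • deriv (fun s => flow F (s, x)) t) (Icc 0 1) r := by
      have hd' : HasDerivAt (fun s => flow F (s, x)) (deriv (fun s => flow F (s, x)) t)
        (r * τ) := by rw [hrt]; exact hd.hasDerivAt
      exact (hd'.scomp r h3).hasDerivWithinAt
    have h5 := (uniqueDiffOn_Icc zero_lt_one r hr).eq_deriv _ h2 h4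
    have h6 := smul_right_injective E hτ h5
    rw [← h1 r hr, hrt] at h6
    rw [h6]
    exact hd.hasDerivAt
  by_cases ht : t = 0
  · subst ht
    have h7 : ∀ᶠ τ in 𝓝[≠] (0 : ℝ), (τ, x) ∈ flowDomain F :=
      nhdsWithin_le_nhds ((Continuous.prodMk_left x).continuousAt.preimage_mem_nhds
        ((isOpen_flowDomain hF).mem_nhds h))
    obtain ⟨τ, hτ, hτ0⟩ := (h7.and self_mem_nhdsWithin).exists
    exact key τ 0 hτ0 (by simp) (by simp) hτ
  · exact key t 1 ht (by simp) (by simp) h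

/-- The flow restricted to the time interval between `0` and `t` is a solution. -/
theorem mem_flowDomain_of_mem_uIcc [ProperSpace E] {F : E → E} (hF : ContDiff ℝ ∞ F) {t s : ℝ}
    {x : E} (h : (t, x) ∈ flowDomain F) (hs : s ∈ uIcc 0 t) : (s, x) ∈ flowDomain F := by
  by_cases ht : t = 0
  · subst ht
    rw [uIcc_self, mem_singleton_iff] at hs
    rwa [hs]
  · have : s / t * t = s := div_mul_cancel₀ s ht
    rw [← this]
    refine mem_flowDomain_mul hF h ?_
    rcases lt_or_gt_of_ne ht with h' | h'
    · rw [uIcc_of_ge h'.le] at hs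
      exact ⟨div_nonneg_of_nonpos hs.2 h'.le, (div_le_one_of_neg h').2 hs.1⟩
    · rw [uIcc_of_le h'.le] at hs
      exact ⟨div_nonneg hs.1 h'.le, (div_le_one h').2 hs.2⟩

end Flow

/-! ### The variational equation -/

section Variational

variable {E : Type} [NormedAddCommGroup E] [NormedSpace ℝ E] [ProperSpace E]

theorem fderiv_flow_zero {F : E → E} (hF : ContDiff ℝ ∞ F) (x δ : E) :
    fderiv ℝ (flow F) (0, x) (0, δ) = δ := by
  have h1 : HasFDerivAt (fun y => flow F (0, y))
      (fderiv ℝ (flow F) (0, x) ∘L ContinuousLinearMap.inr ℝ ℝ E) x :=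
    HasFDerivAt.comp x (g := flow F) (f := fun y => ((0 : ℝ), y))
      ((contDiffAt_flow hF (flow_zero hF x).1).differentiableAt (by simp)).hasFDerivAt
      (hasFDerivAt_prodMk_right 0 x)
  have h2 : (fun y => flow F (0, y)) = id := funext fun y => (flow_zero hF y).2
  rw [h2] at h1
  have := DFunLike.congr_fun (h1.unique (hasFDerivAt_id x)) δ
  simpa using this

/-- The variational equation: derivatives of the flow in the initial data solve the linearized
equation. This is the symmetry of the second derivatives of the flow. -/
theorem hasDerivAt_fderiv_flow {F : E → E} (hF : ContDiff ℝ ∞ F) {t : ℝ} {x : E}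
    (h : (t, x) ∈ flowDomain F) (δ : E) :
    HasDerivAt (fun s => fderiv ℝ (flow F) (s, x) (0, δ))
      (fderiv ℝ F (flow F (t, x)) (fderiv ℝ (flow F) (t, x) (0, δ))) t := by
  have hΦ := contDiffAt_flow hF h
  have hdΦ : DifferentiableAt ℝ (fderiv ℝ (flow F)) (t, x) :=
    (hΦ.fderiv_right (m := ∞) (by simp)).differentiableAt (by simp)
  have h1 : HasDerivAt (fun s => fderiv ℝ (flow F) (s, x) (0, δ))
      (fderiv ℝ (fderiv ℝ (flow F)) (t, x) (1, 0) (0, δ)) t := by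
    have h2 : HasDerivAt (fun s : ℝ => (s, x)) ((1 : ℝ), (0 : E)) t :=
      (hasDerivAt_id t).prodMk (hasDerivAt_const t x)
    have h3 : HasDerivAt (fun s => fderiv ℝ (flow F) (s, x))
        (fderiv ℝ (fderiv ℝ (flow F)) (t, x) (1, 0)) t :=
      HasFDerivAt.comp_hasDerivAt (l := fderiv ℝ (flow F)) (f := fun s => (s, x)) t
        hdΦ.hasFDerivAt h2
    simpa using h3.clm_apply (hasDerivAt_const t ((0 : ℝ), δ))
  have h4 : (fun p => fderiv ℝ (flow F) p (1, 0)) =ᶠ[𝓝 (t, x)] fun p => F (flow F p) := by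
    filter_upwards [(isOpen_flowDomain hF).mem_nhds h] with p hp
    have h5 : HasDerivAt (fun s : ℝ => (s, p.2)) ((1 : ℝ), (0 : E)) p.1 :=
      (hasDerivAt_id p.1).prodMk (hasDerivAt_const p.1 p.2)
    have h6 : HasDerivAt (fun s => flow F (s, p.2)) (fderiv ℝ (flow F) p (1, 0)) p.1 :=
      HasFDerivAt.comp_hasDerivAt (l := flow F) (f := fun s => (s, p.2)) p.1
        ((contDiffAt_flow hF hp).differentiableAt (by simp)).hasFDerivAt h5
    exact h6.unique (hasDerivAt_flow hF (t := p.1) (x := p.2) hp)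
  have h7 : HasFDerivAt (fun p => fderiv ℝ (flow F) p (1, 0))
      ((fderiv ℝ F (flow F (t, x))) ∘L fderiv ℝ (flow F) (t, x)) (t, x) :=
    (HasFDerivAt.comp (t, x) (hF.differentiable (by simp) _).hasFDerivAt
      (hΦ.differentiableAt (by simp)).hasFDerivAt).congr_of_eventuallyEq h4
  have h8 : HasFDerivAt (fun p => fderiv ℝ (flow F) p (1, 0))
      ((fderiv ℝ (fderiv ℝ (flow F)) (t, x)).flip (1, 0)) (t, x) := by
    simpa using hdΦ.hasFDerivAt.clm_apply (hasFDerivAt_const ((1 : ℝ), (0 : E)) (t, x))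
  have h9 := DFunLike.congr_fun (h7.unique h8) (0, δ)
  have hsymm := (hΦ.isSymmSndFDerivAt (by
    rw [minSmoothness_of_isRCLikeNormedField]
    exact WithTop.coe_le_coe.2 (le_top (a := (2 : ℕ∞))))) (1, 0) (0, δ)
  simp only [ContinuousLinearMap.comp_apply, ContinuousLinearMap.flip_apply] at h9
  rw [h9, ← hsymm]
  exact h1

end Variational

/-! ### Uniqueness for linear equations -/

section LinearODE

variable {E : Type} [NormedAddCommGroup E] [NormedSpace ℝ E]

theorem linearODE_eq_zero {A : ℝ → E →L[ℝ] E} (hA : Continuous A) {Y : ℝ → E}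
    (hY : ∀ t, HasDerivAt Y (A t (Y t)) t) {t₀ : ℝ} (h0 : Y t₀ = 0) : Y = 0 := by
  ext t
  obtain ⟨a, b, ht, ht₀⟩ : ∃ a b, t ∈ Ioo a b ∧ t₀ ∈ Ioo a b := by
    refine ⟨min t t₀ - 1, max t t₀ + 1, ?_, ?_⟩ <;> constructor <;> grind
  obtain ⟨K, hK⟩ := isCompact_Icc.exists_bound_of_continuousOn
    (hA.continuousOn (s := Icc a b))
  refine ODE_solution_unique_of_mem_Ioo (v := fun s y => A s y) (K := K.toNNReal)
    (s := fun _ => univ) (fun s hs => ?_) ht₀ (fun s _ => ⟨hY s, trivial⟩)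
    (g := 0) (fun s _ => ⟨by simp, trivial⟩)
    h0 ht
  refine ((A s).lipschitz.weaken ?_).lipschitzOnWith
  rw [← NNReal.coe_le_coe, coe_nnnorm]
  exact (hK s (Ioo_subset_Icc_self hs)).trans (Real.le_coe_toNNReal K)

theorem linearODE_unique {A : ℝ → E →L[ℝ] E} (hA : Continuous A) {g : ℝ → E} {Y Z : ℝ → E}
    (hY : ∀ t, HasDerivAt Y (A t (Y t) + g t) t) (hZ : ∀ t, HasDerivAt Z (A t (Z t) + g t) t)
    {t₀ : ℝ} (h0 : Y t₀ = Z t₀) : Y = Z := by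
  have := linearODE_eq_zero hA (Y := Y - Z) (t₀ := t₀)
    (fun t => by simpa using (hY t).sub (hZ t)) (by simp [h0])
  exact sub_eq_zero.1 this

end LinearODE

/-! ### Periodic extension of solutions -/

section PeriodicExtension

variable {E : Type} [NormedAddCommGroup E] [NormedSpace ℝ E]

/-- A solution of an autonomous equation on `[-T, T]` with equal values at the end points extends
to a periodic solution on the line. -/
theorem exists_periodic_extension {F : E → E} {T : ℝ} (hT : 0 < T) {u : ℝ → E}
    (hu : ∀ s ∈ Icc (-T) T, HasDerivAt u (F (u s)) s) (hper : u (-T) = u T) :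
    ∃ U : ℝ → E, (∀ s, HasDerivAt U (F (U s)) s) ∧ Function.Periodic U (2 * T) ∧
      ∀ s ∈ Icc (-T) T, U s = u s := by
  have hT2 : 0 < 2 * T := by positivity
  set U : ℝ → E := fun s => u (toIcoMod hT2 (-T) s) with hU
  have hUper : Function.Periodic U (2 * T) := fun s => by simp [hU]
  have hUeq : ∀ s ∈ Icc (-T) T, U s = u s := by
    intro s hs
    rcases eq_or_lt_of_le hs.2 with h | h
    · have : toIcoMod hT2 (-T) T = -T := by
        have := toIcoMod_add_right hT2 (-T) (-T)
        rwa [show -T + 2 * T = T by ring, toIcoMod_apply_left] at this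
      simp only [hU]
      rw [h, this, hper]
    · simp only [hU]
      rw [(toIcoMod_eq_self hT2).2 ⟨hs.1, by linarith⟩]
  have hbase : ∀ s ∈ Ico (-T) T, HasDerivAt U (F (U s)) s := by
    intro s hs
    rw [hUeq s (Ico_subset_Icc_self hs)]
    rcases eq_or_lt_of_le hs.1 with h | h
    · rw [← h]
      have hr : HasDerivWithinAt U (F (u (-T))) (Ici (-T)) (-T) := by
        refine ((hu (-T) ⟨le_rfl, by linarith⟩).hasDerivWithinAt).congr_of_eventuallyEq ?_
          (hUeq _ ⟨le_rfl, by linarith⟩)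
        filter_upwards [Icc_mem_nhdsGE (show -T < T by linarith)] with y hy using hUeq y hy
      have hl : HasDerivWithinAt U (F (u (-T))) (Iic (-T)) (-T) := by
        have h1 : HasDerivAt (fun y => u (y + 2 * T)) (F (u (-T))) (-T) := by
          have h2 := hu T ⟨by linarith, le_rfl⟩
          rw [← hper] at h2
          refine HasDerivAt.comp_add_const (-T) (2 * T) ?_
          rwa [show -T + 2 * T = T by ring]
        refine h1.hasDerivWithinAt.congr_of_eventuallyEq ?_ ?_
        · filter_upwards [Icc_mem_nhdsLE (show -T - 2 * T < -T by linarith)] with y hy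
          rw [← hUper y]
          exact hUeq _ ⟨by linarith [hy.1], by linarith [hy.2]⟩
        · rw [← hUper]
          exact hUeq _ ⟨by linarith, by linarith⟩
      have := hl.union hr
      rwa [Iic_union_Ici, hasDerivWithinAt_univ] at this
    · refine (hu s (Ico_subset_Icc_self hs)).congr_of_eventuallyEq ?_
      filter_upwards [Ioo_mem_nhds h hs.2] with y hy using hUeq y (Ioo_subset_Icc_self hy)
  refine ⟨U, fun s => ?_, hUper, hUeq⟩
  have h1 : toIcoMod hT2 (-T) s ∈ Ico (-T) T := by
    have := toIcoMod_mem_Ico hT2 (-T) s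
    rwa [show -T + 2 * T = T by ring] at this
  have h2 := hbase _ h1
  have h3 : s - toIcoDiv hT2 (-T) s • (2 * T) = toIcoMod hT2 (-T) s := rfl
  rw [← h3] at h2
  have h4 := HasDerivAt.comp_sub_const s (toIcoDiv hT2 (-T) s • (2 * T)) h2
  simpa only [hUper.sub_zsmul_eq] using h4

end PeriodicExtension

/-! ### The implicit function theorem -/

section ImplicitFunction

theorem eventually_isInvertible_fderiv {Q Y Z : Type} [NormedAddCommGroup Q] [NormedSpace ℝ Q]
    [NormedAddCommGroup Y] [NormedSpace ℝ Y] [CompleteSpace Y]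
    [NormedAddCommGroup Z] [NormedSpace ℝ Z] {H : Q × Y → Z} {u : Q × Y}
    (hH : ContDiffAt ℝ ∞ H u)
    (hinv : (fderiv ℝ H u ∘L ContinuousLinearMap.inr ℝ Q Y).IsInvertible) :
    ∀ᶠ v in 𝓝 u, (fderiv ℝ H v ∘L ContinuousLinearMap.inr ℝ Q Y).IsInvertible := by
  obtain ⟨e, he⟩ := hinv
  have hc : ContinuousAt (fun v => fderiv ℝ H v ∘L ContinuousLinearMap.inr ℝ Q Y) u :=
    ((hH.continuousAt_fderiv (by simp))).clm_comp continuousAt_const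
  have := e.nhds
  rw [he] at this
  exact hc.eventually this

/-- The smooth implicit function theorem, with smoothness in a neighborhood of the base point. -/
theorem exists_smooth_implicit {Q Y Z : Type} [NormedAddCommGroup Q] [NormedSpace ℝ Q]
    [CompleteSpace Q] [NormedAddCommGroup Y] [NormedSpace ℝ Y] [CompleteSpace Y]
    [NormedAddCommGroup Z] [NormedSpace ℝ Z] [CompleteSpace Z] {H : Q × Y → Z} {q₀ : Q} {y₀ : Y}
    (hH : ∀ᶠ u in 𝓝 (q₀, y₀), ContDiffAt ℝ ∞ H u) (h0 : H (q₀, y₀) = 0)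
    (hinv : (fderiv ℝ H (q₀, y₀) ∘L ContinuousLinearMap.inr ℝ Q Y).IsInvertible) :
    ∃ ψ : Q → Y, ψ q₀ = y₀ ∧ (∀ᶠ q in 𝓝 q₀, ContDiffAt ℝ ∞ ψ q) ∧
      ∀ᶠ u in 𝓝 (q₀, y₀), (H u = 0 ↔ ψ u.1 = u.2) := by
  have aux : ∀ u : Q × Y, ContDiffAt ℝ ∞ H u → H u = 0 →
      (fderiv ℝ H u ∘L ContinuousLinearMap.inr ℝ Q Y).IsInvertible →
      ∃ ψ : Q → Y, ψ u.1 = u.2 ∧ ContDiffAt ℝ ∞ ψ u.1 ∧ ∀ᶠ v in 𝓝 u, (H v = 0 ↔ ψ v.1 = v.2) := by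
    intro u hu hu0 hi
    refine ⟨hu.implicitFunction (by simp) hi, hu.implicitFunction_apply_self (by simp) hi,
      hu.contDiffAt_implicitFunction (by simp) hi, ?_⟩
    have := hu.eventually_apply_eq_iff_implicitFunction (by simp) hi
    rwa [hu0] at this
  obtain ⟨ψ, hψ0, hψc, hψ⟩ := aux (q₀, y₀) hH.self_of_nhds h0 hinv
  refine ⟨ψ, hψ0, ?_, hψ⟩
  have hcont : ContinuousAt (fun q => (q, ψ q)) q₀ := continuousAt_id.prodMk hψc.continuousAt
  have hcont' : Tendsto (fun q => (q, ψ q)) (𝓝 q₀) (𝓝 (q₀, y₀)) := by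
    have := hcont.tendsto
    dsimp only at this hψ0
    rwa [hψ0] at this
  filter_upwards [hcont'.eventually hH, hcont'.eventually hψ.eventually_nhds,
    hcont'.eventually (eventually_isInvertible_fderiv hH.self_of_nhds hinv)] with q h1 h2 h3
  obtain ⟨χ, hχ0, hχc, hχ⟩ := aux (q, ψ q) h1 (h2.self_of_nhds.2 rfl) h3
  dsimp only at hχ0 hχc
  refine hχc.congr_of_eventuallyEq ?_
  have hc : Tendsto (fun q => (q, χ q)) (𝓝 q) (𝓝 (q, ψ q)) := by
    have := (continuousAt_id.prodMk hχc.continuousAt : ContinuousAt (fun q => (q, χ q)) q).tendsto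
    rwa [hχ0] at this
  filter_upwards [hc.eventually h2, hc.eventually hχ] with p hp1 hp2
  exact hp1.1 (hp2.2 rfl)

theorem isInvertible_of_injective {Y Z : Type} [NormedAddCommGroup Y] [NormedSpace ℝ Y]
    [FiniteDimensional ℝ Y] [NormedAddCommGroup Z] [NormedSpace ℝ Z] [FiniteDimensional ℝ Z]
    (hd : Module.finrank ℝ Y = Module.finrank ℝ Z) (L : Y →L[ℝ] Z)
    (hL : ∀ y, L y = 0 → y = 0) : L.IsInvertible := by
  have hinj : Function.Injective (L : Y →ₗ[ℝ] Z) :=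
    (injective_iff_map_eq_zero (L : Y →ₗ[ℝ] Z)).2 hL
  exact ⟨(LinearEquiv.ofInjectiveOfFinrankEq (L : Y →ₗ[ℝ] Z) hinj hd).toContinuousLinearEquiv, by
    ext y; rfl⟩

end ImplicitFunction

/-! ### Neighborhoods with interval slices -/

section Slices

/-- A neighborhood of `(a, b) × {μ₀}` contains an open neighborhood whose slices are intervals. -/
theorem exists_isOpen_ordConnected_slices {M : Type} [TopologicalSpace M] {a b : ℝ} (hab : a < b)
    {S : Set (ℝ × M)} {μ₀ : M} (hS : ∀ k ∈ Ioo a b, S ∈ 𝓝 (k, μ₀)) :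
    ∃ W : Set (ℝ × M), IsOpen W ∧ W ⊆ S ∧ W ⊆ Ioo a b ×ˢ univ ∧ (∀ k ∈ Ioo a b, (k, μ₀) ∈ W) ∧
      ∀ μ, OrdConnected {k | (k, μ) ∈ W} := by
  set c : ℝ := (a + b) / 2 with hc
  have hcab : c ∈ Ioo a b := ⟨by linarith, by linarith⟩
  -- The segments from the midpoint `c` make the slices star-shaped.
  set W : Set (ℝ × M) :=
    {q | q.1 ∈ Ioo a b ∧ ∀ r ∈ Icc (0 : ℝ) 1, (c + r * (q.1 - c), q.2) ∈ interior S} with hW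
  have hWiff : ∀ k μ, (k, μ) ∈ W ↔ k ∈ Ioo a b ∧ ∀ k' ∈ uIcc c k, (k', μ) ∈ interior S := by
    intro k μ
    simp only [hW, mem_ofPred_eq, ← segment_eq_uIcc, segment_eq_image', forall_mem_image, smul_eq_mul]
  refine ⟨W, ?_, ?_, fun q hq => ⟨hq.1, trivial⟩, ?_, ?_⟩
  · rw [isOpen_iff_mem_nhds]
    intro q hq
    have h1 : ∀ᶠ p in 𝓝 q, ∀ r ∈ Icc (0 : ℝ) 1, (c + r * (p.1 - c), p.2) ∈ interior S := by
      refine isCompact_Icc.eventually_forall_of_forall_eventually fun r hr => ?_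
      have hcont : Continuous fun z : (ℝ × M) × ℝ => (c + z.2 * (z.1.1 - c), z.1.2) := by fun_prop
      exact hcont.continuousAt.eventually (isOpen_interior.mem_nhds (hq.2 r hr))
    have h2 : ∀ᶠ p in 𝓝 q, p.1 ∈ Ioo a b :=
      continuous_fst.continuousAt.eventually (isOpen_Ioo.mem_nhds hq.1)
    filter_upwards [h1, h2] with p hp1 hp2 using ⟨hp2, hp1⟩
  · intro q hq
    have := hq.2 1 (by simp)
    simp only [one_mul, add_sub_cancel] at this
    exact interior_subset this
  · intro k hk
    rw [hWiff]
    refine ⟨hk, fun k' hk' => mem_interior_iff_mem_nhds.2 (hS k' ?_)⟩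
    exact (ordConnected_Ioo.uIcc_subset hcab hk) hk'
  · intro μ
    refine ⟨fun k₁ h₁ k₂ h₂ k hk => ?_⟩
    simp only [mem_ofPred_eq, hWiff] at h₁ h₂ ⊢
    refine ⟨⟨h₁.1.1.trans_le hk.1, hk.2.trans_lt h₂.1.2⟩, fun k' hk' => ?_⟩
    rcases le_total c k with h | h
    · rw [uIcc_of_le h] at hk'
      exact h₂.2 k' (Icc_subset_uIcc ⟨hk'.1, hk'.2.trans hk.2⟩)
    · rw [uIcc_of_ge h] at hk'
      exact h₁.2 k' (Icc_subset_uIcc' ⟨hk.1.trans hk'.1, hk'.2⟩)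

end Slices

/-! ### Semiconjugate flows -/

section Semiconjugacy

variable {E E' : Type} [NormedAddCommGroup E] [NormedSpace ℝ E] [ProperSpace E]
  [NormedAddCommGroup E'] [NormedSpace ℝ E'] [ProperSpace E']

/-- A linear map that semiconjugates two vector fields, up to a constant change of the time scale,
semiconjugates their flows. -/
theorem flow_semiconj {F : E → E} {F' : E' → E'} (hF : ContDiff ℝ ∞ F) (hF' : ContDiff ℝ ∞ F')
    (L : E →L[ℝ] E') (c : ℝ) (h : ∀ x, F' (L x) = c • L (F x)) {t : ℝ} {x : E}
    (hx : (c * t, x) ∈ flowDomain F) :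
    (t, L x) ∈ flowDomain F' ∧ flow F' (t, L x) = L (flow F (c * t, x)) := by
  obtain ⟨u, h0, hu, h1⟩ := exists_isUnitSol_of_mem hF hx
  have hsol : IsUnitSol F' t (fun s => L (u s)) := by
    intro s hs
    have := L.hasFDerivAt.comp_hasDerivWithinAt s (hu s hs)
    refine this.congr_deriv ?_
    rw [h, map_smul, smul_smul, mul_comm]
  have := hsol.flow_eq hF'
  dsimp only at this h0
  rwa [h0, h1] at this

theorem flow_semiconj_one {F : E → E} {F' : E' → E'} (hF : ContDiff ℝ ∞ F) (hF' : ContDiff ℝ ∞ F')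
    (L : E →L[ℝ] E') (h : ∀ x, F' (L x) = L (F x)) {t : ℝ} {x : E}
    (hx : (t, x) ∈ flowDomain F) :
    (t, L x) ∈ flowDomain F' ∧ flow F' (t, L x) = L (flow F (t, x)) := by
  have := flow_semiconj hF hF' L 1 (by simpa using h) (t := t) (x := x) (by simpa using hx)
  simpa using this

theorem flow_zero_field (t : ℝ) (x : E) : flow (fun _ : E => (0 : E)) (t, x) = x :=
  (flow_eq_of_hasDerivAt (F := fun _ : E => (0 : E)) contDiff_const (u := fun _ => x) (t := t)
    (fun s _ => hasDerivAt_const s x)).2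

/-- A linear first integral of a vector field is constant along its flow. -/
theorem flow_firstIntegral {F : E → E} (hF : ContDiff ℝ ∞ F) (L : E →L[ℝ] E')
    (h : ∀ x, L (F x) = 0) {t : ℝ} {x : E} (hx : (t, x) ∈ flowDomain F) :
    L (flow F (t, x)) = L x := by
  have := (flow_semiconj_one (F' := fun _ : E' => (0 : E')) hF contDiff_const L
    (fun x => (h x).symm) hx).2
  rw [← this, flow_zero_field]

/-- Semiconjugacies pass to the derivatives of the flows. -/
theorem fderiv_flow_semiconj {F : E → E} {F' : E' → E'} (hF : ContDiff ℝ ∞ F)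
    (hF' : ContDiff ℝ ∞ F') (L : E →L[ℝ] E') (h : ∀ x, F' (L x) = L (F x)) {t : ℝ} {x : E}
    (hx : (t, x) ∈ flowDomain F) (δ : E) :
    L (fderiv ℝ (flow F) (t, x) (0, δ)) = fderiv ℝ (flow F') (t, L x) (0, L δ) := by
  have hx' := (flow_semiconj_one hF hF' L h hx).1
  have h1 : (fun p => L (flow F p)) =ᶠ[𝓝 (t, x)] fun p => flow F' (p.1, L p.2) := by
    filter_upwards [(isOpen_flowDomain hF).mem_nhds hx] with p hp
    exact (flow_semiconj_one hF hF' L h (t := p.1) (x := p.2) hp).2.symm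
  have h2 : HasFDerivAt (fun p => L (flow F p)) (L ∘L fderiv ℝ (flow F) (t, x)) (t, x) :=
    L.hasFDerivAt.comp (t, x) ((contDiffAt_flow hF hx).differentiableAt (by simp)).hasFDerivAt
  have h3 : HasFDerivAt (fun p : ℝ × E => flow F' (p.1, L p.2))
      (fderiv ℝ (flow F') (t, L x) ∘L
        ((ContinuousLinearMap.fst ℝ ℝ E).prod (L ∘L ContinuousLinearMap.snd ℝ ℝ E))) (t, x) :=
    HasFDerivAt.comp (t, x) (g := flow F') (f := fun p : ℝ × E => (p.1, L p.2))
      ((contDiffAt_flow hF' hx').differentiableAt (by simp)).hasFDerivAt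
      (hasFDerivAt_fst.prodMk (L.hasFDerivAt.comp _ hasFDerivAt_snd))
  have := DFunLike.congr_fun (h2.unique (h3.congr_of_eventuallyEq h1)) (0, δ)
  simpa using this

end Semiconjugacy

/-! ### Jets of functions and shifts -/

section Jets

variable {V : Type} [NormedAddCommGroup V] [NormedSpace ℝ V]

/-- The derivative `(u₁, …, uₙ₋₁, y)` of the jet `(u₀, …, uₙ₋₁)` of a solution of `u⁽ⁿ⁾ = y`. -/
def shiftJet {n : ℕ} (U : Fin n → V) (y : V) : Fin n → V :=
  fun j => if h : (j : ℕ) + 1 < n then U ⟨j + 1, h⟩ else y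

theorem hasDerivAt_iteratedDeriv_jet {n : ℕ} {u : ℝ → V} (hu : ContDiff ℝ n u) (x : ℝ) :
    HasDerivAt (fun x => fun j : Fin n => iteratedDeriv (j : ℕ) u x)
      (shiftJet (fun j : Fin n => iteratedDeriv (j : ℕ) u x) (iteratedDeriv n u x)) x := by
  rw [hasDerivAt_pi]
  intro j
  have h1 : HasDerivAt (fun x => iteratedDeriv (j : ℕ) u x) (iteratedDeriv ((j : ℕ) + 1) u x) x := by
    rw [iteratedDeriv_succ]
    exact ((hu.differentiable_iteratedDeriv j (by exact_mod_cast j.2)) x).hasDerivAt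
  unfold shiftJet
  split_ifs with h
  · exact h1
  · have : (j : ℕ) + 1 = n := by omega
    rw [this] at h1
    exact h1

/-- A solution of the first order system for jets is the jet of its first component. -/
theorem jet_of_hasDerivAt_shiftJet {n : ℕ} [NeZero n] {U : ℝ → Fin n → V} {y : ℝ → V}
    (hU : ∀ x, HasDerivAt U (shiftJet (U x) (y x)) x) :
    (∀ j : Fin n, iteratedDeriv (j : ℕ) (fun x => U x 0) = fun x => U x j) ∧
      iteratedDeriv n (fun x => U x 0) = y := by
  have h1 : ∀ j : ℕ, ∀ h : j < n, iteratedDeriv j (fun x => U x 0) = fun x => U x ⟨j, h⟩ := by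
    intro j
    induction j with
    | zero => intro h; rw [iteratedDeriv_zero]; rfl
    | succ j ih =>
      intro h
      rw [iteratedDeriv_succ, ih (by omega)]
      ext1 x
      have := ((hasDerivAt_pi.1 (hU x)) ⟨j, by omega⟩).deriv
      rw [this]
      simp [shiftJet, h]
  refine ⟨fun j => h1 j j.2, ?_⟩
  obtain ⟨n, rfl⟩ := Nat.exists_eq_succ_of_ne_zero (NeZero.ne n)
  rw [iteratedDeriv_succ, h1 n (by omega)]
  ext1 x
  rw [((hasDerivAt_pi.1 (hU x)) ⟨n, by omega⟩).deriv]
  simp [shiftJet]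

theorem contDiff_of_hasDerivAt_shiftJet {n : ℕ} [NeZero n] {U : ℝ → Fin n → V} {y : ℝ → V}
    (hU : ∀ x, HasDerivAt U (shiftJet (U x) (y x)) x) (hy : Continuous y) :
    ContDiff ℝ n (fun x => U x 0) := by
  obtain ⟨h1, h2⟩ := jet_of_hasDerivAt_shiftJet hU
  have hUj : ∀ j : Fin n, Differentiable ℝ fun x => U x j := fun j x =>
    ((hasDerivAt_pi.1 (hU x)) j).differentiableAt
  rw [show ((n : ℕ) : WithTop ℕ∞) = ((n : ℕ∞) : WithTop ℕ∞) from rfl, contDiff_iff_iteratedDeriv]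
  constructor
  · intro i hi
    have hi' : i ≤ n := by exact_mod_cast hi
    rcases hi'.lt_or_eq with h | h
    · rw [h1 ⟨i, h⟩]
      exact (hUj _).continuous
    · rw [h, h2]
      exact hy
  · intro i hi
    have hi' : i < n := by exact_mod_cast hi
    rw [h1 ⟨i, hi'⟩]
    exact hUj _

end Jets

/-! ### Jets of equilibria and their reflection -/

section RealProfiles

variable {m N : ℕ}

/-- `U` solves the first order system for the jets `(u, u', …, u⁽²ᵐ⁻¹⁾)` of equilibria `u(x)`, that
is, of solutions of `u⁽²ᵐ⁾ = (-1)ᵐ g(u, …, u⁽²ᵐ⁻¹⁾)`. -/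
def IsJetSol (g : (Fin (2 * m) → Fin N → ℝ) → Fin N → ℝ) (U : ℝ → Fin (2 * m) → Fin N → ℝ) :
    Prop :=
  ∀ x, HasDerivAt U (shiftJet (U x) ((-1 : ℝ) ^ m • g (U x))) x

/-- The restriction of a jet to its components of odd order. -/
noncomputable def oddPart (m N : ℕ) : (Fin (2 * m) → Fin N → ℝ) →L[ℝ] (Fin m → Fin N → ℝ) :=
  LinearMap.toContinuousLinearMap
    { toFun := fun U i => U ⟨2 * i + 1, by omega⟩
      map_add' := fun _ _ => rfl
      map_smul' := fun _ _ => rfl }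

/-- The restriction of a jet to its components of even order. -/
noncomputable def evenPart (m N : ℕ) : (Fin (2 * m) → Fin N → ℝ) →L[ℝ] (Fin m → Fin N → ℝ) :=
  LinearMap.toContinuousLinearMap
    { toFun := fun U i => U ⟨2 * i, by omega⟩
      map_add' := fun _ _ => rfl
      map_smul' := fun _ _ => rfl }

/-- The jet with given components of even order and vanishing components of odd order. -/
noncomputable def evenJet (m N : ℕ) : (Fin m → Fin N → ℝ) →L[ℝ] (Fin (2 * m) → Fin N → ℝ) :=
  LinearMap.toContinuousLinearMap
    { toFun := fun a j => if (j : ℕ) % 2 = 0 then a ⟨j / 2, by omega⟩ else 0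
      map_add' := fun a b => by ext j i; simp only [Pi.add_apply]; split_ifs <;> simp
      map_smul' := fun c a => by ext j i; simp only [Pi.smul_apply]; split_ifs <;> simp }

/-- The reflection of jets as a continuous linear map. -/
noncomputable def reflectL (m N : ℕ) :
    (Fin (2 * m) → Fin N → ℝ) →L[ℝ] (Fin (2 * m) → Fin N → ℝ) :=
  LinearMap.toContinuousLinearMap
    { toFun := reflectJet
      map_add' := fun a b => by ext j i; simp [reflectJet, mul_add]
      map_smul' := fun c a => by ext j i; simp [reflectJet]; ring }

@[simp] theorem oddPart_apply (U : Fin (2 * m) → Fin N → ℝ) (i : Fin m) :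
    oddPart m N U i = U ⟨2 * i + 1, by omega⟩ := rfl

@[simp] theorem evenPart_apply (U : Fin (2 * m) → Fin N → ℝ) (i : Fin m) :
    evenPart m N U i = U ⟨2 * i, by omega⟩ := rfl

theorem evenJet_apply (a : Fin m → Fin N → ℝ) (j : Fin (2 * m)) :
    evenJet m N a j = if (j : ℕ) % 2 = 0 then a ⟨j / 2, by omega⟩ else 0 := rfl

@[simp] theorem reflectL_apply (U : Fin (2 * m) → Fin N → ℝ) : reflectL m N U = reflectJet U := rfl

theorem evenPart_evenJet (a : Fin m → Fin N → ℝ) : evenPart m N (evenJet m N a) = a := by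
  ext i b
  rw [evenPart_apply, evenJet_apply]
  simp

/-- The jets that are fixed by the reflection are those of even functions. -/
theorem reflectJet_eq_self_iff (U : Fin (2 * m) → Fin N → ℝ) :
    reflectJet U = U ↔ oddPart m N U = 0 := by
  constructor
  · intro h
    ext i b
    have := congrFun (congrFun h ⟨2 * i + 1, by omega⟩) b
    simp only [reflectJet, Pi.smul_apply, smul_eq_mul, pow_succ, pow_mul] at this
    rw [oddPart_apply, Pi.zero_apply, Pi.zero_apply]
    norm_num at this
    linarith
  · intro h
    ext j b
    rcases Nat.even_or_odd (j : ℕ) with hj | hj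
    · simp [reflectJet, hj.neg_one_pow]
    · obtain ⟨i, hi⟩ := hj
      have := congrFun (congrFun h ⟨i, by omega⟩) b
      have hj' : j = ⟨2 * i + 1, by omega⟩ := Fin.ext hi
      rw [oddPart_apply, Pi.zero_apply, Pi.zero_apply] at this
      dsimp only at this
      rw [reflectJet, Pi.smul_apply, hj', this, smul_zero]

theorem evenJet_evenPart {U : Fin (2 * m) → Fin N → ℝ} (h : oddPart m N U = 0) :
    evenJet m N (evenPart m N U) = U := by
  ext j b
  rw [evenJet_apply]
  split_ifs with hj
  · rw [evenPart_apply]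
    exact congrFun (congrArg U (Fin.ext (by dsimp only; omega))) b
  · have := congrFun (congrFun h ⟨j / 2, by omega⟩) b
    rw [oddPart_apply, Pi.zero_apply, Pi.zero_apply] at this
    rw [Pi.zero_apply, ← this]
    exact congrFun (congrArg U (Fin.ext (by dsimp only; omega))) b

theorem oddPart_evenJet (a : Fin m → Fin N → ℝ) : oddPart m N (evenJet m N a) = 0 := by
  ext i b
  rw [oddPart_apply, evenJet_apply]
  simp [Nat.add_mod]

theorem reflectJet_evenJet (a : Fin m → Fin N → ℝ) :
    reflectJet (evenJet m N a) = evenJet m N a :=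
  (reflectJet_eq_self_iff _).2 (oddPart_evenJet a)

/-- Reflection reverses the direction of the shift. -/
theorem shiftJet_reflectJet (U : Fin (2 * m) → Fin N → ℝ) (y : Fin N → ℝ) :
    shiftJet (reflectJet U) y = (-1 : ℝ) • reflectJet (shiftJet U y) := by
  ext j b
  simp only [shiftJet, reflectJet, Pi.smul_apply, smul_eq_mul]
  split_ifs with h
  · simp only [pow_succ, Pi.smul_apply, smul_eq_mul]
    ring
  · have hj : Odd (j : ℕ) := by
      rw [Nat.odd_iff]; omega
    rw [hj.neg_one_pow]
    ring

theorem shiftJet_add {V : Type} [AddCommGroup V] {n : ℕ} (U U' : Fin n → V) (y y' : V) :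
    shiftJet (U + U') (y + y') = shiftJet U y + shiftJet U' y' := by
  ext j
  simp only [shiftJet, Pi.add_apply]
  split_ifs <;> rfl

theorem shiftJet_smul {R V : Type} [AddCommGroup V] [SMul R V] {n : ℕ} (c : R) (U : Fin n → V)
    (y : V) : shiftJet (c • U) (c • y) = c • shiftJet U y := by
  ext j
  simp only [shiftJet, Pi.smul_apply]
  split_ifs <;> rfl

theorem jet_eq_iteratedDeriv {v : ℝ → Fin N → ℝ} (hv : ContDiff ℝ ((2 * m : ℕ) : WithTop ℕ∞) v)
    (k x : ℝ) : jet m k v (k * x) =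
      fun j : Fin (2 * m) => iteratedDeriv (j : ℕ) (fun x => v (k * x)) x := by
  ext j : 1
  have h1 : ContDiff ℝ (j : ℕ) v := hv.of_le (by exact_mod_cast j.2.le)
  have h2 := congrFun (iteratedDeriv_comp_const_smul h1 k) x
  rw [h2]
  rfl

theorem isJetSol_of_isStationary {g : (Fin (2 * m) → Fin N → ℝ) → Fin N → ℝ} {k : ℝ}
    {v : ℝ → Fin N → ℝ} (hv : ContDiff ℝ ((2 * m : ℕ) : WithTop ℕ∞) v)
    (hs : IsStationary g k v) : IsJetSol g (fun x => jet m k v (k * x)) := by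
  intro x
  have hu : ContDiff ℝ ((2 * m : ℕ) : WithTop ℕ∞) (fun x => v (k * x)) :=
    hv.comp (contDiff_const.mul contDiff_id)
  have h1 := hasDerivAt_iteratedDeriv_jet hu x
  simp only [jet_eq_iteratedDeriv hv]
  convert h1 using 2
  have h2 := hs (k * x)
  rw [jet_eq_iteratedDeriv hv] at h2
  have h3 := congrFun (iteratedDeriv_comp_const_smul hv k) x
  rw [h3, eq_neg_of_add_eq_zero_right h2, smul_neg, smul_smul, ← neg_smul]
  congr 1
  have : (-1 : ℝ) ^ m * (-1) ^ m = 1 := by rw [← mul_pow]; simp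
  linear_combination (k ^ (2 * m)) * this

/-- Solutions of the first order system are jets of classical equilibria. -/
theorem jet_profile [NeZero m] {g : (Fin (2 * m) → Fin N → ℝ) → Fin N → ℝ} {k : ℝ} (hk : 0 < k)
    {U : ℝ → Fin (2 * m) → Fin N → ℝ} (hg : Continuous g) (hU : IsJetSol g U) :
    ContDiff ℝ ((2 * m : ℕ) : WithTop ℕ∞) (fun ξ => U (ξ / k) 0) ∧
    (∀ ξ, jet m k (fun ξ => U (ξ / k) 0) ξ = U (ξ / k)) ∧
      IsStationary g k (fun ξ => U (ξ / k) 0) := by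
  have hc : Continuous U := continuous_iff_continuousAt.2 fun x => (hU x).continuousAt
  obtain ⟨h1, h2⟩ := jet_of_hasDerivAt_shiftJet hU
  have h3 := contDiff_of_hasDerivAt_shiftJet hU 
    ((hg.comp hc).const_smul ((-1 : ℝ) ^ m))
  have h4 : ContDiff ℝ ((2 * m : ℕ) : WithTop ℕ∞) (fun ξ => U (ξ / k) 0) :=
    h3.comp (contDiff_id.div_const k)
  have h5 : (fun x => (fun ξ => U (ξ / k) 0) (k * x)) = fun x => U x 0 := by
    ext1 x
    simp only [mul_div_cancel_left₀ x hk.ne']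
  have h6 : ∀ ξ, jet m k (fun ξ => U (ξ / k) 0) ξ = U (ξ / k) := by
    intro ξ
    have := jet_eq_iteratedDeriv h4 k (ξ / k)
    rw [mul_div_cancel₀ ξ hk.ne', h5] at this
    rw [this]
    ext j : 1
    rw [h1 j]
  refine ⟨h4, h6, fun ξ => ?_⟩
  rw [h6]
  have h7 := congrFun (iteratedDeriv_comp_const_smul h4 k) (ξ / k)
  rw [h5, h2, mul_div_cancel₀ ξ hk.ne'] at h7
  rw [mul_smul, ← h7, smul_smul]
  have : -(-1 : ℝ) ^ m * (-1) ^ m = -1 := by rw [neg_mul, ← mul_pow]; simp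
  rw [this, neg_one_smul, neg_add_cancel]

end RealProfiles

/-! ### Stripes as zeros of a shooting problem -/

section Families

variable {m N : ℕ} {M : Type} [NormedAddCommGroup M] [NormedSpace ℝ M] [FiniteDimensional ℝ M]
  {f : M → (Fin (2 * m) → Fin N → ℝ) → Fin N → ℝ}

/-- The vector field of the first order system for jets, extended by the trivial equation for the
system parameters. -/
def jetField (f : M → (Fin (2 * m) → Fin N → ℝ) → Fin N → ℝ) :
    M × (Fin (2 * m) → Fin N → ℝ) → M × (Fin (2 * m) → Fin N → ℝ) :=
  fun q => (0, shiftJet q.2 ((-1 : ℝ) ^ m • f q.1 q.2))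

theorem contDiff_shiftJet {X V : Type} [NormedAddCommGroup X] [NormedSpace ℝ X]
    [NormedAddCommGroup V] [NormedSpace ℝ V] {n : ℕ} {U : X → Fin n → V} {y : X → V}
    (hU : ContDiff ℝ ∞ U) (hy : ContDiff ℝ ∞ y) : ContDiff ℝ ∞ (fun x => shiftJet (U x) (y x)) := by
  rw [contDiff_pi]
  intro j
  unfold shiftJet
  split_ifs with h
  · exact (contDiff_pi.1 hU) _
  · exact hy

omit [FiniteDimensional ℝ M] in
theorem contDiff_jetField
    (hf : ContDiff ℝ ∞ (fun q : M × (Fin (2 * m) → Fin N → ℝ) => f q.1 q.2)) :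
    ContDiff ℝ ∞ (jetField f) :=
  contDiff_const.prodMk (contDiff_shiftJet contDiff_snd (hf.const_smul ((-1 : ℝ) ^ m)))

/-- Jets of even profiles that are `2π`-periodic in `ξ = k x`, in the variable `x`. -/
structure IsStripeSol (g : (Fin (2 * m) → Fin N → ℝ) → Fin N → ℝ) (k : ℝ)
    (U : ℝ → Fin (2 * m) → Fin N → ℝ) : Prop where
  sol : IsJetSol g U
  periodic : Function.Periodic U (2 * Real.pi / k)
  reflect : ∀ x, U (-x) = reflectJet (U x)

/-- The shooting condition for the even data `a`: the solution with the jet `evenJet a` at `x = 0`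
exists up to the half period `π / k`, and its derivatives of odd order vanish there. -/
def IsZero (f : M → (Fin (2 * m) → Fin N → ℝ) → Fin N → ℝ) (k : ℝ) (μ : M)
    (a : Fin m → Fin N → ℝ) : Prop :=
  (Real.pi / k, (μ, evenJet m N a)) ∈ flowDomain (jetField f) ∧
    oddPart m N (flow (jetField f) (Real.pi / k, (μ, evenJet m N a))).2 = 0

/-- The profile, in `ξ = k x`, of the solution with even data `a`. -/
noncomputable def profile [NeZero m] (f : M → (Fin (2 * m) → Fin N → ℝ) → Fin N → ℝ) (k : ℝ) (μ : M)
    (a : Fin m → Fin N → ℝ) : ℝ → Fin N → ℝ :=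
  fun ξ => (flow (jetField f) (ξ / k, (μ, evenJet m N a))).2 0

theorem flow_jetField_of_isJetSol
    (hf : ContDiff ℝ ∞ (fun q : M × (Fin (2 * m) → Fin N → ℝ) => f q.1 q.2)) {μ : M}
    {U : ℝ → Fin (2 * m) → Fin N → ℝ} (hU : IsJetSol (f μ) U) (t : ℝ) :
    (t, (μ, U 0)) ∈ flowDomain (jetField f) ∧ flow (jetField f) (t, (μ, U 0)) = (μ, U t) :=
  flow_eq_of_hasDerivAt (contDiff_jetField hf) (u := fun s => (μ, U s)) (t := t)
    (fun s _ => (hasDerivAt_const s μ).prodMk (hU s))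

theorem flow_jetField_fst
    (hf : ContDiff ℝ ∞ (fun q : M × (Fin (2 * m) → Fin N → ℝ) => f q.1 q.2)) {t : ℝ}
    {x : M × (Fin (2 * m) → Fin N → ℝ)} (h : (t, x) ∈ flowDomain (jetField f)) :
    (flow (jetField f) (t, x)).1 = x.1 :=
  flow_firstIntegral (contDiff_jetField hf) (ContinuousLinearMap.fst ℝ M _) (fun _ => rfl) h

/-- Reversibility of the flow. -/
theorem flow_jetField_neg
    (hf : ContDiff ℝ ∞ (fun q : M × (Fin (2 * m) → Fin N → ℝ) => f q.1 q.2))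
    (hsymm : ∀ μ U, f μ (reflectJet U) = f μ U) {t : ℝ} {μ : M} {x : Fin (2 * m) → Fin N → ℝ}
    (h : (t, (μ, x)) ∈ flowDomain (jetField f)) :
    (-t, (μ, reflectJet x)) ∈ flowDomain (jetField f) ∧
      (flow (jetField f) (-t, (μ, reflectJet x))).2
        = reflectJet (flow (jetField f) (t, (μ, x))).2 := by
  have hF := contDiff_jetField hf
  have := flow_semiconj hF hF
    (((ContinuousLinearMap.id ℝ M).prodMap (reflectL m N))) (-1) (fun q => by
      ext1
      · simp [jetField]
      · change shiftJet (reflectJet q.2) ((-1 : ℝ) ^ m • f q.1 (reflectJet q.2)) =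
          (-1 : ℝ) • reflectJet (shiftJet q.2 ((-1 : ℝ) ^ m • f q.1 q.2))
        rw [hsymm, shiftJet_reflectJet]) (t := -t) (x := (μ, x)) (by simpa using h)
  refine ⟨this.1, ?_⟩
  have h2 := congrArg Prod.snd this.2
  simpa using h2

/-- Solutions of the shooting problem are stripes: by reversibility, the solution on `[0, π / k]`
extends evenly to `[-π / k, π / k]`, with equal values at the end points, and then periodically. -/
theorem exists_isStripeSol_of_isZero
    (hf : ContDiff ℝ ∞ (fun q : M × (Fin (2 * m) → Fin N → ℝ) => f q.1 q.2))
    (hsymm : ∀ μ U, f μ (reflectJet U) = f μ U) {k : ℝ} (hk : 0 < k) {μ : M}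
    {a : Fin m → Fin N → ℝ} (h : IsZero f k μ a) :
    ∃ U, IsStripeSol (f μ) k U ∧ U 0 = evenJet m N a := by
  have hF := contDiff_jetField hf
  set T : ℝ := Real.pi / k with hT
  have hTpos : 0 < T := div_pos Real.pi_pos hk
  set x₀ := evenJet m N a with hx₀
  have hRx : reflectJet x₀ = x₀ := reflectJet_evenJet a
  have hdom : ∀ s ∈ Icc (-T) T, (s, (μ, x₀)) ∈ flowDomain (jetField f) := by
    intro s hs
    rcases le_total 0 s with h0 | h0
    · exact mem_flowDomain_of_mem_uIcc hF h.1 (Icc_subset_uIcc ⟨h0, hs.2⟩)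
    · have h1 : (-s, (μ, x₀)) ∈ flowDomain (jetField f) :=
        mem_flowDomain_of_mem_uIcc hF h.1 (Icc_subset_uIcc ⟨by linarith, by linarith [hs.1]⟩)
      have h2 := (flow_jetField_neg hf hsymm h1).1
      rwa [neg_neg, hRx] at h2
  obtain ⟨U, hU, hper, hUeq⟩ := exists_periodic_extension (E := Fin (2 * m) → Fin N → ℝ)
    (F := fun U => shiftJet U ((-1 : ℝ) ^ m • f μ U)) hTpos
    (u := fun s => (flow (jetField f) (s, (μ, x₀))).2) (fun s hs => by
      have h1 := hasDerivAt_flow hF (hdom s hs)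
      have h2 := flow_jetField_fst hf (hdom s hs)
      have h3 := hasFDerivAt_snd.comp_hasDerivAt s h1
      simpa [jetField, h2, Function.comp_def] using h3) (by
      have h1 := (flow_jetField_neg hf hsymm h.1).2
      rw [hRx] at h1
      exact h1.trans ((reflectJet_eq_self_iff _).2 h.2))
  have hU0 : U 0 = x₀ := by
    rw [hUeq 0 ⟨by linarith, hTpos.le⟩, (flow_zero hF _).2]
  have hUsol : IsJetSol (f μ) U := hU
  refine ⟨U, ⟨hU, by rwa [mul_div_assoc], fun x => ?_⟩, hU0⟩
  have h1 := flow_jetField_of_isJetSol hf hUsol x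
  have h2 := flow_jetField_of_isJetSol hf hUsol (-x)
  have h3 := (flow_jetField_neg hf hsymm h1.1).2
  rw [hU0] at h1 h2 h3
  rw [hRx, h1.2, h2.2] at h3
  exact h3

/-- Stripes solve the shooting problem: they are even about `0`, and by periodicity also about `π / k`. -/
theorem IsStripeSol.isZero
    (hf : ContDiff ℝ ∞ (fun q : M × (Fin (2 * m) → Fin N → ℝ) => f q.1 q.2)) {k : ℝ} {μ : M}
    {U : ℝ → Fin (2 * m) → Fin N → ℝ} (hU : IsStripeSol (f μ) k U) :
    evenJet m N (evenPart m N (U 0)) = U 0 ∧ IsZero f k μ (evenPart m N (U 0)) := by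
  have h0 : evenJet m N (evenPart m N (U 0)) = U 0 := by
    refine evenJet_evenPart ((reflectJet_eq_self_iff _).1 ?_)
    rw [← hU.reflect, neg_zero]
  have h1 := flow_jetField_of_isJetSol hf hU.sol (Real.pi / k)
  refine ⟨h0, ?_, ?_⟩
  · rw [h0]
    exact h1.1
  · rw [h0, h1.2, ← reflectJet_eq_self_iff, ← hU.reflect, ← hU.periodic]
    congr 1
    ring

theorem IsStripeSol.profile_eq [NeZero m]
    (hf : ContDiff ℝ ∞ (fun q : M × (Fin (2 * m) → Fin N → ℝ) => f q.1 q.2)) {k : ℝ} {μ : M}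
    {U : ℝ → Fin (2 * m) → Fin N → ℝ} (hU : IsStripeSol (f μ) k U) {a : Fin m → Fin N → ℝ}
    (ha : U 0 = evenJet m N a) : profile f k μ a = fun ξ => U (ξ / k) 0 := by
  ext1 ξ
  rw [profile, ← ha, (flow_jetField_of_isJetSol hf hU.sol (ξ / k)).2]

theorem IsStripe.isStripeSol {g : (Fin (2 * m) → Fin N → ℝ) → Fin N → ℝ} {k : ℝ}
    {v : ℝ → Fin N → ℝ} (hv : IsStripe g k v) : IsStripeSol g k (fun x => jet m k v (k * x)) := by
  refine ⟨isJetSol_of_isStationary hv.contDiff hv.stationary, fun x => ?_, fun x => ?_⟩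
  · have h1 : k * (x + 2 * Real.pi / k) = k * x + 2 * Real.pi := by
      have := hv.wavenumber_pos.ne'
      field_simp
    have h2 : (fun y => v (y + 2 * Real.pi)) = v := funext hv.periodic
    ext j : 1
    simp only [jet, h1]
    have h3 := congrFun (iteratedDeriv_comp_add_const (j : ℕ) v (2 * Real.pi)) (k * x)
    rw [h2] at h3
    rw [h3]
  · ext j : 1
    simp only [jet, reflectJet, mul_neg]
    have h2 : (fun y => v (-y)) = v := funext hv.even
    have h3 := iteratedDeriv_comp_neg (j : ℕ) v (-(k * x))
    rw [h2, neg_neg] at h3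
    rw [h3, smul_comm]

theorem IsStripeSol.isStripe [NeZero m] {g : (Fin (2 * m) → Fin N → ℝ) → Fin N → ℝ}
    (hg : Continuous g) {k : ℝ}
    (hk : 0 < k) {U : ℝ → Fin (2 * m) → Fin N → ℝ} (hU : IsStripeSol g k U)
    (hnc : ∃ x, U x 0 ≠ U 0 0) : IsStripe g k (fun ξ => U (ξ / k) 0) := by
  obtain ⟨h1, h2, h3⟩ := jet_profile hk hg hU.sol
  refine ⟨hk, h1, fun ξ => ?_, fun ξ => ?_, ?_, h3⟩
  · rw [add_div, hU.periodic]
  · rw [neg_div, hU.reflect]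
    simp [reflectJet]
  · obtain ⟨x, hx⟩ := hnc
    refine ⟨k * x, ?_⟩
    simpa [mul_div_cancel_left₀ x hk.ne'] using hx

end Families

/-! ### The Floquet transform -/

section Twist

variable {m N : ℕ}

/-- The Floquet transform `x ↦ exp(i ℓ x) w(k x)`, which turns `k ∂_ξ + i ℓ` into `∂ₓ`. -/
noncomputable def twist (k ℓ : ℝ) (w : ℝ → Fin N → ℂ) (x : ℝ) : Fin N → ℂ :=
  Complex.exp (Complex.I * ℓ * x) • w (k * x)

theorem twist_eq_iff {k ℓ x : ℝ} {w w' : ℝ → Fin N → ℂ} :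
    twist k ℓ w x = twist k ℓ w' x ↔ w (k * x) = w' (k * x) :=
  (smul_right_injective _ (Complex.exp_ne_zero _)).eq_iff

theorem hasDerivAt_cexp_mul (c : ℂ) (x : ℝ) :
    HasDerivAt (fun x : ℝ => Complex.exp (c * x)) (Complex.exp (c * x) * c) x := by
  have h1 : HasDerivAt (fun x : ℝ => c * (x : ℂ)) c x := by
    simpa using (Complex.ofRealCLM.hasDerivAt (x := x)).const_mul c
  exact h1.cexp

theorem hasDerivAt_twist {k ℓ x : ℝ} {w : ℝ → Fin N → ℂ} (hw : DifferentiableAt ℝ w (k * x)) :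
    HasDerivAt (twist k ℓ w) (twist k ℓ (blochDeriv k ℓ w) x) x := by
  have h2 : HasDerivAt (fun x => w (k * x)) (k • deriv w (k * x)) x := by
    have h3 : HasDerivAt (fun x : ℝ => k * x) k x := by simpa using (hasDerivAt_id x).const_mul k
    exact hw.hasDerivAt.scomp x h3
  have h4 := (hasDerivAt_cexp_mul (Complex.I * ℓ) x).smul h2
  refine h4.congr_deriv ?_
  simp only [twist, blochDeriv, smul_add, mul_smul]
  ext a
  simp

theorem contDiff_blochDeriv {k ℓ : ℝ} {w : ℝ → Fin N → ℂ} {n : ℕ}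
    (hw : ContDiff ℝ ((n + 1 : ℕ) : WithTop ℕ∞) w) : ContDiff ℝ n (blochDeriv k ℓ w) := by
  have h1 : ContDiff ℝ n (deriv w) := by
    rw [Nat.cast_add, Nat.cast_one, contDiff_succ_iff_deriv] at hw
    exact hw.2.2
  exact (h1.const_smul (k : ℂ)).add
    ((hw.of_le (by exact_mod_cast Nat.le_succ n)).const_smul (Complex.I * (ℓ : ℂ)))

theorem contDiff_iterate_blochDeriv {k ℓ : ℝ} {w : ℝ → Fin N → ℂ} {n j i : ℕ}
    (hw : ContDiff ℝ n w) (hj : j + i = n) : ContDiff ℝ i ((blochDeriv k ℓ)^[j] w) := by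
  induction j generalizing i with
  | zero =>
    obtain rfl : i = n := by omega
    exact hw
  | succ j ih =>
    rw [Function.iterate_succ_apply']
    exact contDiff_blochDeriv (ih (i := i + 1) (by omega))

theorem iteratedDeriv_twist {k ℓ : ℝ} {w : ℝ → Fin N → ℂ} {n j : ℕ}
    (hw : ContDiff ℝ n w) (hj : j ≤ n) :
    iteratedDeriv j (twist k ℓ w) = twist k ℓ ((blochDeriv k ℓ)^[j] w) := by
  induction j with
  | zero => simp
  | succ j ih =>
    rw [iteratedDeriv_succ, ih (by omega), Function.iterate_succ_apply']
    ext1 x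
    have h1 : ContDiff ℝ ((n - j : ℕ) : WithTop ℕ∞) ((blochDeriv k ℓ)^[j] w) :=
      contDiff_iterate_blochDeriv hw (by omega)
    have h2 : ((n - j : ℕ) : WithTop ℕ∞) ≠ 0 := by
      have : n - j ≠ 0 := by omega
      exact_mod_cast this
    exact (hasDerivAt_twist ((h1.differentiable h2) _)).deriv

theorem contDiff_twist {k ℓ : ℝ} {w : ℝ → Fin N → ℂ} {n : ℕ} (hw : ContDiff ℝ n w) :
    ContDiff ℝ n (twist k ℓ w) := by
  have h1 : ContDiff ℝ n (fun x : ℝ => Complex.exp (Complex.I * ℓ * x)) :=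
    (contDiff_const.mul Complex.ofRealCLM.contDiff).cexp
  exact h1.smul (hw.comp (contDiff_const.mul contDiff_id))

theorem continuous_twist {k ℓ : ℝ} {w : ℝ → Fin N → ℂ} (hw : Continuous w) :
    Continuous (twist k ℓ w) := by
  have h1 : Continuous (fun x : ℝ => Complex.exp (Complex.I * ℓ * x)) :=
    Complex.continuous_exp.comp (continuous_const.mul Complex.continuous_ofReal)
  exact h1.smul (hw.comp (continuous_const.mul continuous_id))

theorem periodic_blochDeriv {k ℓ T : ℝ} {w : ℝ → Fin N → ℂ} (hw : Function.Periodic w T) :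
    Function.Periodic (blochDeriv k ℓ w) T := by
  intro x
  have h1 : deriv w (x + T) = deriv w x := by
    have := deriv_comp_add_const w T x
    rw [show (fun x => w (x + T)) = w from funext hw] at this
    exact this.symm
  simp only [blochDeriv, h1, hw x]

theorem periodic_iterate_blochDeriv {k ℓ T : ℝ} {w : ℝ → Fin N → ℂ} (hw : Function.Periodic w T)
    (j : ℕ) : Function.Periodic ((blochDeriv k ℓ)^[j] w) T := by
  induction j with
  | zero => exact hw
  | succ j ih =>
    rw [Function.iterate_succ_apply']
    exact periodic_blochDeriv ih

theorem twist_add_period {k ℓ : ℝ} (hk : k ≠ 0) {w : ℝ → Fin N → ℂ}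
    (hw : Function.Periodic w (2 * Real.pi)) (x : ℝ) :
    twist k ℓ w (x + 2 * Real.pi / k) =
      Complex.exp (2 * Real.pi * Complex.I * (ℓ / k : ℝ)) • twist k ℓ w x := by
  have h1 : k * (x + 2 * Real.pi / k) = k * x + 2 * Real.pi := by field_simp
  rw [twist, h1, hw, twist, smul_smul, ← Complex.exp_add]
  congr 2
  push_cast
  ring

end Twist

/-! ### Bloch operators as first order systems -/

section Linearization

variable {m N : ℕ}

/-- The Jacobian matrix of `g` in its `j`-th slot at the jet `U`, with complex entries. -/
noncomputable def coeffMat (g : (Fin (2 * m) → Fin N → ℝ) → Fin N → ℝ)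
    (U : Fin (2 * m) → Fin N → ℝ) (j : Fin (2 * m)) : Matrix (Fin N) (Fin N) ℂ :=
  Matrix.of fun a b => ((fderiv ℝ g U (Pi.single j (Pi.single b (1 : ℝ))) a : ℝ) : ℂ)

/-- The complexified derivative of `g` at the jet `U`. -/
noncomputable def linTerm (g : (Fin (2 * m) → Fin N → ℝ) → Fin N → ℝ)
    (U : Fin (2 * m) → Fin N → ℝ) (Y : Fin (2 * m) → Fin N → ℂ) : Fin N → ℂ :=
  ∑ j, (coeffMat g U j).mulVec (Y j)

theorem linTerm_add (g : (Fin (2 * m) → Fin N → ℝ) → Fin N → ℝ)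
    (U : Fin (2 * m) → Fin N → ℝ) (Y Z : Fin (2 * m) → Fin N → ℂ) :
    linTerm g U (Y + Z) = linTerm g U Y + linTerm g U Z := by
  simp [linTerm, Matrix.mulVec_add, Finset.sum_add_distrib]

theorem linTerm_smul (g : (Fin (2 * m) → Fin N → ℝ) → Fin N → ℝ)
    (U : Fin (2 * m) → Fin N → ℝ) (c : ℂ) (Y : Fin (2 * m) → Fin N → ℂ) :
    linTerm g U (c • Y) = c • linTerm g U Y := by
  simp [linTerm, Matrix.mulVec_smul, Finset.smul_sum]

/-- The entrywise inclusion of real jets into complex jets. -/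
noncomputable def complexJet (m N : ℕ) :
    (Fin (2 * m) → Fin N → ℝ) →L[ℝ] (Fin (2 * m) → Fin N → ℂ) :=
  LinearMap.toContinuousLinearMap
    { toFun := fun V j b => (V j b : ℂ)
      map_add' := fun _ _ => by ext; simp
      map_smul' := fun _ _ => by ext; simp }

@[simp] theorem complexJet_apply (V : Fin (2 * m) → Fin N → ℝ) (j : Fin (2 * m)) (b : Fin N) :
    complexJet m N V j b = (V j b : ℂ) := rfl

theorem linTerm_complexJet (g : (Fin (2 * m) → Fin N → ℝ) → Fin N → ℝ)
    (U V : Fin (2 * m) → Fin N → ℝ) :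
    linTerm g U (complexJet m N V) = fun a => ((fderiv ℝ g U V a : ℝ) : ℂ) := by
  have hV : V = ∑ j, ∑ b, V j b • (Pi.single j (Pi.single b (1 : ℝ)) :
      Fin (2 * m) → Fin N → ℝ) := by
    ext j b
    simp only [Finset.sum_apply, Pi.smul_apply, smul_eq_mul]
    rw [Finset.sum_eq_single j]
    · rw [Finset.sum_eq_single b] <;> simp +contextual [eq_comm]
    · intro i _ hi
      simp [Pi.single_eq_of_ne' hi]
    · simp
  ext a
  conv_rhs => rw [hV]
  simp only [map_sum, map_smul, Finset.sum_apply, Pi.smul_apply, smul_eq_mul, Complex.ofReal_sum,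
    Complex.ofReal_mul]
  simp only [linTerm, Finset.sum_apply, Matrix.mulVec, dotProduct, coeffMat, Matrix.of_apply,
    complexJet_apply]
  exact Finset.sum_congr rfl fun j _ => Finset.sum_congr rfl fun b _ => mul_comm _ _

/-- The right hand side of the eigenvalue problem, as a linear first order system for the complex
jet `Y`. -/
noncomputable def linField [NeZero m] (g : (Fin (2 * m) → Fin N → ℝ) → Fin N → ℝ)
    (z : ℂ) (U : Fin (2 * m) → Fin N → ℝ) :
    (Fin (2 * m) → Fin N → ℂ) →L[ℂ] (Fin (2 * m) → Fin N → ℂ) :=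
  LinearMap.toContinuousLinearMap
    { toFun := fun Y => shiftJet Y ((-1 : ℂ) ^ m • (linTerm g U Y - z • Y 0))
      map_add' := fun Y Z => by
        rw [← shiftJet_add, ← smul_add, linTerm_add, Pi.add_apply, smul_add]
        congr 2
        abel
      map_smul' := fun c Y => by
        rw [RingHom.id_apply, ← shiftJet_smul, linTerm_smul, Pi.smul_apply, smul_comm z c,
          ← smul_sub, smul_comm _ c] }

theorem linField_apply [NeZero m] (g : (Fin (2 * m) → Fin N → ℝ) → Fin N → ℝ)
    (z : ℂ) (U : Fin (2 * m) → Fin N → ℝ) (Y : Fin (2 * m) → Fin N → ℂ) :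
    linField g z U Y = shiftJet Y ((-1 : ℂ) ^ m • (linTerm g U Y - z • Y 0)) := rfl

theorem contDiff_linTerm {M : Type} [NormedAddCommGroup M] [NormedSpace ℝ M]
    {f : M → (Fin (2 * m) → Fin N → ℝ) → Fin N → ℝ}
    (hf : ContDiff ℝ ∞ (fun q : M × (Fin (2 * m) → Fin N → ℝ) => f q.1 q.2))
    {X : Type} [NormedAddCommGroup X] [NormedSpace ℝ X] {μ : X → M}
    {U : X → Fin (2 * m) → Fin N → ℝ} {Y : X → Fin (2 * m) → Fin N → ℂ} {n : WithTop ℕ∞}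
    (hn : n ≤ ∞) (hμ : ContDiff ℝ n μ) (hU : ContDiff ℝ n U) (hY : ContDiff ℝ n Y) :
    ContDiff ℝ n (fun x => linTerm (f (μ x)) (U x) (Y x)) := by
  have h0 : ContDiff ℝ ∞ (fun q : M × (Fin (2 * m) → Fin N → ℝ) => fderiv ℝ (f q.1) q.2) :=
    ContDiff.fderiv (f := fun (q : M × (Fin (2 * m) → Fin N → ℝ)) (U : Fin (2 * m) → Fin N → ℝ) =>
      f q.1 U) (g := fun q => q.2)
      (hf.comp ((contDiff_fst.comp contDiff_fst).prodMk contDiff_snd)) contDiff_snd (by simp)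
  have h1 : ContDiff ℝ n (fun x => fderiv ℝ (f (μ x)) (U x)) :=
    (h0.of_le hn).comp (hμ.prodMk hU)
  unfold linTerm
  refine ContDiff.sum fun j _ => ?_
  rw [contDiff_pi]
  intro a
  simp only [Matrix.mulVec, dotProduct]
  refine ContDiff.sum fun b _ => ?_
  refine ContDiff.mul ?_ ((contDiff_pi.1 ((contDiff_pi.1 hY) j)) b)
  simp only [coeffMat, Matrix.of_apply]
  exact Complex.ofRealCLM.contDiff.comp ((contDiff_pi.1 (h1.clm_apply contDiff_const)) a)

theorem contDiff_linTerm' {g : (Fin (2 * m) → Fin N → ℝ) → Fin N → ℝ} (hg : ContDiff ℝ ∞ g)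
    {X : Type} [NormedAddCommGroup X] [NormedSpace ℝ X]
    {U : X → Fin (2 * m) → Fin N → ℝ} {Y : X → Fin (2 * m) → Fin N → ℂ} {n : WithTop ℕ∞}
    (hn : n ≤ ∞) (hU : ContDiff ℝ n U) (hY : ContDiff ℝ n Y) :
    ContDiff ℝ n (fun x => linTerm g (U x) (Y x)) :=
  contDiff_linTerm (M := ℝ) (f := fun _ => g) (μ := fun _ => 0) (hg.comp contDiff_snd) hn
    contDiff_const hU hY

theorem continuous_linTerm {g : (Fin (2 * m) → Fin N → ℝ) → Fin N → ℝ} (hg : ContDiff ℝ ∞ g) :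
    Continuous fun q : (Fin (2 * m) → Fin N → ℝ) × (Fin (2 * m) → Fin N → ℂ) =>
      linTerm g q.1 q.2 := by
  have h1 : ContDiff ℝ 0 fun q : (Fin (2 * m) → Fin N → ℝ) × (Fin (2 * m) → Fin N → ℂ) =>
      linTerm g q.1 q.2 := contDiff_linTerm' hg (by simp) contDiff_fst contDiff_snd
  exact h1.continuous

theorem continuous_linField [NeZero m] {g : (Fin (2 * m) → Fin N → ℝ) → Fin N → ℝ}
    (hg : ContDiff ℝ ∞ g) {z : ℂ} {U : ℝ → Fin (2 * m) → Fin N → ℝ} (hU : Continuous U) :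
    Continuous fun x => (linField g z (U x)).restrictScalars ℝ := by
  rw [continuous_clm_apply]
  intro Y
  change Continuous fun x => shiftJet Y ((-1 : ℂ) ^ m • (linTerm g (U x) Y - z • Y 0))
  have h1 : Continuous fun U => linTerm g U Y :=
    (contDiff_linTerm' hg (n := 0) (by simp) contDiff_id contDiff_const).continuous
  refine continuous_pi fun j => ?_
  unfold shiftJet
  split_ifs with h
  · exact continuous_const
  · exact ((h1.comp hU).sub continuous_const).const_smul ((-1 : ℂ) ^ m)

theorem neg_I_pow (m : ℕ) : -Complex.I ^ (2 * m) = -(-1 : ℂ) ^ m := by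
  rw [pow_mul, Complex.I_sq]

/-- The Bloch equation `L_ℓ w = r` as a first order system for the jet of the Floquet transform
of `w`. -/
theorem hasDerivAt_twistJet {g : (Fin (2 * m) → Fin N → ℝ) → Fin N → ℝ} {k ℓ : ℝ} (hk : k ≠ 0)
    {v : ℝ → Fin N → ℝ} {U : ℝ → Fin (2 * m) → Fin N → ℝ} (hv : ∀ ξ, jet m k v ξ = U (ξ / k))
    {w r : ℝ → Fin N → ℂ} (hw : IsBlochFunction m w) (h : ∀ ξ, blochOp g k v ℓ w ξ = r ξ) (x : ℝ) :
    HasDerivAt (fun x => fun j : Fin (2 * m) => twist k ℓ ((blochDeriv k ℓ)^[(j : ℕ)] w) x)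
      (shiftJet (fun j : Fin (2 * m) => twist k ℓ ((blochDeriv k ℓ)^[(j : ℕ)] w) x)
        ((-1 : ℂ) ^ m • (linTerm g (U x)
          (fun j : Fin (2 * m) => twist k ℓ ((blochDeriv k ℓ)^[(j : ℕ)] w) x)
            - twist k ℓ r x))) x := by
  have h1 := hasDerivAt_iteratedDeriv_jet (contDiff_twist (k := k) (ℓ := ℓ) hw.1) x
  have h2 : ∀ x, (fun j : Fin (2 * m) => iteratedDeriv (j : ℕ) (twist k ℓ w) x) =
      fun j : Fin (2 * m) => twist k ℓ ((blochDeriv k ℓ)^[(j : ℕ)] w) x := by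
    intro x
    ext j : 1
    rw [iteratedDeriv_twist hw.1 j.2.le]
  rw [funext h2, h2 x] at h1
  convert h1 using 2
  rw [iteratedDeriv_twist hw.1 le_rfl]
  have h3 := h (k * x)
  have h4 : ∀ j, coeff g k v j (k * x) = coeffMat g (U x) j := by
    intro j
    unfold coeff coeffMat
    rw [hv, mul_div_cancel_left₀ x hk]
  simp only [blochOp, h4, neg_I_pow] at h3
  have h5 : linTerm g (U x) (fun j : Fin (2 * m) => twist k ℓ ((blochDeriv k ℓ)^[(j : ℕ)] w) x) =
      Complex.exp (Complex.I * ℓ * x) •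
        ∑ j : Fin (2 * m), (coeffMat g (U x) j).mulVec ((blochDeriv k ℓ)^[(j : ℕ)] w (k * x)) := by
    simp only [linTerm, twist, Matrix.mulVec_smul, Finset.smul_sum]
  rw [h5, twist, twist, ← h3, ← smul_sub, sub_add_cancel_right, smul_comm, neg_smul, neg_neg,
    smul_smul ((-1 : ℂ) ^ m)]
  rw [← mul_pow]
  simp

/-- The inverse of the Floquet transform, for the first component of a complex jet. -/
noncomputable def untwist [NeZero m] (k ℓ : ℝ) (Y : ℝ → Fin (2 * m) → Fin N → ℂ) (ξ : ℝ) :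
    Fin N → ℂ :=
  Complex.exp (-(Complex.I * ℓ) * (ξ / k : ℝ)) • Y (ξ / k) 0

theorem twist_untwist [NeZero m] {k : ℝ} (hk : k ≠ 0) (ℓ : ℝ) (Y : ℝ → Fin (2 * m) → Fin N → ℂ) :
    twist k ℓ (untwist k ℓ Y) = fun x => Y x 0 := by
  ext1 x
  rw [twist, untwist, mul_div_cancel_left₀ x hk, smul_smul, ← Complex.exp_add]
  simp

theorem contDiff_untwist [NeZero m] {k ℓ : ℝ} {n : ℕ} {Y : ℝ → Fin (2 * m) → Fin N → ℂ}
    (hY : ContDiff ℝ n fun x => Y x 0) : ContDiff ℝ n (untwist k ℓ Y) := by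
  have h1 : ContDiff ℝ n (fun x : ℝ => Complex.exp (-(Complex.I * ℓ) * x)) :=
    (contDiff_const.mul Complex.ofRealCLM.contDiff).cexp
  exact (h1.smul hY).comp (g := fun x : ℝ => Complex.exp (-(Complex.I * ℓ) * x) • Y x 0)
    (f := fun ξ => ξ / k) (contDiff_id.div_const k)

/-- Floquet solutions of the first order system yield Bloch functions. -/
theorem blochOp_untwist [NeZero m] {g : (Fin (2 * m) → Fin N → ℝ) → Fin N → ℝ}
    (hg : ContDiff ℝ ∞ g) {k ℓ : ℝ} (hk : k ≠ 0)
    {v : ℝ → Fin N → ℝ} {U : ℝ → Fin (2 * m) → Fin N → ℝ} (hU : Continuous U)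
    (hv : ∀ ξ, jet m k v ξ = U (ξ / k))
    {Y : ℝ → Fin (2 * m) → Fin N → ℂ} {r : ℝ → Fin N → ℂ} (hr : Continuous r)
    (hY : ∀ x, HasDerivAt Y (shiftJet (Y x)
      ((-1 : ℂ) ^ m • (linTerm g (U x) (Y x) - twist k ℓ r x))) x)
    (hper : ∀ x, Y (x + 2 * Real.pi / k) =
      Complex.exp (2 * Real.pi * Complex.I * (ℓ / k : ℝ)) • Y x) :
    IsBlochFunction m (untwist k ℓ Y) ∧ ∀ ξ, blochOp g k v ℓ (untwist k ℓ Y) ξ = r ξ := by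
  have hYc : Continuous Y := continuous_iff_continuousAt.2 fun x => (hY x).continuousAt
  have hrt : Continuous (twist k ℓ r) := continuous_twist hr
  have hlt : Continuous fun x => linTerm g (U x) (Y x) :=
    Continuous.comp (g := fun q : (Fin (2 * m) → Fin N → ℝ) × (Fin (2 * m) → Fin N → ℂ) =>
      linTerm g q.1 q.2) (f := fun x => (U x, Y x)) (continuous_linTerm hg) (hU.prodMk hYc)
  have h1 := contDiff_of_hasDerivAt_shiftJet hY ((hlt.sub hrt).const_smul ((-1 : ℂ) ^ m))
  obtain ⟨h2, h3⟩ := jet_of_hasDerivAt_shiftJet hY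
  have hw := contDiff_untwist (k := k) (ℓ := ℓ) h1
  have hwp : Function.Periodic (untwist k ℓ Y) (2 * Real.pi) := by
    intro ξ
    rw [untwist, untwist, add_div, hper, Pi.smul_apply, smul_smul, ← Complex.exp_add]
    congr 2
    push_cast
    ring
  refine ⟨⟨hw, hwp⟩, fun ξ => ?_⟩
  have hj : ∀ j : ℕ, ∀ hj : j < 2 * m, ∀ x,
      twist k ℓ ((blochDeriv k ℓ)^[j] (untwist k ℓ Y)) x = Y x ⟨j, hj⟩ := by
    intro j hj x
    rw [← iteratedDeriv_twist hw hj.le, twist_untwist hk]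
    exact congrFun (h2 ⟨j, hj⟩) x
  have hlast : ∀ x, twist k ℓ ((blochDeriv k ℓ)^[2 * m] (untwist k ℓ Y)) x =
      (-1 : ℂ) ^ m • (linTerm g (U x) (Y x) - twist k ℓ r x) := by
    intro x
    rw [← iteratedDeriv_twist hw le_rfl, twist_untwist hk]
    exact congrFun h3 x
  set x := ξ / k with hx
  have hξ : ξ = k * x := by rw [hx, mul_div_cancel₀ ξ hk]
  have h4 : ∀ j, coeff g k v j ξ = coeffMat g (U x) j := by
    intro j
    unfold coeff coeffMat
    rw [hv]
  have h5 : linTerm g (U x) (Y x) = Complex.exp (Complex.I * ℓ * x) •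
      ∑ j : Fin (2 * m), (coeffMat g (U x) j).mulVec
        ((blochDeriv k ℓ)^[(j : ℕ)] (untwist k ℓ Y) (k * x)) := by
    simp only [linTerm, Finset.smul_sum, ← Matrix.mulVec_smul]
    refine Finset.sum_congr rfl fun j _ => ?_
    rw [← hj j j.2 x]
    rfl
  have h6 := hlast x
  rw [h5, twist, twist, ← smul_sub, smul_comm] at h6
  have h7 := smul_right_injective (Fin N → ℂ) (Complex.exp_ne_zero _) h6
  simp only [blochOp, h4, neg_I_pow]
  rw [hξ, h7, smul_smul, neg_mul, ← mul_pow]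
  simp

end Linearization

/-! ### Solutions of the linearized system -/

section LinearSolutions

variable {m N : ℕ} [NeZero m]

/-- `Y` solves the first order system that corresponds to `(L - z) w = r`, with forcing `R`. -/
def IsLinSol (g : (Fin (2 * m) → Fin N → ℝ) → Fin N → ℝ) (U : ℝ → Fin (2 * m) → Fin N → ℝ)
    (z : ℂ) (R : ℝ → Fin N → ℂ) (Y : ℝ → Fin (2 * m) → Fin N → ℂ) : Prop :=
  ∀ x, HasDerivAt Y
    (shiftJet (Y x) ((-1 : ℂ) ^ m • (linTerm g (U x) (Y x) - z • Y x 0 - R x))) x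

theorem shiftJet_forced (g : (Fin (2 * m) → Fin N → ℝ) → Fin N → ℝ) (z : ℂ)
    (U : Fin (2 * m) → Fin N → ℝ) (Y : Fin (2 * m) → Fin N → ℂ) (R : Fin N → ℂ) :
    shiftJet Y ((-1 : ℂ) ^ m • (linTerm g U Y - z • Y 0 - R)) =
      linField g z U Y + shiftJet 0 (-((-1 : ℂ) ^ m • R)) := by
  rw [linField_apply, ← shiftJet_add, add_zero, smul_sub _ _ R, sub_eq_add_neg]

theorem IsLinSol.unique {g : (Fin (2 * m) → Fin N → ℝ) → Fin N → ℝ} (hg : ContDiff ℝ ∞ g)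
    {U : ℝ → Fin (2 * m) → Fin N → ℝ} (hU : Continuous U) {z : ℂ} {R : ℝ → Fin N → ℂ}
    {Y Z : ℝ → Fin (2 * m) → Fin N → ℂ} (hY : IsLinSol g U z R Y) (hZ : IsLinSol g U z R Z)
    {x : ℝ} (h : Y x = Z x) : Y = Z := by
  refine linearODE_unique (continuous_linField hg hU (z := z))
    (g := fun x => shiftJet 0 (-((-1 : ℂ) ^ m • R x))) (fun x => ?_) (fun x => ?_) h
  · exact (hY x).congr_deriv (shiftJet_forced _ _ _ _ _)
  · exact (hZ x).congr_deriv (shiftJet_forced _ _ _ _ _)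

theorem IsLinSol.smul {g : (Fin (2 * m) → Fin N → ℝ) → Fin N → ℝ}
    {U : ℝ → Fin (2 * m) → Fin N → ℝ} {z : ℂ} {R : ℝ → Fin N → ℂ}
    {Y : ℝ → Fin (2 * m) → Fin N → ℂ} (hY : IsLinSol g U z R Y) (c : ℂ) :
    IsLinSol g U z (c • R) (c • Y) := by
  intro x
  refine ((hY x).const_smul c).congr_deriv ?_
  simp only [Pi.smul_apply]
  rw [linTerm_smul, ← shiftJet_smul, smul_comm z c, ← smul_sub, ← smul_sub, smul_comm _ c]

theorem IsLinSol.comp_add {g : (Fin (2 * m) → Fin N → ℝ) → Fin N → ℝ}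
    {U : ℝ → Fin (2 * m) → Fin N → ℝ} {z : ℂ} {R : ℝ → Fin N → ℂ}
    {Y : ℝ → Fin (2 * m) → Fin N → ℂ} (hY : IsLinSol g U z R Y) {P : ℝ}
    (hU : Function.Periodic U P) (hR : Function.Periodic R P) :
    IsLinSol g U z R (fun x => Y (x + P)) := by
  intro x
  have := (hY (x + P)).comp_add_const x P
  rwa [hU x, hR x] at this

theorem IsLinSol.continuous {g : (Fin (2 * m) → Fin N → ℝ) → Fin N → ℝ}
    {U : ℝ → Fin (2 * m) → Fin N → ℝ} {z : ℂ} {R : ℝ → Fin N → ℂ}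
    {Y : ℝ → Fin (2 * m) → Fin N → ℂ} (hY : IsLinSol g U z R Y) : Continuous Y :=
  continuous_iff_continuousAt.2 fun x => (hY x).continuousAt

/-- Nontrivial solutions have a nontrivial first component, as the other components are its derivatives. -/
theorem IsLinSol.eq_zero {g : (Fin (2 * m) → Fin N → ℝ) → Fin N → ℝ}
    {U : ℝ → Fin (2 * m) → Fin N → ℝ} {z : ℂ} {R : ℝ → Fin N → ℂ}
    {Y : ℝ → Fin (2 * m) → Fin N → ℂ} (hY : IsLinSol g U z R Y) (h : ∀ x, Y x 0 = 0) : Y = 0 := by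
  obtain ⟨h1, -⟩ := jet_of_hasDerivAt_shiftJet hY
  ext1 x
  ext1 j
  rw [← congrFun (h1 j) x, show (fun x => Y x 0) = fun _ => 0 from funext h]
  rw [iteratedDeriv_fun_const_zero]
  rfl

theorem isLinSol_complexJet {g : (Fin (2 * m) → Fin N → ℝ) → Fin N → ℝ}
    {U : ℝ → Fin (2 * m) → Fin N → ℝ} {V : ℝ → Fin (2 * m) → Fin N → ℝ}
    (hV : ∀ x, HasDerivAt V
      (shiftJet (V x) ((-1 : ℝ) ^ m • fderiv ℝ g (U x) (V x))) x) :
    IsLinSol g U 0 0 (fun x => complexJet m N (V x)) := by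
  intro x
  have h1 := (complexJet m N).hasFDerivAt.comp_hasDerivAt x (hV x)
  refine h1.congr_deriv ?_
  rw [linTerm_complexJet]
  ext j b
  rw [complexJet_apply]
  simp only [shiftJet]
  split_ifs <;> simp

omit [NeZero m] in
/-- The derivative of a jet solution solves the linearized equation. -/
theorem IsJetSol.hasDerivAt_deriv {g : (Fin (2 * m) → Fin N → ℝ) → Fin N → ℝ}
    (hg : ContDiff ℝ ∞ g) {U : ℝ → Fin (2 * m) → Fin N → ℝ} (hU : IsJetSol g U) (x : ℝ) :
    HasDerivAt (deriv U) (shiftJet (deriv U x) ((-1 : ℝ) ^ m • fderiv ℝ g (U x) (deriv U x))) x := by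
  have h1 : deriv U = fun x => shiftJet (U x) ((-1 : ℝ) ^ m • g (U x)) :=
    funext fun x => (hU x).deriv
  have h2 := (hU x).differentiableAt.hasDerivAt
  have h3 : HasDerivAt (fun x => (-1 : ℝ) ^ m • g (U x))
      ((-1 : ℝ) ^ m • fderiv ℝ g (U x) (deriv U x)) x :=
    ((((hg.differentiable (by simp)) (U x)).hasFDerivAt).comp_hasDerivAt x h2).const_smul ((-1 : ℝ) ^ m)
  conv => enter [1]; rw [h1]
  rw [hasDerivAt_pi]
  intro j
  unfold shiftJet
  split_ifs with h
  · exact (hasDerivAt_pi.1 h2) _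
  · exact h3

end LinearSolutions

/-! ### Bloch eigenvalues and Floquet multipliers -/

section BlochCorrespondence

variable {m N : ℕ} [NeZero m] {g : (Fin (2 * m) → Fin N → ℝ) → Fin N → ℝ} {k : ℝ}
  {v : ℝ → Fin N → ℝ} {U : ℝ → Fin (2 * m) → Fin N → ℝ}

/-- The jet of the Floquet transform of `w`. -/
noncomputable def twistJet (m : ℕ) (k ℓ : ℝ) (w : ℝ → Fin N → ℂ) (x : ℝ) :
    Fin (2 * m) → Fin N → ℂ :=
  fun j => twist k ℓ ((blochDeriv k ℓ)^[(j : ℕ)] w) x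

/-- The Floquet multiplier `exp(2πiσ)`. -/
noncomputable def multiplier (σ : ℝ) : ℂ := Complex.exp (2 * Real.pi * Complex.I * σ)

theorem twistJet_zero (k ℓ : ℝ) (w : ℝ → Fin N → ℂ) (x : ℝ) :
    twistJet m k ℓ w x 0 = twist k ℓ w x := rfl

omit [NeZero m] in
theorem twistJet_add_period {ℓ : ℝ} (hk : k ≠ 0) {w : ℝ → Fin N → ℂ}
    (hw : Function.Periodic w (2 * Real.pi)) (x : ℝ) :
    twistJet m k ℓ w (x + 2 * Real.pi / k) = multiplier (ℓ / k) • twistJet m k ℓ w x := by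
  ext j : 1
  exact twist_add_period hk (periodic_iterate_blochDeriv hw j) x

theorem isLinSol_twistJet {ℓ : ℝ} (hk : k ≠ 0) (hv : ∀ ξ, jet m k v ξ = U (ξ / k))
    {w r : ℝ → Fin N → ℂ} (hw : IsBlochFunction m w) (h : ∀ ξ, blochOp g k v ℓ w ξ = r ξ) :
    IsLinSol g U 0 (twist k ℓ r) (twistJet m k ℓ w) := by
  intro x
  have := hasDerivAt_twistJet hk hv hw h x
  simp only [zero_smul, sub_zero]
  exact this

theorem isLinSol_twistJet_eigen {ℓ : ℝ} (hk : k ≠ 0) (hv : ∀ ξ, jet m k v ξ = U (ξ / k)) {z : ℂ}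
    {w : ℝ → Fin N → ℂ} (hw : IsBlochFunction m w) (h : ∀ ξ, blochOp g k v ℓ w ξ = z • w ξ) :
    IsLinSol g U z 0 (twistJet m k ℓ w) := by
  intro x
  have := hasDerivAt_twistJet hk hv hw h x
  have h1 : twist k ℓ (fun ξ => z • w ξ) x = z • twistJet m k ℓ w x 0 := by
    rw [twistJet_zero, twist, twist, smul_comm]
  rw [h1] at this
  simp only [Pi.zero_apply, sub_zero]
  exact this

theorem eq_of_twistJet_eq_smul {ℓ : ℝ} (hk : k ≠ 0) {w w' : ℝ → Fin N → ℂ} {c : ℂ}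
    (h : twistJet m k ℓ w = c • twistJet m k ℓ w') : w = c • w' := by
  ext1 ξ
  have h1 := congrFun (congrFun h (ξ / k)) 0
  rw [Pi.smul_apply, Pi.smul_apply, twistJet_zero, twistJet_zero] at h1
  have h2 : c • twist k ℓ w' (ξ / k) = twist k ℓ (c • w') (ξ / k) := by
    rw [twist, twist, Pi.smul_apply, smul_comm]
  rw [h2, twist_eq_iff, mul_div_cancel₀ ξ hk] at h1
  exact h1

theorem untwist_ne_zero {ℓ : ℝ} (hk : k ≠ 0) {z : ℂ} {R : ℝ → Fin N → ℂ}
    {Y : ℝ → Fin (2 * m) → Fin N → ℂ} (hY : IsLinSol g U z R Y) (h : Y ≠ 0) :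
    untwist k ℓ Y ≠ 0 := by
  intro h0
  refine h (hY.eq_zero fun x => ?_)
  have := congrFun (twist_untwist hk ℓ Y) x
  rw [h0] at this
  rw [← this]
  simp [twist]

theorem twist_smul_untwist (hk : k ≠ 0) (ℓ : ℝ) (z : ℂ) (Y : ℝ → Fin (2 * m) → Fin N → ℂ)
    (x : ℝ) : twist k ℓ (fun ξ => z • untwist k ℓ Y ξ) x = z • Y x 0 := by
  rw [← congrFun (twist_untwist hk ℓ Y) x, twist, twist, smul_comm]

theorem continuous_untwist {ℓ : ℝ} {Y : ℝ → Fin (2 * m) → Fin N → ℂ} (hY : Continuous Y) :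
    Continuous (untwist k ℓ Y) := by
  have h0 : ContDiff ℝ (0 : ℕ) fun x => Y x 0 := by
    rw [Nat.cast_zero, contDiff_zero]
    exact (continuous_apply 0).comp hY
  exact (contDiff_untwist h0).continuous

/-- The Floquet condition only has to be checked at the initial point. -/
theorem IsLinSol.floquet (hg : ContDiff ℝ ∞ g) (hU : Continuous U) {P : ℝ}
    (hper : Function.Periodic U P) {z c : ℂ} {R : ℝ → Fin N → ℂ} (hR : ∀ x, R (x + P) = c • R x)
    {Y : ℝ → Fin (2 * m) → Fin N → ℂ} (hY : IsLinSol g U z R Y) (h0 : Y P = c • Y 0) (x : ℝ) :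
    Y (x + P) = c • Y x := by
  have h1 : IsLinSol g U z (c • R) (fun x => Y (x + P)) := by
    intro x
    have := (hY (x + P)).comp_add_const x P
    rwa [hper x, hR x] at this
  have := h1.unique hg hU (hY.smul c) (x := 0) (by simpa using h0)
  exact congrFun this x

theorem blochOp_untwist_eigen (hg : ContDiff ℝ ∞ g) (hk : k ≠ 0)
    (hv : ∀ ξ, jet m k v ξ = U (ξ / k)) (hU : Continuous U)
    (hper : Function.Periodic U (2 * Real.pi / k)) {ℓ : ℝ} {z : ℂ}
    {Y : ℝ → Fin (2 * m) → Fin N → ℂ} (hY : IsLinSol g U z 0 Y)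
    (h0 : Y (2 * Real.pi / k) = multiplier (ℓ / k) • Y 0) :
    IsBlochFunction m (untwist k ℓ Y) ∧
      ∀ ξ, blochOp g k v ℓ (untwist k ℓ Y) ξ = z • untwist k ℓ Y ξ := by
  refine blochOp_untwist hg hk hU hv ((continuous_untwist hY.continuous).const_smul z) (fun x => ?_)
    (hY.floquet hg hU hper (by simp) h0)
  have := hY x
  rw [twist_smul_untwist hk]
  simpa only [Pi.zero_apply, sub_zero] using this

/-- Bloch eigenvalues are the spectral parameters with a solution of the linear first order system
that has the Floquet multiplier `exp(2πiℓ/k)` over a period. -/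
theorem isBlochEigenvalue_iff (hg : ContDiff ℝ ∞ g) (hk : k ≠ 0)
    (hv : ∀ ξ, jet m k v ξ = U (ξ / k)) (hU : Continuous U)
    (hper : Function.Periodic U (2 * Real.pi / k)) {ℓ : ℝ} {z : ℂ} :
    IsBlochEigenvalue g k v ℓ z ↔ ∃ Y : ℝ → Fin (2 * m) → Fin N → ℂ, IsLinSol g U z 0 Y ∧ Y ≠ 0 ∧
      Y (2 * Real.pi / k) = multiplier (ℓ / k) • Y 0 := by
  constructor
  · rintro ⟨w, hw, hw0, h⟩
    refine ⟨twistJet m k ℓ w, isLinSol_twistJet_eigen hk hv hw h, fun h0 => hw0 ?_, ?_⟩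
    · have := eq_of_twistJet_eq_smul (m := m) (w := w) (w' := 0) (c := 0) (ℓ := ℓ) hk (by simpa using h0)
      simpa using this
    · have := twistJet_add_period (m := m) (ℓ := ℓ) hk hw.2 0
      rwa [zero_add] at this
  · rintro ⟨Y, hY, hY0, h⟩
    obtain ⟨h1, h2⟩ := blochOp_untwist_eigen hg hk hv hU hper hY h
    exact ⟨_, h1, untwist_ne_zero hk hY hY0, h2⟩

end BlochCorrespondence

/-! ### The solution operator of the eigenvalue problem -/

section Monodromy

variable {m N : ℕ} [NeZero m] {M : Type} [NormedAddCommGroup M] [NormedSpace ℝ M]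
  [FiniteDimensional ℝ M] {f : M → (Fin (2 * m) → Fin N → ℝ) → Fin N → ℝ}

/-- The vector field for the jet of an equilibrium together with a complex solution of the
eigenvalue problem for the linearization, with trivial equations for the system parameters and for
the spectral parameter. -/
noncomputable def augField (f : M → (Fin (2 * m) → Fin N → ℝ) → Fin N → ℝ)
    (q : M × ℂ × (Fin (2 * m) → Fin N → ℝ) × (Fin (2 * m) → Fin N → ℂ)) :
    M × ℂ × (Fin (2 * m) → Fin N → ℝ) × (Fin (2 * m) → Fin N → ℂ) :=
  (0, 0, shiftJet q.2.2.1 ((-1 : ℝ) ^ m • f q.1 q.2.2.1), linField (f q.1) q.2.1 q.2.2.1 q.2.2.2)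

/-- The solution operator of the eigenvalue problem along the solution with the initial jet `x`. -/
noncomputable def mono (f : M → (Fin (2 * m) → Fin N → ℝ) → Fin N → ℝ) (t : ℝ) (μ : M) (z : ℂ)
    (x : Fin (2 * m) → Fin N → ℝ) (Y : Fin (2 * m) → Fin N → ℂ) : Fin (2 * m) → Fin N → ℂ :=
  (flow (augField f) (t, (μ, z, x, Y))).2.2.2

omit [FiniteDimensional ℝ M] in
theorem contDiff_augField
    (hf : ContDiff ℝ ∞ (fun q : M × (Fin (2 * m) → Fin N → ℝ) => f q.1 q.2)) :
    ContDiff ℝ ∞ (augField f) := by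
  have hU : ContDiff ℝ ∞ (fun q : M × ℂ × (Fin (2 * m) → Fin N → ℝ) × (Fin (2 * m) → Fin N → ℂ) =>
    q.2.2.1) := contDiff_fst.comp (contDiff_snd.comp contDiff_snd)
  have hY : ContDiff ℝ ∞ (fun q : M × ℂ × (Fin (2 * m) → Fin N → ℝ) × (Fin (2 * m) → Fin N → ℂ) =>
    q.2.2.2) := contDiff_snd.comp (contDiff_snd.comp contDiff_snd)
  have hz : ContDiff ℝ ∞ (fun q : M × ℂ × (Fin (2 * m) → Fin N → ℝ) × (Fin (2 * m) → Fin N → ℂ) =>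
    q.2.1) := contDiff_fst.comp contDiff_snd
  have h1 : ContDiff ℝ ∞
      (fun q : M × ℂ × (Fin (2 * m) → Fin N → ℝ) × (Fin (2 * m) → Fin N → ℂ) =>
        f q.1 q.2.2.1) := hf.comp (contDiff_fst.prodMk hU)
  have h2 : ContDiff ℝ ∞
      (fun q : M × ℂ × (Fin (2 * m) → Fin N → ℝ) × (Fin (2 * m) → Fin N → ℂ) =>
        linTerm (f q.1) q.2.2.1 q.2.2.2) := contDiff_linTerm hf le_rfl contDiff_fst hU hY
  have h3 : ContDiff ℝ ∞
      (fun q : M × ℂ × (Fin (2 * m) → Fin N → ℝ) × (Fin (2 * m) → Fin N → ℂ) =>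
        q.2.1 • q.2.2.2 0) := hz.smul ((contDiff_pi.1 hY) 0)
  exact contDiff_const.prodMk (contDiff_const.prodMk
    ((contDiff_shiftJet hU (h1.const_smul ((-1 : ℝ) ^ m))).prodMk
      (contDiff_shiftJet hY ((h2.sub h3).const_smul ((-1 : ℂ) ^ m)))))

theorem flow_augField_of_isLinSol
    (hf : ContDiff ℝ ∞ (fun q : M × (Fin (2 * m) → Fin N → ℝ) => f q.1 q.2)) {μ : M} {z : ℂ}
    {U : ℝ → Fin (2 * m) → Fin N → ℝ} (hU : IsJetSol (f μ) U)
    {Y : ℝ → Fin (2 * m) → Fin N → ℂ} (hY : IsLinSol (f μ) U z 0 Y) (t : ℝ) :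
    (t, (μ, z, U 0, Y 0)) ∈ flowDomain (augField f) ∧
      flow (augField f) (t, (μ, z, U 0, Y 0)) = (μ, z, U t, Y t) :=
  flow_eq_of_hasDerivAt (contDiff_augField hf) (u := fun s => (μ, z, U s, Y s)) (t := t)
    (fun s _ => (hasDerivAt_const s μ).prodMk ((hasDerivAt_const s z).prodMk
      ((hU s).prodMk (by
        have := hY s
        simp only [Pi.zero_apply, sub_zero] at this
        exact this))))

/-- Solutions of the linear system exist globally: they are small perturbations of the zero
solution, up to scaling. -/
theorem mem_flowDomain_augField
    (hf : ContDiff ℝ ∞ (fun q : M × (Fin (2 * m) → Fin N → ℝ) => f q.1 q.2)) {μ : M} (z : ℂ)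
    {U : ℝ → Fin (2 * m) → Fin N → ℝ} (hU : IsJetSol (f μ) U) (t : ℝ)
    (Y : Fin (2 * m) → Fin N → ℂ) : (t, (μ, z, U 0, Y)) ∈ flowDomain (augField f) := by
  have hF := contDiff_augField hf
  have h0 : IsLinSol (f μ) U z 0 (fun _ => 0) := by
    intro x
    have h1 : linField (f μ) z (U x) 0 = 0 := map_zero _
    rw [linField_apply] at h1
    simp only [Pi.zero_apply, sub_zero] at h1 ⊢
    rw [h1]
    exact hasDerivAt_const x 0
  have h1 := (flow_augField_of_isLinSol hf hU h0 t).1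
  have hcont : ContinuousAt (fun c : ℝ => (t, (μ, z, U 0, c • Y))) 0 := by fun_prop
  have h2 : ∀ᶠ c : ℝ in 𝓝[≠] 0, (t, (μ, z, U 0, c • Y)) ∈ flowDomain (augField f) := by
    refine nhdsWithin_le_nhds (hcont.eventually ((isOpen_flowDomain hF).mem_nhds ?_))
    simpa using h1
  obtain ⟨c, hc, hc0⟩ := (h2.and self_mem_nhdsWithin).exists
  have hc0' : c ≠ 0 := hc0
  -- Multiplication of the complex jet by `c⁻¹` commutes with the vector field.
  set S : (Fin (2 * m) → Fin N → ℂ) →L[ℝ] (Fin (2 * m) → Fin N → ℂ) :=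
    c⁻¹ • ContinuousLinearMap.id ℝ _ with hS
  have h3 := (flow_semiconj_one hF hF ((ContinuousLinearMap.id ℝ M).prodMap
    ((ContinuousLinearMap.id ℝ ℂ).prodMap ((ContinuousLinearMap.id ℝ _).prodMap S))) (fun q => by
      change (0, 0, shiftJet q.2.2.1 ((-1 : ℝ) ^ m • f q.1 q.2.2.1),
        linField (f q.1) q.2.1 q.2.2.1 (c⁻¹ • q.2.2.2)) = (0, 0, shiftJet q.2.2.1
          ((-1 : ℝ) ^ m • f q.1 q.2.2.1), c⁻¹ • linField (f q.1) q.2.1 q.2.2.1 q.2.2.2)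
      rw [(linField (f q.1) q.2.1 q.2.2.1).map_smul_of_tower]) hc).1
  change (t, (μ, z, U 0, c⁻¹ • c • Y)) ∈ _ at h3
  rwa [inv_smul_smul₀ hc0'] at h3

theorem flow_augField_eq
    (hf : ContDiff ℝ ∞ (fun q : M × (Fin (2 * m) → Fin N → ℝ) => f q.1 q.2)) {μ : M} (z : ℂ)
    {U : ℝ → Fin (2 * m) → Fin N → ℝ} (hU : IsJetSol (f μ) U) (t : ℝ)
    (Y : Fin (2 * m) → Fin N → ℂ) :
    flow (augField f) (t, (μ, z, U 0, Y)) = (μ, z, U t, mono f t μ z (U 0) Y) := by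
  have hF := contDiff_augField hf
  have h := mem_flowDomain_augField hf z hU t Y
  have h1 := flow_firstIntegral hF (ContinuousLinearMap.fst ℝ M _) (fun _ => rfl) h
  have h2 := flow_firstIntegral hF ((ContinuousLinearMap.fst ℝ ℂ
    ((Fin (2 * m) → Fin N → ℝ) × (Fin (2 * m) → Fin N → ℂ))) ∘L
      (ContinuousLinearMap.snd ℝ M _)) (fun _ => rfl) h
  have h3 := (flow_semiconj_one hF (contDiff_jetField hf) ((ContinuousLinearMap.fst ℝ M _).prod
    ((ContinuousLinearMap.fst ℝ _ (Fin (2 * m) → Fin N → ℂ)) ∘L (ContinuousLinearMap.snd ℝ ℂ _) ∘L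
      (ContinuousLinearMap.snd ℝ M _))) (fun _ => rfl) h).2
  have h4 := h3.symm.trans (flow_jetField_of_isJetSol hf hU t).2
  have h5 := congrArg Prod.snd h4
  exact Prod.ext h1 (Prod.ext h2 (Prod.ext h5 rfl))

theorem isLinSol_mono
    (hf : ContDiff ℝ ∞ (fun q : M × (Fin (2 * m) → Fin N → ℝ) => f q.1 q.2)) {μ : M} (z : ℂ)
    {U : ℝ → Fin (2 * m) → Fin N → ℝ} (hU : IsJetSol (f μ) U) (Y : Fin (2 * m) → Fin N → ℂ) :
    IsLinSol (f μ) U z 0 (fun t => mono f t μ z (U 0) Y) := by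
  intro t
  have h1 := hasDerivAt_flow (contDiff_augField hf) (mem_flowDomain_augField hf z hU t Y)
  have h2 := hasFDerivAt_snd.comp_hasDerivAt t
    (hasFDerivAt_snd.comp_hasDerivAt t (hasFDerivAt_snd.comp_hasDerivAt t h1))
  simp only [Pi.zero_apply, sub_zero]
  rw [flow_augField_eq hf z hU t Y] at h2
  exact h2

theorem mono_zero (hf : ContDiff ℝ ∞ (fun q : M × (Fin (2 * m) → Fin N → ℝ) => f q.1 q.2))
    (μ : M) (z : ℂ) (x : Fin (2 * m) → Fin N → ℝ) (Y : Fin (2 * m) → Fin N → ℂ) :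
    mono f 0 μ z x Y = Y := by
  rw [mono, (flow_zero (contDiff_augField hf) _).2]

theorem mono_eq (hf : ContDiff ℝ ∞ (fun q : M × (Fin (2 * m) → Fin N → ℝ) => f q.1 q.2)) {μ : M}
    {z : ℂ} {U : ℝ → Fin (2 * m) → Fin N → ℝ} (hU : IsJetSol (f μ) U)
    {Y : ℝ → Fin (2 * m) → Fin N → ℂ} (hY : IsLinSol (f μ) U z 0 Y) (t : ℝ) :
    mono f t μ z (U 0) (Y 0) = Y t := by
  rw [mono, (flow_augField_of_isLinSol hf hU hY t).2]

theorem mono_smul (hf : ContDiff ℝ ∞ (fun q : M × (Fin (2 * m) → Fin N → ℝ) => f q.1 q.2)) {μ : M}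
    (z : ℂ) {U : ℝ → Fin (2 * m) → Fin N → ℝ} (hU : IsJetSol (f μ) U) (t : ℝ) (c : ℂ)
    (Y : Fin (2 * m) → Fin N → ℂ) : mono f t μ z (U 0) (c • Y) = c • mono f t μ z (U 0) Y := by
  have h1 := (isLinSol_mono hf z hU Y).smul c
  rw [smul_zero] at h1
  have h2 := mono_eq hf hU h1 t
  simpa [mono_zero hf] using h2

omit [FiniteDimensional ℝ M] in
/-- The derivative of the vector field in the directions of the spectral parameter and of the
complex jet. -/
theorem fderiv_augField_apply
    (hf : ContDiff ℝ ∞ (fun q : M × (Fin (2 * m) → Fin N → ℝ) => f q.1 q.2)) (μ : M) (z δz : ℂ)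
    (U : Fin (2 * m) → Fin N → ℝ) (Y h : Fin (2 * m) → Fin N → ℂ) :
    (fderiv ℝ (augField f) (μ, z, U, Y) (0, δz, 0, h)).2.2.2 =
      shiftJet h ((-1 : ℂ) ^ m • (linTerm (f μ) U h - z • h 0 - δz • Y 0)) := by
  set D := shiftJet h ((-1 : ℂ) ^ m • (linTerm (f μ) U h - z • h 0 - δz • Y 0)) with hD
  set Q : Fin (2 * m) → Fin N → ℂ := shiftJet 0 ((-1 : ℂ) ^ m • (-(δz • h 0))) with hQ
  have h1 : ∀ s : ℝ, (augField f ((μ, z, U, Y) + s • (0, δz, 0, h))).2.2.2 =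
      linField (f μ) z U Y + s • D + (s * s) • Q := by
    intro s
    have h2 : (μ, z, U, Y) + s • ((0 : M), δz, (0 : Fin (2 * m) → Fin N → ℝ), h) =
        (μ, z + s • δz, U, Y + s • h) := by simp
    rw [h2]
    simp only [augField]
    rw [linField_apply, linField_apply, hD, hQ, ← shiftJet_smul, ← shiftJet_smul, ← shiftJet_add,
      ← shiftJet_add, smul_zero, add_zero]
    congr 1
    have h3 : linTerm (f μ) U (s • h) = s • linTerm (f μ) U h := by
      have := linTerm_smul (f μ) U (s : ℂ) h
      simpa only [Complex.coe_smul] using this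
    rw [linTerm_add, h3, smul_comm s, smul_comm (s * s), ← smul_add, ← smul_add]
    congr 1
    ext a
    simp only [Pi.add_apply, Pi.sub_apply, Pi.smul_apply, Pi.neg_apply, smul_eq_mul,
      Complex.real_smul, Complex.ofReal_mul]
    ring
  have h4 : HasDerivAt (fun s : ℝ => (augField f ((μ, z, U, Y) + s • (0, δz, 0, h))).2.2.2) D 0 := by
    simp only [h1]
    have h5 := (((hasDerivAt_id (0 : ℝ)).smul_const D).const_add (linField (f μ) z U Y)).add
      (((hasDerivAt_id (0 : ℝ)).mul (hasDerivAt_id (0 : ℝ))).smul_const Q)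
    exact h5.congr_deriv (by simp)
  have h6 : HasDerivAt (fun s : ℝ => augField f ((μ, z, U, Y) + s • (0, δz, 0, h)))
      (fderiv ℝ (augField f) (μ, z, U, Y) (0, δz, 0, h)) 0 := by
    have h7 : HasDerivAt (fun s : ℝ => (μ, z, U, Y) + s • ((0 : M), δz,
        (0 : Fin (2 * m) → Fin N → ℝ), h)) (0, δz, 0, h) 0 := by
      simpa using ((hasDerivAt_id (0 : ℝ)).smul_const
        ((0 : M), δz, (0 : Fin (2 * m) → Fin N → ℝ), h)).const_add (μ, z, U, Y)
    refine HasFDerivAt.comp_hasDerivAt (l := augField f) 0 ?_ h7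
    rw [zero_smul, add_zero]
    exact ((contDiff_augField hf).differentiable (by simp) _).hasFDerivAt
  have h8 := hasFDerivAt_snd.comp_hasDerivAt 0
    (hasFDerivAt_snd.comp_hasDerivAt 0 (hasFDerivAt_snd.comp_hasDerivAt 0 h6))
  exact h8.unique h4

/-- The derivative of the solution operator in the spectral parameter and the initial data solves
the linear system forced by the solution itself. -/
theorem isLinSol_fderiv_mono
    (hf : ContDiff ℝ ∞ (fun q : M × (Fin (2 * m) → Fin N → ℝ) => f q.1 q.2)) {μ : M} (z : ℂ)
    {U : ℝ → Fin (2 * m) → Fin N → ℝ} (hU : IsJetSol (f μ) U) (Y : Fin (2 * m) → Fin N → ℂ)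
    (δz : ℂ) (δY : Fin (2 * m) → Fin N → ℂ) :
    IsLinSol (f μ) U z (fun t => δz • mono f t μ z (U 0) Y 0)
      (fun t => (fderiv ℝ (flow (augField f)) (t, (μ, z, U 0, Y)) (0, (0, δz, 0, δY))).2.2.2) := by
  intro t
  have hF := contDiff_augField hf
  have h := mem_flowDomain_augField hf z hU t Y
  have h1 := hasDerivAt_fderiv_flow hF h (0, δz, 0, δY)
  set H := fderiv ℝ (flow (augField f)) (t, (μ, z, U 0, Y)) (0, (0, δz, 0, δY)) with hH
  have hz : ∀ (E : Type) [NormedAddCommGroup E] [NormedSpace ℝ E] [ProperSpace E] (t : ℝ)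
      (x δ : E), fderiv ℝ (flow (fun _ : E => (0 : E))) (t, x) (0, δ) = δ := by
    intro E _ _ _ t x δ
    have : flow (fun _ : E => (0 : E)) = fun p => p.2 := funext fun p => flow_zero_field p.1 p.2
    rw [this, fderiv_snd]
    rfl
  have h2 : H.1 = 0 := by
    have := fderiv_flow_semiconj hF (F' := fun _ : M => (0 : M)) contDiff_const
      (ContinuousLinearMap.fst ℝ M _) (fun _ => rfl) h (0, δz, 0, δY)
    rw [hz] at this
    exact this
  have h3 : H.2.1 = δz := by
    have := fderiv_flow_semiconj hF (F' := fun _ : ℂ => (0 : ℂ)) contDiff_const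
      ((ContinuousLinearMap.fst ℝ ℂ
        ((Fin (2 * m) → Fin N → ℝ) × (Fin (2 * m) → Fin N → ℂ))) ∘L
        (ContinuousLinearMap.snd ℝ M _)) (fun _ => rfl) h (0, δz, 0, δY)
    rw [hz] at this
    exact this
  have h4 : H.2.2.1 = 0 := by
    have := fderiv_flow_semiconj hF (contDiff_jetField hf) ((ContinuousLinearMap.fst ℝ M _).prod
      ((ContinuousLinearMap.fst ℝ _ (Fin (2 * m) → Fin N → ℂ)) ∘L
        (ContinuousLinearMap.snd ℝ ℂ _) ∘L (ContinuousLinearMap.snd ℝ M _))) (fun _ => rfl) h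
      (0, δz, 0, δY)
    have h5 := this.trans (map_zero (fderiv ℝ (flow (jetField f)) (t, (μ, U 0))))
    exact congrArg Prod.snd h5
  have h6 : H = (0, δz, 0, H.2.2.2) := Prod.ext h2 (Prod.ext h3 (Prod.ext h4 rfl))
  have h7 := hasFDerivAt_snd.comp_hasDerivAt t
    (hasFDerivAt_snd.comp_hasDerivAt t (hasFDerivAt_snd.comp_hasDerivAt t h1))
  refine h7.congr_deriv ?_
  rw [← fderiv_augField_apply hf, ← flow_augField_eq hf z hU t Y, ← h6]
  rfl

theorem fderiv_mono_zero
    (hf : ContDiff ℝ ∞ (fun q : M × (Fin (2 * m) → Fin N → ℝ) => f q.1 q.2)) (μ : M) (z : ℂ)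
    (x : Fin (2 * m) → Fin N → ℝ) (Y : Fin (2 * m) → Fin N → ℂ)
    (δz : ℂ) (δY : Fin (2 * m) → Fin N → ℂ) :
    (fderiv ℝ (flow (augField f)) (0, (μ, z, x, Y)) (0, (0, δz, 0, δY))).2.2.2 = δY := by
  rw [fderiv_flow_zero (contDiff_augField hf)]

end Monodromy

/-! ### Fourier coefficients of periodic functions -/

section Fourier

/-- The Fourier coefficients of a function on `[0, 2π]`. -/
noncomputable def fcoeff (h : ℝ → ℂ) (n : ℤ) : ℂ := fourierCoeffOn Real.two_pi_pos h n

theorem fcoeff_eq (h : ℝ → ℂ) (n : ℤ) :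
    fcoeff h n = (1 / (2 * Real.pi - 0) : ℝ) • ∫ x in (0 : ℝ)..2 * Real.pi,
      fourier (-n) (x : AddCircle (2 * Real.pi - 0)) • h x :=
  fourierCoeffOn_eq_integral h n Real.two_pi_pos

theorem continuous_fourier_smul {h : ℝ → ℂ} (hh : Continuous h) (n : ℤ) :
    Continuous fun x : ℝ => fourier (-n) (x : AddCircle (2 * Real.pi - 0)) • h x := by
  have h1 : Continuous fun x : ℝ => fourier (-n) (x : AddCircle (2 * Real.pi - 0)) :=
    (fourier (T := 2 * Real.pi - 0) (-n)).continuous.comp (AddCircle.continuous_mk' _)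
  exact h1.smul hh

theorem fcoeff_add {h₁ h₂ : ℝ → ℂ} (hh₁ : Continuous h₁) (hh₂ : Continuous h₂) (n : ℤ) :
    fcoeff (fun x => h₁ x + h₂ x) n = fcoeff h₁ n + fcoeff h₂ n := by
  simp only [fcoeff_eq, smul_add (fourier (-n) _ : ℂ)]
  rw [intervalIntegral.integral_add ((continuous_fourier_smul hh₁ n).intervalIntegrable _ _)
    ((continuous_fourier_smul hh₂ n).intervalIntegrable _ _), smul_add]

theorem fcoeff_const_mul (h : ℝ → ℂ) (c : ℂ) (n : ℤ) :
    fcoeff (fun x => c * h x) n = c * fcoeff h n :=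
  fourierCoeffOn.const_mul h c n Real.two_pi_pos

theorem fcoeff_deriv {h : ℝ → ℂ} (hh : ContDiff ℝ 1 h) (hp : Function.Periodic h (2 * Real.pi))
    (n : ℤ) : fcoeff (deriv h) n = Complex.I * n * fcoeff h n := by
  have hd : ∀ x, HasDerivAt h (deriv h x) x := fun x =>
    ((hh.differentiable one_ne_zero) x).hasDerivAt
  have hc : Continuous (deriv h) := hh.continuous_deriv le_rfl
  have h2 : h (2 * Real.pi) = h 0 := by simpa using hp 0
  by_cases hn : n = 0
  · subst hn
    rw [fcoeff_eq]
    have h3 := intervalIntegral.integral_eq_sub_of_hasDerivAt (fun x _ => hd x)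
      (hc.intervalIntegrable 0 (2 * Real.pi))
    simp [h3, h2]
  · have h3 := fourierCoeffOn_of_hasDerivAt Real.two_pi_pos hn (fun x _ => hd x)
      (hc.intervalIntegrable 0 (2 * Real.pi))
    rw [h2, sub_self, mul_zero, zero_sub] at h3
    change fcoeff h n = _ at h3
    change _ = _ * -(_ * fcoeff (deriv h) n) at h3
    rw [h3]
    have hpi : (Real.pi : ℂ) ≠ 0 := by exact_mod_cast Real.pi_ne_zero
    have hn' : (n : ℂ) ≠ 0 := by exact_mod_cast hn
    push_cast
    field_simp
    ring_nf

theorem hasSum_sq_fcoeff {h : ℝ → ℂ} (hh : Continuous h) :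
    HasSum (fun n => ‖fcoeff h n‖ ^ 2)
      ((2 * Real.pi - 0)⁻¹ • ∫ x in (0 : ℝ)..2 * Real.pi, ‖h x‖ ^ 2) := by
  refine hasSum_sq_fourierCoeffOn Real.two_pi_pos ?_
  obtain ⟨C, hC⟩ := isCompact_Icc.exists_bound_of_continuousOn
    (hh.continuousOn (s := Icc 0 (2 * Real.pi)))
  refine MemLp.of_bound (hh.aestronglyMeasurable) C ?_
  rw [ae_restrict_iff' measurableSet_Ioc]
  exact Eventually.of_forall fun x hx => hC x (Ioc_subset_Icc_self hx)

/-- A pointwise bound for Fourier coefficients gives a bound for the mean squares. -/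
theorem integral_sq_le_of_fcoeff_le {h₁ h₂ : ℝ → ℂ} (hh₁ : Continuous h₁) (hh₂ : Continuous h₂)
    {r : ℝ} (hr : 0 ≤ r) (h : ∀ n, r * ‖fcoeff h₁ n‖ ≤ ‖fcoeff h₂ n‖) :
    r ^ 2 * ∫ x in (0 : ℝ)..2 * Real.pi, ‖h₁ x‖ ^ 2 ≤
      ∫ x in (0 : ℝ)..2 * Real.pi, ‖h₂ x‖ ^ 2 := by
  have h1 := (hasSum_sq_fcoeff hh₁).mul_left (r ^ 2)
  have h2 := hasSum_le (fun n => by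
    rw [← mul_pow]
    exact pow_le_pow_left₀ (by positivity) (h n) 2) h1 (hasSum_sq_fcoeff hh₂)
  have hpi : 0 < (2 * Real.pi - 0)⁻¹ := by
    rw [sub_zero]; positivity
  rw [smul_eq_mul, smul_eq_mul, mul_left_comm] at h2
  exact le_of_mul_le_mul_left h2 hpi

end Fourier

/-! ### A bound for unstable eigenvalues -/

section APriori

variable {m N : ℕ}

theorem fcoeff_blochDeriv {k ℓ : ℝ} {w : ℝ → Fin N → ℂ} (hw : ContDiff ℝ 1 w)
    (hp : Function.Periodic w (2 * Real.pi)) (a : Fin N) (n : ℤ) :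
    fcoeff (fun ξ => blochDeriv k ℓ w ξ a) n =
      Complex.I * ((k * n + ℓ : ℝ) : ℂ) * fcoeff (fun ξ => w ξ a) n := by
  have hwa : ContDiff ℝ 1 fun ξ => w ξ a := (contDiff_pi.1 hw) a
  have h1 : ∀ ξ, deriv w ξ a = deriv (fun ξ => w ξ a) ξ := fun ξ =>
    ((hasDerivAt_pi.1 ((hw.differentiable one_ne_zero) ξ).hasDerivAt) a).deriv.symm
  have h2 : (fun ξ => blochDeriv k ℓ w ξ a) = fun ξ =>
      (k : ℂ) * deriv (fun ξ => w ξ a) ξ + (Complex.I * ℓ) * w ξ a := by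
    ext ξ
    simp [blochDeriv, h1]
  rw [h2, fcoeff_add (h₁ := fun ξ => (k : ℂ) * deriv (fun ξ => w ξ a) ξ)
    (h₂ := fun ξ => (Complex.I * ℓ) * w ξ a) (continuous_const.mul (hwa.continuous_deriv le_rfl))
    (continuous_const.mul hwa.continuous), fcoeff_const_mul, fcoeff_const_mul,
    fcoeff_deriv hwa (fun ξ => by simp only [hp ξ])]
  push_cast
  ring

theorem fcoeff_iterate_blochDeriv {k ℓ : ℝ} {w : ℝ → Fin N → ℂ} {i : ℕ} (hw : ContDiff ℝ i w)
    (hp : Function.Periodic w (2 * Real.pi)) (a : Fin N) (n : ℤ) {j : ℕ} (hj : j ≤ i) :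
    fcoeff (fun ξ => (blochDeriv k ℓ)^[j] w ξ a) n =
      (Complex.I * ((k * n + ℓ : ℝ) : ℂ)) ^ j * fcoeff (fun ξ => w ξ a) n := by
  induction j with
  | zero => simp
  | succ j ih =>
    have h1 : ContDiff ℝ ((i - j : ℕ) : WithTop ℕ∞) ((blochDeriv k ℓ)^[j] w) :=
      contDiff_iterate_blochDeriv hw (by omega)
    have h2 : ContDiff ℝ 1 ((blochDeriv k ℓ)^[j] w) := by
      refine h1.of_le ?_
      have : 1 ≤ i - j := by omega
      exact_mod_cast this
    rw [Function.iterate_succ_apply',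
      fcoeff_blochDeriv h2 (periodic_iterate_blochDeriv hp j), ih (by omega), pow_succ]
    ring

/-- The symbol estimate for the resolvent of the leading part in the right half plane. -/
theorem mul_pow_le_norm_add_pow {z : ℂ} (hz : 0 ≤ z.re) {r : ℝ} (hr : 1 ≤ r)
    (hrz : r ^ (2 * m) = ‖z‖) (s : ℝ) {j : ℕ} (hj : j < 2 * m) :
    r * |s| ^ j ≤ ‖z + ((s ^ (2 * m) : ℝ) : ℂ)‖ := by
  set b := s ^ (2 * m) with hb
  have hb0 : 0 ≤ b := by rw [hb, pow_mul]; positivity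
  have hbs : b = |s| ^ (2 * m) := by rw [hb, pow_mul, pow_mul, sq_abs]
  have h1 : ‖z‖ ≤ ‖z + (b : ℂ)‖ := by
    rw [Complex.norm_def, Complex.norm_def]
    apply Real.sqrt_le_sqrt
    simp only [Complex.normSq_apply, Complex.add_re, Complex.ofReal_re, Complex.add_im,
      Complex.ofReal_im, add_zero]
    nlinarith
  have h2 : b ≤ ‖z + (b : ℂ)‖ := by
    refine le_trans ?_ (Complex.re_le_norm _)
    simpa using hz
  rcases le_total r |s| with h | h
  · calc r * |s| ^ j ≤ |s| * |s| ^ j := by gcongr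
      _ = |s| ^ (j + 1) := by ring
      _ ≤ |s| ^ (2 * m) := pow_le_pow_right₀ (hr.trans h) hj
      _ = b := hbs.symm
      _ ≤ _ := h2
  · calc r * |s| ^ j ≤ r * r ^ j := by gcongr
      _ = r ^ (j + 1) := by ring
      _ ≤ r ^ (2 * m) := pow_le_pow_right₀ hr hj
      _ = ‖z‖ := hrz
      _ ≤ _ := h1

/-- Unstable Bloch eigenvalues are bounded in terms of a bound for the coefficients only. -/
theorem norm_le_of_isBlochEigenvalue (hm : 0 < m) {g : (Fin (2 * m) → Fin N → ℝ) → Fin N → ℝ}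
    {k ℓ : ℝ} {v : ℝ → Fin N → ℝ} {C : ℝ}
    (hC : ∀ ξ j a b, ‖coeff g k v j ξ a b‖ ≤ C) {z : ℂ} (hz : 0 ≤ z.re)
    (h : IsBlochEigenvalue g k v ℓ z) :
    ‖z‖ ≤ max 1 ((2 * m * N * (2 * m * N * C ^ 2)) ^ m) := by
  rcases le_total ‖z‖ 1 with hz1 | hz1
  · exact hz1.trans (le_max_left _ _)
  refine le_max_of_le_right ?_
  obtain ⟨w, ⟨hw, hp⟩, hw0, hL⟩ := h
  -- With the length scale `r = ‖z‖ ^ (1 / 2m)`, each derivative of order `j < 2m` is smaller by the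
  -- factor `1 / r` than `G = z w + (i ∂)^(2m) w`, in the mean square. By the eigenvalue equation, `G`
  -- is bounded by these derivatives, which bounds `r`.
  obtain ⟨r, hr, hrz⟩ : ∃ r : ℝ, 1 ≤ r ∧ r ^ (2 * m) = ‖z‖ :=
    ⟨‖z‖ ^ (((2 * m : ℕ) : ℝ)⁻¹), Real.one_le_rpow hz1 (by positivity),
      Real.rpow_inv_natCast_pow (norm_nonneg z) (by omega)⟩
  set B : ℕ → ℝ → Fin N → ℂ := fun j => (blochDeriv k ℓ)^[j] w with hB
  have hBc : ∀ j, j ≤ 2 * m → ∀ a, Continuous fun ξ => B j ξ a := fun j hj a =>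
    (continuous_apply a).comp
      (contDiff_iterate_blochDeriv (i := 2 * m - j) hw (by omega)).continuous
  set G : Fin N → ℝ → ℂ := fun a ξ => z * w ξ a + Complex.I ^ (2 * m) * B (2 * m) ξ a with hG
  have hGc : ∀ a, Continuous (G a) := fun a =>
    (continuous_const.mul (hBc 0 (by omega) a)).add (continuous_const.mul (hBc _ le_rfl a))
  have hGL : ∀ a ξ, G a ξ = ∑ j : Fin (2 * m), ∑ b, coeff g k v j ξ a b * B j ξ b := by
    intro a ξ
    have h1 := congrFun (hL ξ) a
    simp only [blochOp, Pi.add_apply, Pi.smul_apply, smul_eq_mul, Finset.sum_apply, Matrix.mulVec,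
      dotProduct] at h1
    rw [hG]
    dsimp only
    rw [← h1]
    simp only [hB]
    ring
  have hfG : ∀ a n, fcoeff (G a) n =
      (z + (((k * n + ℓ) ^ (2 * m) : ℝ) : ℂ)) * fcoeff (fun ξ => w ξ a) n := by
    intro a n
    have hI : Complex.I ^ (2 * m) * Complex.I ^ (2 * m) = 1 := by
      rw [pow_mul, Complex.I_sq, ← mul_pow]; simp
    rw [hG]
    dsimp only
    rw [fcoeff_add (h₁ := fun ξ => z * w ξ a) (h₂ := fun ξ => Complex.I ^ (2 * m) * B (2 * m) ξ a)
      (continuous_const.mul (hBc 0 (by omega) a))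
      (continuous_const.mul (hBc _ le_rfl a)), fcoeff_const_mul, fcoeff_const_mul, hB,
      fcoeff_iterate_blochDeriv hw hp a n le_rfl, mul_pow]
    push_cast
    linear_combination ((k : ℂ) * n + ℓ) ^ (2 * m) * fcoeff (fun ξ => w ξ a) n * hI
  have h1 : ∀ j : Fin (2 * m), ∀ a, r ^ 2 * ∫ ξ in (0 : ℝ)..2 * Real.pi, ‖B j ξ a‖ ^ 2 ≤
      ∫ ξ in (0 : ℝ)..2 * Real.pi, ‖G a ξ‖ ^ 2 := by
    intro j a
    refine integral_sq_le_of_fcoeff_le (hBc j j.2.le a) (hGc a) (by linarith) fun n => ?_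
    rw [hB, hfG, fcoeff_iterate_blochDeriv hw hp a n j.2.le, norm_mul, norm_mul, norm_pow, norm_mul,
      Complex.norm_I, one_mul, Complex.norm_real, Real.norm_eq_abs, ← mul_assoc]
    exact mul_le_mul_of_nonneg_right (mul_pow_le_norm_add_pow hz hr hrz _ j.2) (norm_nonneg _)
  have h2 : ∀ a ξ, ‖G a ξ‖ ^ 2 ≤
      (2 * m * N * C ^ 2) * ∑ j : Fin (2 * m), ∑ b, ‖B j ξ b‖ ^ 2 := by
    intro a ξ
    rw [hGL, ← Finset.sum_product', ← Finset.sum_product']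
    have h3 : ‖∑ x : Fin (2 * m) × Fin N, coeff g k v x.1 ξ a x.2 * B x.1 ξ x.2‖ ≤
        ∑ x : Fin (2 * m) × Fin N, C * ‖B x.1 ξ x.2‖ := by
      refine (norm_sum_le _ _).trans (Finset.sum_le_sum fun x _ => ?_)
      rw [norm_mul]
      exact mul_le_mul_of_nonneg_right (hC _ _ _ _) (norm_nonneg _)
    have h4 := sq_sum_le_card_mul_sum_sq (s := (Finset.univ : Finset (Fin (2 * m) × Fin N)))
      (f := fun x => C * ‖B x.1 ξ x.2‖)
    calc _ ≤ (∑ x : Fin (2 * m) × Fin N, C * ‖B x.1 ξ x.2‖) ^ 2 :=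
          pow_le_pow_left₀ (norm_nonneg _) h3 2
      _ ≤ _ := h4
      _ = _ := by
          simp only [Finset.card_univ, Fintype.card_prod, Fintype.card_fin, mul_pow,
            ← Finset.mul_sum, Finset.univ_product_univ]
          push_cast
          ring
  set E : ℝ := ∑ j : Fin (2 * m), ∑ b, ∫ ξ in (0 : ℝ)..2 * Real.pi, ‖B j ξ b‖ ^ 2 with hE
  have hint : ∀ j : Fin (2 * m), ∀ b, IntervalIntegrable (fun ξ => ‖B j ξ b‖ ^ 2) volume 0
      (2 * Real.pi) := fun j b => (((hBc j j.2.le b).norm).pow 2).intervalIntegrable _ _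
  have hint' : ∀ j ∈ (Finset.univ : Finset (Fin (2 * m))),
      IntervalIntegrable (fun ξ => ∑ b, ‖B j ξ b‖ ^ 2) volume 0 (2 * Real.pi) := fun j _ =>
    Continuous.intervalIntegrable (continuous_finsetSum _ fun b _ =>
      ((hBc j j.2.le b).norm).pow 2) _ _
  have h5 : ∀ a, ∫ ξ in (0 : ℝ)..2 * Real.pi, ‖G a ξ‖ ^ 2 ≤ (2 * m * N * C ^ 2) * E := by
    intro a
    have h6 : (2 * m * N * C ^ 2) * E = ∫ ξ in (0 : ℝ)..2 * Real.pi,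
        (2 * m * N * C ^ 2) * ∑ j : Fin (2 * m), ∑ b, ‖B j ξ b‖ ^ 2 := by
      rw [intervalIntegral.integral_const_mul, intervalIntegral.integral_finsetSum
        hint']
      congr 1
      exact Finset.sum_congr rfl fun j _ =>
        (intervalIntegral.integral_finsetSum (fun b _ => hint j b)).symm
    rw [h6]
    refine intervalIntegral.integral_mono_on Real.two_pi_pos.le
      (((hGc a).norm.pow 2).intervalIntegrable _ _) ?_ (fun ξ _ => h2 a ξ)
    refine Continuous.intervalIntegrable (continuous_const.mul ?_) _ _
    exact continuous_finsetSum _ fun j _ => continuous_finsetSum _ fun b _ =>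
      ((hBc j j.2.le b).norm).pow 2
  have hE0 : 0 < E := by
    obtain ⟨ξ, hξ⟩ := Function.ne_iff.1 hw0
    obtain ⟨a, ha⟩ := Function.ne_iff.1 hξ
    obtain ⟨y, hy, hy'⟩ := hp.exists_mem_Ico₀ Real.two_pi_pos ξ
    refine Finset.sum_pos' (fun j _ => Finset.sum_nonneg fun b _ =>
      intervalIntegral.integral_nonneg Real.two_pi_pos.le fun _ _ => by positivity)
      ⟨⟨0, by omega⟩, Finset.mem_univ _, Finset.sum_pos' (fun b _ =>
        intervalIntegral.integral_nonneg Real.two_pi_pos.le fun _ _ => by positivity)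
        ⟨a, Finset.mem_univ _, ?_⟩⟩
    refine intervalIntegral.integral_pos Real.two_pi_pos
      (((hBc 0 (by omega) a).norm).pow 2).continuousOn (fun _ _ => by positivity)
      ⟨y, Ico_subset_Icc_self hy, ?_⟩
    have h7 : B 0 y a ≠ 0 := by
      change w y a ≠ 0
      rw [← hy']
      exact ha
    positivity
  have h8 : r ^ 2 * E ≤ (2 * m * N * (2 * m * N * C ^ 2)) * E := by
    calc r ^ 2 * E = ∑ j : Fin (2 * m), ∑ b, r ^ 2 * ∫ ξ in (0 : ℝ)..2 * Real.pi, ‖B j ξ b‖ ^ 2 := by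
          simp only [hE, Finset.mul_sum]
      _ ≤ ∑ _j : Fin (2 * m), ∑ _b : Fin N, (2 * m * N * C ^ 2) * E :=
          Finset.sum_le_sum fun j _ => Finset.sum_le_sum fun b _ => (h1 j b).trans (h5 b)
      _ = _ := by
          simp only [Finset.sum_const, Finset.card_univ, Fintype.card_fin, nsmul_eq_mul]
          push_cast
          ring
  have h9 := le_of_mul_le_mul_right h8 hE0
  rw [← hrz, pow_mul]
  exact pow_le_pow_left₀ (by positivity) h9 m

end APriori

/-! ### Continuation of simple eigenvalues -/

section SimpleBranch

/-- Continuation of a simple eigenvalue. The map `A (p, (Y, z))` is linear in `Y`, the kernel at the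
base point `p₀` for `z = 0` is spanned by `w₀`, and the eigenvalue `z = 0` is algebraically simple
in the sense that `∂_z A · w₀` is not in the range of `∂_Y A`. Then all null vectors near the base
point, of any size, belong to a smooth branch `(η, ζ)`, along which simplicity persists. -/
theorem exists_simple_branch {Q V : Type} [NormedAddCommGroup Q] [NormedSpace ℝ Q]
    [CompleteSpace Q] [NormedAddCommGroup V] [NormedSpace ℂ V] [FiniteDimensional ℂ V]
    {A : Q × (V × ℂ) → V} {p₀ : Q} {w₀ : V}
    (hsm : ∀ Y, ∀ᶠ u in 𝓝 (p₀, (Y, (0 : ℂ))), ContDiffAt ℝ ∞ A u)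
    (hhom : ∀ᶠ r in 𝓝 (p₀, (0 : ℂ)), ∀ (c : ℂ) Y, A (r.1, (c • Y, r.2)) = c • A (r.1, (Y, r.2)))
    (hw₀ : w₀ ≠ 0) (hA₀ : A (p₀, (w₀, 0)) = 0)
    (hker : ∀ Y, A (p₀, (Y, 0)) = 0 → ∃ c : ℂ, Y = c • w₀)
    (hinj : ∀ Y z, fderiv ℝ A (p₀, (w₀, 0)) (0, (Y, z)) = 0 → z = 0 ∧ ∃ c : ℂ, Y = c • w₀) :
    ∃ (η : Q → V) (ζ : Q → ℂ), ζ p₀ = 0 ∧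
      (∀ᶠ p in 𝓝 p₀, ContDiffAt ℝ ∞ ζ p) ∧
      (∀ᶠ p in 𝓝 p₀, η p ≠ 0 ∧ A (p, (η p, ζ p)) = 0) ∧
      (∀ᶠ r in 𝓝 (p₀, (0 : ℂ)), ∀ Y, Y ≠ 0 → A (r.1, (Y, r.2)) = 0 →
        r.2 = ζ r.1 ∧ ∃ c : ℂ, c ≠ 0 ∧ Y = c • η r.1) ∧
      (∀ᶠ p in 𝓝 p₀, ∀ Y z, fderiv ℝ A (p, (η p, ζ p)) (0, (Y, z)) = 0 → z = 0) := by
  have : FiniteDimensional ℝ V := FiniteDimensional.complexToReal V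
  obtain ⟨φ, hφ⟩ := SeparatingDual.exists_eq_one (R := ℂ) hw₀
  -- The bordered system: the normalization `φ Y = 1` makes the derivative invertible.
  set φR : V →L[ℝ] ℂ := φ.restrictScalars ℝ with hφR
  set nrm : Q × (V × ℂ) →L[ℝ] ℂ :=
    φR ∘L ContinuousLinearMap.fst ℝ V ℂ ∘L ContinuousLinearMap.snd ℝ Q (V × ℂ) with hnrm
  set H : Q × (V × ℂ) → V × ℂ := fun u => (A u, nrm u - 1) with hH
  have hHsm : ∀ {u}, ContDiffAt ℝ ∞ A u → ContDiffAt ℝ ∞ H u := fun h =>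
    h.prodMk (nrm.contDiff.contDiffAt.sub contDiffAt_const)
  have hHd : ∀ {u}, ContDiffAt ℝ ∞ A u → ∀ δ, fderiv ℝ H u δ = (fderiv ℝ A u δ, nrm δ) := by
    intro u h δ
    have h1 := (h.differentiableAt (by simp)).hasFDerivAt.prodMk
      (nrm.hasFDerivAt.sub_const (x := u) 1)
    rw [h1.fderiv]
    rfl
  have hinvert : (fderiv ℝ H (p₀, (w₀, 0)) ∘L ContinuousLinearMap.inr ℝ Q (V × ℂ)).IsInvertible := by
    refine isInvertible_of_injective rfl _ fun y hy => ?_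
    obtain ⟨Y, z⟩ := y
    rw [ContinuousLinearMap.comp_apply, ContinuousLinearMap.inr_apply,
      hHd (hsm w₀).self_of_nhds, Prod.mk_eq_zero] at hy
    obtain ⟨hz, c, hc⟩ := hinj Y z hy.1
    have h2 : φ Y = 0 := hy.2
    rw [hc, map_smul, hφ, smul_eq_mul, mul_one] at h2
    rw [hz, hc, h2, zero_smul]
    rfl
  obtain ⟨ψ, hψ0, hψc, hψ⟩ := exists_smooth_implicit (H := H) (q₀ := p₀) (y₀ := (w₀, (0 : ℂ)))
    ((hsm w₀).mono fun u => hHsm) (by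
      change (A (p₀, (w₀, 0)), φ w₀ - 1) = 0
      rw [hA₀, hφ, sub_self]
      rfl) hinvert
  have hψt : Tendsto (fun p => (p, ψ p)) (𝓝 p₀) (𝓝 (p₀, (w₀, 0))) := by
    have h1 := (continuousAt_id.prodMk hψc.self_of_nhds.continuousAt :
      ContinuousAt (fun p => (p, ψ p)) p₀).tendsto
    rwa [hψ0] at h1
  have hzero : ∀ᶠ p in 𝓝 p₀, A (p, ψ p) = 0 ∧ φ (ψ p).1 = 1 := by
    filter_upwards [hψt.eventually hψ] with p hp
    have h1 : (A (p, ψ p), φ (ψ p).1 - 1) = 0 := hp.2 rfl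
    rw [Prod.mk_eq_zero, sub_eq_zero] at h1
    exact h1
  refine ⟨fun p => (ψ p).1, fun p => (ψ p).2, by simp [hψ0], ?_, ?_, ?_, ?_⟩
  · exact hψc.mono fun p hp => contDiffAt_snd.comp p hp
  · filter_upwards [hzero] with p hp
    refine ⟨fun h => ?_, hp.1⟩
    have h1 := hp.2
    rw [h, map_zero] at h1
    exact zero_ne_one h1
  -- By homogeneity it suffices to consider the compact unit sphere. Near multiples of `w₀`, null
  -- vectors can be normalized and are on the branch; near other vectors there are none.
  · have h1 : ∀ᶠ r in 𝓝 (p₀, (0 : ℂ)), ∀ Y ∈ Metric.sphere (0 : V) 1, A (r.1, (Y, r.2)) = 0 →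
        r.2 = (ψ r.1).2 ∧ φ Y ≠ 0 ∧ Y = φ Y • (ψ r.1).1 := by
      have : ProperSpace V := FiniteDimensional.proper ℂ V
      refine (isCompact_sphere (0 : V) 1).eventually_forall_of_forall_eventually fun Y hY => ?_
      have hY0 : Y ≠ 0 := by
        rintro rfl
        simp at hY
      have hcont : Tendsto (fun x : (Q × ℂ) × V => (x.1.1, (x.2, x.1.2))) (𝓝 ((p₀, 0), Y))
          (𝓝 (p₀, (Y, 0))) := by
        have h2 : Continuous fun x : (Q × ℂ) × V => (x.1.1, (x.2, x.1.2)) := by fun_prop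
        exact h2.tendsto _
      by_cases h0 : A (p₀, (Y, 0)) = 0
      · obtain ⟨c, hc⟩ := hker Y h0
        have hφY : φ Y = c := by rw [hc, map_smul, hφ, smul_eq_mul, mul_one]
        have hc0 : c ≠ 0 := by
          rintro rfl
          exact hY0 (by rw [hc, zero_smul])
        have h3 : ContinuousAt (fun x : (Q × ℂ) × V => φ x.2) ((p₀, 0), Y) := by fun_prop
        have h4 : Tendsto (fun x : (Q × ℂ) × V => (x.1.1, ((φ x.2)⁻¹ • x.2, x.1.2)))
            (𝓝 ((p₀, 0), Y)) (𝓝 (p₀, (w₀, 0))) := by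
          have h5 : ContinuousAt (fun x : (Q × ℂ) × V => (x.1.1, ((φ x.2)⁻¹ • x.2, x.1.2)))
              ((p₀, 0), Y) := by
            refine ContinuousAt.prodMk (by fun_prop) (ContinuousAt.prodMk ?_ (by fun_prop))
            exact (h3.inv₀ (by simpa [hφY] using hc0)).smul (by fun_prop)
          have h6 := h5.tendsto
          dsimp only at h6
          have h7 : (φ Y)⁻¹ • Y = w₀ := by rw [hφY, hc, inv_smul_smul₀ hc0]
          rwa [h7] at h6
        have h7 : Tendsto (fun x : (Q × ℂ) × V => x.1) (𝓝 ((p₀, 0), Y)) (𝓝 (p₀, 0)) :=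
          continuous_fst.tendsto _
        filter_upwards [h4.eventually hψ, h7.eventually hhom, h3.eventually_ne (by
          simpa [hφY] using hc0)] with x hx1 hx2 hx3 hx4
        have h8 : ψ x.1.1 = ((φ x.2)⁻¹ • x.2, x.1.2) := by
          refine hx1.1 ?_
          change (A (x.1.1, ((φ x.2)⁻¹ • x.2, x.1.2)), φ ((φ x.2)⁻¹ • x.2) - 1) = 0
          rw [hx2, hx4, smul_zero, map_smul, smul_eq_mul, inv_mul_cancel₀ hx3, sub_self]
          rfl
        rw [h8]
        exact ⟨rfl, hx3, (smul_inv_smul₀ hx3 _).symm⟩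
      · have h2 := (hsm Y).self_of_nhds.continuousAt.tendsto.comp hcont
        filter_upwards [h2.eventually_ne h0] with x hx hx'
        exact absurd hx' hx
    filter_upwards [h1, hhom] with r hr hr2 Y hY hAY
    have hn : (‖Y‖ : ℂ) ≠ 0 := by simpa using hY
    obtain ⟨h2, h3, h4⟩ := hr ((‖Y‖ : ℂ)⁻¹ • Y) (by
      rw [mem_sphere_zero_iff_norm, norm_smul, norm_inv, Complex.norm_real, norm_norm,
        inv_mul_cancel₀ (norm_ne_zero_iff.2 hY)]) (by rw [hr2, hAY, smul_zero])
    refine ⟨h2, ‖Y‖ * φ ((‖Y‖ : ℂ)⁻¹ • Y), mul_ne_zero hn h3, ?_⟩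
    rw [mul_smul, ← h4, smul_inv_smul₀ hn]
  · have h1 : ∀ᶠ p in 𝓝 p₀, ContDiffAt ℝ ∞ A (p, ψ p) := hψt.eventually (hsm w₀)
    have h2 := hψt.eventually (eventually_isInvertible_fderiv (hHsm (hsm w₀).self_of_nhds) hinvert)
    have h3 : Tendsto (fun p => (p, (ψ p).2)) (𝓝 p₀) (𝓝 (p₀, 0)) := by
      have h4 : Continuous fun u : Q × (V × ℂ) => (u.1, u.2.2) := by fun_prop
      exact (h4.tendsto (p₀, (w₀, 0))).comp hψt
    filter_upwards [h1, h2, h3.eventually hhom, hzero] with p hp1 hp2 hp3 hp4 Y z hYz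
    -- Subtract a multiple of the null vector, so that the increment satisfies the normalization.
    have h5 : ∀ c : ℂ, fderiv ℝ A (p, ψ p) (0, (c • (ψ p).1, 0)) = 0 := by
      intro c
      have h6 : HasDerivAt (fun s : ℝ => (p, ψ p) + s • ((0 : Q), (c • (ψ p).1, (0 : ℂ))))
          (0, (c • (ψ p).1, 0)) 0 := by
        simpa using ((hasDerivAt_id (0 : ℝ)).smul_const
          ((0 : Q), (c • (ψ p).1, (0 : ℂ)))).const_add (p, ψ p)
      have h7 : HasDerivAt (fun s : ℝ => A ((p, ψ p) + s • ((0 : Q), (c • (ψ p).1, (0 : ℂ)))))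
          (fderiv ℝ A (p, ψ p) (0, (c • (ψ p).1, 0))) 0 := by
        refine HasFDerivAt.comp_hasDerivAt (l := A) 0 ?_ h6
        rw [zero_smul, add_zero]
        exact (hp1.differentiableAt (by simp)).hasFDerivAt
      have h8 : (fun s : ℝ => A ((p, ψ p) + s • ((0 : Q), (c • (ψ p).1, (0 : ℂ))))) =
          fun _ => 0 := by
        ext1 s
        have h9 : (p, ψ p) + s • ((0 : Q), (c • (ψ p).1, (0 : ℂ))) =
            (p, ((1 + s * c : ℂ) • (ψ p).1, (ψ p).2)) := by
          refine Prod.ext (by simp) (Prod.ext ?_ (by simp))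
          simp only [Prod.snd_add, Prod.fst_add, Prod.smul_snd, Prod.smul_fst, add_smul, one_smul,
            mul_smul, Complex.coe_smul]
        rw [h9, hp3]
        change _ • A (p, ψ p) = 0
        rw [hp4.1, smul_zero]
      rw [h8] at h7
      exact h7.unique (hasDerivAt_const _ _)
    obtain ⟨e, he⟩ := hp2
    have h10 : e (Y - φ Y • (ψ p).1, z) = 0 := by
      have h11 : e (Y - φ Y • (ψ p).1, z) =
          fderiv ℝ H (p, ψ p) (0, (Y - φ Y • (ψ p).1, z)) := by
        have := congrArg (fun L : (V × ℂ) →L[ℝ] (V × ℂ) => L (Y - φ Y • (ψ p).1, z)) he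
        exact this
      rw [h11, hHd hp1, Prod.mk_eq_zero]
      constructor
      · have h12 : ((0 : Q), (Y - φ Y • (ψ p).1, z)) = (0, (Y, z)) - (0, (φ Y • (ψ p).1, 0)) := by
          simp
        rw [h12, map_sub, hYz, h5, sub_zero]
      · change φ (Y - φ Y • (ψ p).1) = 0
        rw [map_sub, map_smul, hp4.2, smul_eq_mul, mul_one, sub_self]
    have h13 := (map_eq_zero_iff e e.injective).1 h10
    exact (Prod.mk_eq_zero.1 h13).2

/-- Null vectors do not appear near parameters without null vectors. -/
theorem eventually_forall_ne_zero {Q V : Type} [TopologicalSpace Q] [NormedAddCommGroup V]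
    [NormedSpace ℂ V] [FiniteDimensional ℂ V] {A : Q × V → V} {p₀ : Q}
    (hc : ∀ Y, ContinuousAt A (p₀, Y)) (hhom : ∀ᶠ p in 𝓝 p₀, ∀ (c : ℂ) Y, A (p, c • Y) = c • A (p, Y))
    (h0 : ∀ Y, Y ≠ 0 → A (p₀, Y) ≠ 0) : ∀ᶠ p in 𝓝 p₀, ∀ Y, Y ≠ 0 → A (p, Y) ≠ 0 := by
  have : ProperSpace V := FiniteDimensional.proper ℂ V
  have h1 : ∀ᶠ p in 𝓝 p₀, ∀ Y ∈ Metric.sphere (0 : V) 1, A (p, Y) ≠ 0 := by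
    refine (isCompact_sphere (0 : V) 1).eventually_forall_of_forall_eventually fun Y hY => ?_
    refine (hc Y).eventually_ne (h0 Y ?_)
    rintro rfl
    simp at hY
  filter_upwards [h1, hhom] with p hp hp2 Y hY hAY
  refine hp ((‖Y‖ : ℂ)⁻¹ • Y) ?_ (by rw [hp2, hAY, smul_zero])
  rw [mem_sphere_zero_iff_norm, norm_smul, norm_inv, Complex.norm_real, norm_norm,
    inv_mul_cancel₀ (norm_ne_zero_iff.2 hY)]

end SimpleBranch

/-! ### Even and strictly concave branches -/

section EvenBranch

/-- A smooth function of `(σ, q)` that is even in `σ`, vanishes at `σ = 0` and is strictly concave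
in `σ` at the base point is negative nearby, and it remains concave. -/
theorem eventually_neg_of_even {Q : Type} [NormedAddCommGroup Q] [NormedSpace ℝ Q] {h : ℝ × Q → ℝ}
    {q₀ : Q} (hsm : ∀ᶠ p in 𝓝 ((0 : ℝ), q₀), ContDiffAt ℝ ∞ h p)
    (h0 : ∀ᶠ q in 𝓝 q₀, h (0, q) = 0)
    (heven : ∀ᶠ p in 𝓝 ((0 : ℝ), q₀), h (-p.1, p.2) = h p)
    (hneg : iteratedDeriv 2 (fun σ => h (σ, q₀)) 0 < 0) :
    (∀ᶠ p in 𝓝 ((0 : ℝ), q₀), p.1 ≠ 0 → h p < 0) ∧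
      ∀ᶠ q in 𝓝 q₀, iteratedDeriv 2 (fun σ => h (σ, q)) 0 < 0 := by
  set d : ℝ × Q → ℝ := fun p => fderiv ℝ h p (1, 0) with hd
  set d2 : ℝ × Q → ℝ := fun p => fderiv ℝ d p (1, 0) with hd2
  have hline : ∀ (p : ℝ × Q), HasDerivAt (fun σ : ℝ => (σ, p.2)) ((1 : ℝ), (0 : Q)) p.1 := fun p =>
    (hasDerivAt_id p.1).prodMk (hasDerivAt_const _ _)
  have hdsm : ∀ {p}, ContDiffAt ℝ ∞ h p → ContDiffAt ℝ ∞ d p := fun hp =>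
    (hp.fderiv_right (m := ∞) (by simp)).clm_apply contDiffAt_const
  have hd1 : ∀ p : ℝ × Q, ContDiffAt ℝ ∞ h p → HasDerivAt (fun σ => h (σ, p.2)) (d p) p.1 :=
    fun p hp => HasFDerivAt.comp_hasDerivAt (l := h) p.1
      (hp.differentiableAt (by simp)).hasFDerivAt (hline p)
  have hd2' : ∀ p : ℝ × Q, ContDiffAt ℝ ∞ h p → HasDerivAt (fun σ => d (σ, p.2)) (d2 p) p.1 :=
    fun p hp => HasFDerivAt.comp_hasDerivAt (l := d) p.1
      ((hdsm hp).differentiableAt (by simp)).hasFDerivAt (hline p)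
  have hit : ∀ q, (∀ᶠ p in 𝓝 ((0 : ℝ), q), ContDiffAt ℝ ∞ h p) →
      iteratedDeriv 2 (fun σ => h (σ, q)) 0 = d2 (0, q) := by
    intro q hq
    have h1 : ∀ᶠ σ in 𝓝 (0 : ℝ), ContDiffAt ℝ ∞ h (σ, q) :=
      (hline (0, q)).continuousAt.eventually hq
    rw [iteratedDeriv_succ, iteratedDeriv_one]
    have h2 : deriv (fun σ => h (σ, q)) =ᶠ[𝓝 0] fun σ => d (σ, q) :=
      h1.mono fun σ hσ => (hd1 (σ, q) hσ).deriv
    rw [h2.deriv_eq]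
    exact (hd2' (0, q) hq.self_of_nhds).deriv
  have hd2c : ContinuousAt d2 (0, q₀) :=
    (((hdsm hsm.self_of_nhds).fderiv_right (m := ∞) (by simp)).clm_apply
      contDiffAt_const).continuousAt
  rw [hit q₀ hsm] at hneg
  have hd2neg : ∀ᶠ p in 𝓝 ((0 : ℝ), q₀), d2 p < 0 := hd2c.eventually_lt_const hneg
  have hq : Tendsto (fun q => ((0 : ℝ), q)) (𝓝 q₀) (𝓝 (0, q₀)) :=
    (continuous_const.prodMk continuous_id).tendsto _
  constructor
  · obtain ⟨s, hs, t, ht, hst⟩ := mem_nhds_prod_iff.1 (hd2neg.and (hsm.and heven))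
    obtain ⟨ε, hε, hεs⟩ := Metric.mem_nhds_iff.1 hs
    have h1 : Ioo (-ε) ε ×ˢ (t ∩ {q | h (0, q) = 0}) ∈ 𝓝 ((0 : ℝ), q₀) :=
      prod_mem_nhds (Ioo_mem_nhds (by linarith) hε) (inter_mem ht h0)
    filter_upwards [h1] with p hp hp0
    obtain ⟨σ, q⟩ := p
    obtain ⟨hσ, hq1, hq0⟩ := hp
    dsimp only at hσ hq1 hq0 hp0
    have hall : ∀ s ∈ Ioo (-ε) ε, d2 (s, q) < 0 ∧ ContDiffAt ℝ ∞ h (s, q) ∧ h (-s, q) = h (s, q) :=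
      fun s hs' => hst ⟨hεs (by rw [Real.ball_eq_Ioo, zero_sub, zero_add]; exact hs'), hq1⟩
    have h0ε : (0 : ℝ) ∈ Ioo (-ε) ε := ⟨by linarith, hε⟩
    -- The first derivative vanishes by evenness, so concavity makes `h` decreasing for `σ > 0`.
    have hd0 : d (0, q) = 0 := by
      have h2 := hd1 (0, q) (hall 0 h0ε).2.1
      have h2' : HasDerivAt (fun σ => h (σ, q)) (d (0, q)) (-0) := by
        rw [neg_zero]; exact h2
      have h3 := h2'.comp (0 : ℝ) (hasDerivAt_neg (0 : ℝ))
      have h4 : (fun σ => h (σ, q)) ∘ Neg.neg =ᶠ[𝓝 0] fun σ => h (σ, q) := by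
        filter_upwards [Ioo_mem_nhds h0ε.1 h0ε.2] with s hs' using (hall s hs').2.2
      have h5 := h2.unique (h3.congr_of_eventuallyEq h4.symm)
      linarith
    have key : ∀ s ∈ Ioo 0 ε, h (s, q) < 0 := by
      intro s hs'
      have hsub : Icc 0 s ⊆ Ioo (-ε) ε := fun x hx => ⟨by linarith [hx.1], by linarith [hx.2, hs'.2]⟩
      have hdanti : StrictAntiOn (fun σ => d (σ, q)) (Icc 0 s) := by
        refine strictAntiOn_of_deriv_neg (convex_Icc _ _) (fun x hx =>
          (hd2' (x, q) (hall x (hsub hx)).2.1).continuousAt.continuousWithinAt) fun x hx => ?_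
        rw [interior_Icc] at hx
        have hx' := hsub (Ioo_subset_Icc_self hx)
        rw [(hd2' (x, q) (hall x hx').2.1).deriv]
        exact (hall x hx').1
      have hanti : StrictAntiOn (fun σ => h (σ, q)) (Icc 0 s) := by
        refine strictAntiOn_of_deriv_neg (convex_Icc _ _) (fun x hx =>
          (hd1 (x, q) (hall x (hsub hx)).2.1).continuousAt.continuousWithinAt) fun x hx => ?_
        rw [interior_Icc] at hx
        have hx' := hsub (Ioo_subset_Icc_self hx)
        rw [(hd1 (x, q) (hall x hx').2.1).deriv]
        have := hdanti ⟨le_rfl, hs'.1.le⟩ (Ioo_subset_Icc_self hx) hx.1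
        dsimp only at this
        rwa [hd0] at this
      have := hanti ⟨le_rfl, hs'.1.le⟩ ⟨hs'.1.le, le_rfl⟩ hs'.1
      dsimp only at this
      rwa [show h (0, q) = 0 from hq0] at this
    rcases lt_or_gt_of_ne hp0 with hlt | hgt
    · rw [← (hall σ hσ).2.2]
      exact key (-σ) ⟨by linarith, by linarith [hσ.1]⟩
    · exact key σ ⟨hgt, hσ.2⟩
  · filter_upwards [hq.eventually hd2neg, hq.eventually hsm.eventually_nhds] with q h1 h2
    rw [hit q h2]
    exact h1

end EvenBranch

/-! ### Reflection and conjugation of complex jets -/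

section ComplexSymmetries

variable {m N : ℕ}

/-- Reflection of complex jets. -/
def reflectC (Y : Fin (2 * m) → Fin N → ℂ) : Fin (2 * m) → Fin N → ℂ :=
  fun j => (-1 : ℂ) ^ (j : ℕ) • Y j

theorem reflectC_smul (c : ℂ) (Y : Fin (2 * m) → Fin N → ℂ) :
    reflectC (c • Y) = c • reflectC Y := by
  ext1 j
  simp only [reflectC, Pi.smul_apply]
  rw [smul_comm]

theorem hasDerivAt_reflectC {Y : ℝ → Fin (2 * m) → Fin N → ℂ} {Y' : Fin (2 * m) → Fin N → ℂ}
    {x : ℝ} (h : HasDerivAt Y Y' x) : HasDerivAt (fun x => reflectC (Y x)) (reflectC Y') x :=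
  hasDerivAt_pi.2 fun j => ((hasDerivAt_pi.1 h) j).const_smul ((-1 : ℂ) ^ (j : ℕ))

theorem shiftJet_reflectC (Y : Fin (2 * m) → Fin N → ℂ) (y : Fin N → ℂ) :
    shiftJet (reflectC Y) y = -reflectC (shiftJet Y y) := by
  ext j : 1
  simp only [Pi.neg_apply, shiftJet, reflectC]
  split_ifs with h
  · rw [pow_succ, mul_neg_one, neg_smul]
  · have hj : (j : ℕ) + 1 = 2 * m := by omega
    have h1 : (-1 : ℂ) ^ (j : ℕ) * (-1) = 1 := by rw [← pow_succ, hj, pow_mul]; simp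
    have h2 : (-1 : ℂ) ^ (j : ℕ) = -1 := by linear_combination -h1
    rw [h2, neg_one_smul, neg_neg]

/-- At reflected jets, the derivatives in the slots of odd order change their sign. -/
theorem coeffMat_reflectJet {g : (Fin (2 * m) → Fin N → ℝ) → Fin N → ℝ}
    (hs : ∀ U, g (reflectJet U) = g U) (hg : ContDiff ℝ ∞ g) (U : Fin (2 * m) → Fin N → ℝ)
    (j : Fin (2 * m)) : coeffMat g (reflectJet U) j = (-1 : ℂ) ^ (j : ℕ) • coeffMat g U j := by
  have h1 : fderiv ℝ g U = (fderiv ℝ g (reflectJet U)) ∘L reflectL m N := by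
    have h2 : g = g ∘ reflectL m N := by
      ext1 V
      simp [hs]
    have h3 : HasFDerivAt (g ∘ reflectL m N) ((fderiv ℝ g (reflectJet U)) ∘L reflectL m N) U :=
      HasFDerivAt.comp (g := g) U ((hg.differentiable (by simp)) _).hasFDerivAt
        (reflectL m N).hasFDerivAt
    rw [← h2] at h3
    exact h3.fderiv
  ext a b
  simp only [coeffMat, Matrix.of_apply, Matrix.smul_apply, smul_eq_mul]
  rw [h1, ContinuousLinearMap.comp_apply, reflectL_apply]
  have h4 : reflectJet (Pi.single j (Pi.single b (1 : ℝ)) : Fin (2 * m) → Fin N → ℝ) =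
      (-1 : ℝ) ^ (j : ℕ) • Pi.single j (Pi.single b (1 : ℝ)) := by
    ext1 i
    rw [reflectJet, Pi.smul_apply]
    rcases eq_or_ne i j with rfl | hij
    · rfl
    · rw [Pi.single_eq_of_ne hij, smul_zero, smul_zero]
  rw [h4, map_smul, Pi.smul_apply, smul_eq_mul]
  push_cast
  rw [← mul_assoc, ← mul_pow]
  simp

theorem linTerm_reflectJet {g : (Fin (2 * m) → Fin N → ℝ) → Fin N → ℝ}
    (hs : ∀ U, g (reflectJet U) = g U) (hg : ContDiff ℝ ∞ g) (U : Fin (2 * m) → Fin N → ℝ)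
    (Y : Fin (2 * m) → Fin N → ℂ) : linTerm g (reflectJet U) (reflectC Y) = linTerm g U Y := by
  refine Finset.sum_congr rfl fun j _ => ?_
  rw [coeffMat_reflectJet hs hg, reflectC, Matrix.smul_mulVec, Matrix.mulVec_smul, smul_smul,
    ← mul_pow]
  simp

/-- Reversibility of the eigenvalue problem along even profiles. -/
theorem IsLinSol.reflect [NeZero m] {g : (Fin (2 * m) → Fin N → ℝ) → Fin N → ℝ}
    (hs : ∀ U, g (reflectJet U) = g U) (hg : ContDiff ℝ ∞ g) {U : ℝ → Fin (2 * m) → Fin N → ℝ}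
    (hU : ∀ x, U (-x) = reflectJet (U x)) {z : ℂ} {Y : ℝ → Fin (2 * m) → Fin N → ℂ}
    (hY : IsLinSol g U z 0 Y) : IsLinSol g U z 0 (fun x => reflectC (Y (-x))) := by
  intro x
  have h1 := hasDerivAt_reflectC ((hY (-x)).scomp x (hasDerivAt_neg x))
  refine h1.congr_deriv ?_
  have h2 : U x = reflectJet (U (-x)) := by rw [← hU, neg_neg]
  have h3 : reflectC (Y (-x)) 0 = Y (-x) 0 := by simp [reflectC]
  dsimp only
  rw [h2, linTerm_reflectJet hs hg, shiftJet_reflectC, h3]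
  ext j : 1
  simp [reflectC]

theorem linTerm_star (g : (Fin (2 * m) → Fin N → ℝ) → Fin N → ℝ) (U : Fin (2 * m) → Fin N → ℝ)
    (Y : Fin (2 * m) → Fin N → ℂ) : linTerm g U (star Y) = star (linTerm g U Y) := by
  ext a
  simp only [linTerm, Finset.sum_apply, Pi.star_apply, Matrix.mulVec, dotProduct, star_sum,
    coeffMat, Matrix.of_apply, star_mul']
  simp

/-- The coefficients are real, so complex conjugation maps solutions for `z` to solutions for `star z`. -/
theorem IsLinSol.star [NeZero m] {g : (Fin (2 * m) → Fin N → ℝ) → Fin N → ℝ}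
    {U : ℝ → Fin (2 * m) → Fin N → ℝ} {z : ℂ} {Y : ℝ → Fin (2 * m) → Fin N → ℂ}
    (hY : IsLinSol g U z 0 Y) : IsLinSol g U (star z) 0 (fun x => star (Y x)) := by
  intro x
  refine (hY x).star.congr_deriv ?_
  rw [linTerm_star]
  ext j : 1
  simp only [Pi.star_apply, shiftJet]
  split_ifs
  · rfl
  · simp [star_smul]

end ComplexSymmetries

/-! ### The translation mode -/

section StripeLinearization

variable {m N : ℕ} [NeZero m] {g : (Fin (2 * m) → Fin N → ℝ) → Fin N → ℝ} {k : ℝ}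
  {U : ℝ → Fin (2 * m) → Fin N → ℝ}

theorem multiplier_zero : multiplier 0 = 1 := by simp [multiplier]

theorem multiplier_neg (σ : ℝ) : multiplier (-σ) = (multiplier σ)⁻¹ := by
  rw [multiplier, multiplier, ← Complex.exp_neg]
  push_cast
  ring_nf

theorem multiplier_ne_zero (σ : ℝ) : multiplier σ ≠ 0 := Complex.exp_ne_zero _

theorem star_multiplier (σ : ℝ) : star (multiplier σ) = multiplier (-σ) := by
  rw [multiplier, multiplier, Complex.star_def, ← Complex.exp_conj]
  simp [Complex.conj_ofNat]

theorem multiplier_sub_intCast (σ : ℝ) (n : ℤ) : multiplier (σ - n) = multiplier σ := by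
  rw [multiplier, multiplier, Complex.exp_eq_exp_iff_exists_int]
  refine ⟨-n, ?_⟩
  push_cast
  ring

theorem contDiff_multiplier : ContDiff ℝ ∞ multiplier :=
  Complex.contDiff_exp.comp (contDiff_const.mul Complex.ofRealCLM.contDiff)

/-- The complex jet of the translation mode `u'(x)`. -/
noncomputable def transJet (U : ℝ → Fin (2 * m) → Fin N → ℝ) (x : ℝ) : Fin (2 * m) → Fin N → ℂ :=
  complexJet m N (deriv U x)

theorem isLinSol_transJet (hg : ContDiff ℝ ∞ g) (hU : IsStripeSol g k U) :
    IsLinSol g U 0 0 (transJet U) :=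
  isLinSol_complexJet (hU.sol.hasDerivAt_deriv hg)

omit [NeZero m] in
theorem transJet_period (hU : IsStripeSol g k U) (x : ℝ) :
    transJet U (x + 2 * Real.pi / k) = transJet U x := by
  have h1 : (fun y => U (y + 2 * Real.pi / k)) = U := funext hU.periodic
  have h2 := deriv_comp_add_const (f := U) (2 * Real.pi / k) x
  rw [h1] at h2
  rw [transJet, transJet, h2]

theorem deriv_profile_apply (hU : IsStripeSol g k U) (ξ : ℝ) :
    translationMode (fun ξ => U (ξ / k) 0) ξ = (k : ℂ)⁻¹ • transJet U (ξ / k) 0 := by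
  have h1 : HasDerivAt (fun ξ => U (ξ / k)) ((k⁻¹ : ℝ) • deriv U (ξ / k)) ξ := by
    have h2 : HasDerivAt (fun ξ : ℝ => ξ / k) k⁻¹ ξ := by
      simpa [div_eq_mul_inv] using (hasDerivAt_id ξ).mul_const k⁻¹
    exact (hU.sol (ξ / k)).differentiableAt.hasDerivAt.scomp ξ h2
  have h3 := (hasDerivAt_pi.1 h1) 0
  ext a
  simp only [translationMode, h3.deriv, transJet, complexJet_apply, Pi.smul_apply, smul_eq_mul]
  push_cast
  rfl

/-- The profile is nonconstant exactly if the translation mode does not vanish. -/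
theorem transJet_ne_zero_iff (hg : ContDiff ℝ ∞ g) (hU : IsStripeSol g k U) :
    transJet U 0 ≠ 0 ↔ ∃ x, U x 0 ≠ U 0 0 := by
  constructor
  · intro h
    by_contra! hc
    obtain ⟨h1, -⟩ := jet_of_hasDerivAt_shiftJet hU.sol
    have h2 : ∀ x, U x = U 0 := by
      intro x
      ext1 j
      rw [← congrFun (h1 j) x, ← congrFun (h1 j) 0,
        show (fun x => U x 0) = fun _ => U 0 0 from funext hc, iteratedDeriv_const,
        iteratedDeriv_const]
    have h3 : deriv U 0 = 0 := by
      rw [show U = fun _ => U 0 from funext h2, deriv_const]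
    exact h (by rw [transJet, h3, map_zero])
  · rintro ⟨x, hx⟩ h
    have h1 : transJet U = 0 := by
      have h2 : Continuous U := continuous_iff_continuousAt.2 fun x => (hU.sol x).continuousAt
      have h3 := (isLinSol_transJet hg hU).smul 0
      rw [zero_smul, zero_smul] at h3
      exact (isLinSol_transJet hg hU).unique hg h2 h3 (x := 0) (by simpa using h)
    have h4 : ∀ x, deriv U x = 0 := by
      intro x
      have h5 := congrFun h1 x
      ext j b
      have := congrFun (congrFun h5 j) b
      simpa [transJet] using this
    exact hx (congrFun (is_const_of_deriv_eq_zero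
      (fun x => (hU.sol x).differentiableAt) h4 x 0) 0)

omit [NeZero m] in
theorem IsStripeSol.continuous (hU : IsStripeSol g k U) : Continuous U :=
  continuous_iff_continuousAt.2 fun x => (hU.sol x).continuousAt

theorem IsStripeSol.jet_eq (hg : ContDiff ℝ ∞ g) (hk : 0 < k) (hU : IsStripeSol g k U) (ξ : ℝ) :
    jet m k (fun ξ => U (ξ / k) 0) ξ = U (ξ / k) :=
  (jet_profile hk hg.continuous hU.sol).2.1 ξ

theorem twist_zero_apply (w : ℝ → Fin N → ℂ) (x : ℝ) : twist k 0 w x = w (k * x) := by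
  simp [twist]

/-- The kernel condition in terms of jets. -/
theorem kernel_iff (hg : ContDiff ℝ ∞ g) (hk : 0 < k) (hU : IsStripeSol g k U) :
    (∀ w : ℝ → Fin N → ℂ, IsBlochFunction m w →
      (∀ ξ, blochOp g k (fun ξ => U (ξ / k) 0) 0 w ξ = 0) →
      ∃ c : ℂ, w = c • translationMode (fun ξ => U (ξ / k) 0)) ↔
    ∀ Y, IsLinSol g U 0 0 Y → Y (2 * Real.pi / k) = Y 0 → ∃ c : ℂ, Y = c • transJet U := by
  have hkC : (k : ℂ) ≠ 0 := by exact_mod_cast hk.ne'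
  have hcomp : ∀ {Y : ℝ → Fin (2 * m) → Fin N → ℂ} {c : ℂ}, IsLinSol g U 0 0 Y →
      (∀ x, Y x 0 = c • transJet U x 0) → Y = c • transJet U := by
    intro Y c hY h
    obtain ⟨h1, -⟩ := jet_of_hasDerivAt_shiftJet hY
    have h2 := (isLinSol_transJet hg hU).smul c
    obtain ⟨h3, -⟩ := jet_of_hasDerivAt_shiftJet h2
    ext1 x
    ext1 j
    rw [← congrFun (h1 j) x, ← congrFun (h3 j) x]
    congr 1
    exact funext h
  constructor
  · intro h Y hY hper
    obtain ⟨h1, h2⟩ := blochOp_untwist_eigen (ℓ := 0) hg hk.ne' (hU.jet_eq hg hk) hU.continuous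
      hU.periodic hY (by rw [zero_div, multiplier_zero, one_smul, hper])
    obtain ⟨c, hc⟩ := h _ h1 (by simpa using h2)
    refine ⟨c * (k : ℂ)⁻¹, hcomp hY fun x => ?_⟩
    have h3 := congrFun (twist_untwist hk.ne' 0 Y) x
    rw [twist_zero_apply, hc, Pi.smul_apply, deriv_profile_apply hU,
      mul_div_cancel_left₀ x hk.ne'] at h3
    rw [← h3, smul_smul]
  · intro h w hw hL
    have h1 : IsLinSol g U 0 0 (twistJet m k 0 w) :=
      isLinSol_twistJet_eigen hk.ne' (hU.jet_eq hg hk) hw (by simpa using hL)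
    have h2 := twistJet_add_period (m := m) (ℓ := 0) hk.ne' hw.2 0
    rw [zero_div, multiplier_zero, one_smul, zero_add] at h2
    obtain ⟨c, hc⟩ := h _ h1 h2
    refine ⟨c * k, ?_⟩
    ext1 ξ
    have h3 := congrFun (congrFun hc (ξ / k)) 0
    rw [twistJet_zero, twist_zero_apply, mul_div_cancel₀ ξ hk.ne'] at h3
    rw [h3]
    change c • transJet U (ξ / k) 0 = (c * k) • translationMode (fun ξ => U (ξ / k) 0) ξ
    rw [deriv_profile_apply hU, smul_smul, mul_assoc, mul_inv_cancel₀ hkC, mul_one]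

/-- The absence of generalized eigenfunctions in terms of jets. -/
theorem simple_iff (hg : ContDiff ℝ ∞ g) (hk : 0 < k) (hU : IsStripeSol g k U) :
    (∃ w : ℝ → Fin N → ℂ, IsBlochFunction m w ∧
      ∀ ξ, blochOp g k (fun ξ => U (ξ / k) 0) 0 w ξ = translationMode (fun ξ => U (ξ / k) 0) ξ) ↔
    ∃ Y, IsLinSol g U 0 (fun x => transJet U x 0) Y ∧ Y (2 * Real.pi / k) = Y 0 := by
  have hkC : (k : ℂ) ≠ 0 := by exact_mod_cast hk.ne'
  have htw : ∀ x, twist k 0 (translationMode (fun ξ => U (ξ / k) 0)) x =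
      (k : ℂ)⁻¹ • transJet U x 0 := fun x => by
    rw [twist_zero_apply, deriv_profile_apply hU, mul_div_cancel_left₀ x hk.ne']
  constructor
  · rintro ⟨w, hw, hL⟩
    have h1 : IsLinSol g U 0 _ (twistJet m k 0 w) :=
      isLinSol_twistJet hk.ne' (hU.jet_eq hg hk) hw hL
    have h2 := twistJet_add_period (m := m) (ℓ := 0) hk.ne' hw.2 0
    rw [zero_div, multiplier_zero, one_smul, zero_add] at h2
    refine ⟨(k : ℂ) • twistJet m k 0 w, ?_, by simp [h2]⟩
    have h3 := h1.smul (k : ℂ)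
    have h4 : (k : ℂ) • twist k 0 (translationMode fun ξ => U (ξ / k) 0) =
        fun x => transJet U x 0 := by
      ext1 x
      rw [Pi.smul_apply, htw, smul_inv_smul₀ hkC]
    rwa [h4] at h3
  · rintro ⟨Y, hY, hper⟩
    have hY' := hY.smul (k : ℂ)⁻¹
    have h1 := hY'.floquet hg hU.continuous hU.periodic (c := 1) (fun x => by
      simp only [Pi.smul_apply, one_smul, transJet_period hU]) (by
      simp only [Pi.smul_apply, one_smul, hper])
    have hr : Continuous (translationMode (fun ξ => U (ξ / k) 0)) := by
      have h2 : translationMode (fun ξ => U (ξ / k) 0) =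
          fun ξ => (k : ℂ)⁻¹ • transJet U (ξ / k) 0 := funext fun ξ => deriv_profile_apply hU ξ
      rw [h2]
      have h3 : Continuous fun x => transJet U x 0 :=
        (continuous_apply 0).comp (isLinSol_transJet hg hU).continuous
      exact (h3.comp (continuous_id.div_const k)).const_smul ((k : ℂ)⁻¹)
    obtain ⟨h2, h3⟩ := blochOp_untwist (ℓ := 0) hg hk.ne' hU.continuous (hU.jet_eq hg hk) hr
      (Y := (k : ℂ)⁻¹ • Y) (fun x => by
        have := hY' x
        simp only [zero_smul, sub_zero] at this
        rw [htw]
        exact this) (fun x => by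
        rw [h1 x, zero_div]
        simp)
    exact ⟨_, h2, h3⟩

end StripeLinearization

/-! ### The Floquet eigenvalue problem along a family of stripes -/

section NullMap

variable {m N : ℕ} [NeZero m] {M : Type} [NormedAddCommGroup M] [NormedSpace ℝ M]
  [FiniteDimensional ℝ M] {f : M → (Fin (2 * m) → Fin N → ℝ) → Fin N → ℝ}
  {U : ℝ × M → ℝ → Fin (2 * m) → Fin N → ℝ} {q : ℝ × M}

/-- The Floquet eigenvalue problem along the family `U` of stripe solutions, as a function of
`((σ, q), (Y, z))`: its zeros are the initial data `Y` of solutions with spectral parameter `z` and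
Floquet multiplier `exp(2πiσ)`. -/
noncomputable def nullMap (f : M → (Fin (2 * m) → Fin N → ℝ) → Fin N → ℝ)
    (U : ℝ × M → ℝ → Fin (2 * m) → Fin N → ℝ)
    (u : (ℝ × (ℝ × M)) × ((Fin (2 * m) → Fin N → ℂ) × ℂ)) : Fin (2 * m) → Fin N → ℂ :=
  mono f (2 * Real.pi / u.1.2.1) u.1.2.2 u.2.2 (U u.1.2 0) u.2.1 - multiplier u.1.1 • u.2.1

/-- `U q` is a stripe solution with the wavenumber and the parameter `q`, and its initial data
depend smoothly on the parameters near `q`. -/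
structure IsSmoothStripeAt (f : M → (Fin (2 * m) → Fin N → ℝ) → Fin N → ℝ)
    (U : ℝ × M → ℝ → Fin (2 * m) → Fin N → ℝ) (q : ℝ × M) : Prop where
  pos : 0 < q.1
  sol : IsStripeSol (f q.2) q.1 (U q)
  smooth : ContDiffAt ℝ ∞ (fun q => U q 0) q

omit [NeZero m] [FiniteDimensional ℝ M] in
theorem contDiff_apply_param
    (hf : ContDiff ℝ ∞ (fun q : M × (Fin (2 * m) → Fin N → ℝ) => f q.1 q.2)) (μ : M) :
    ContDiff ℝ ∞ (f μ) :=
  hf.comp (contDiff_const.prodMk contDiff_id)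

theorem contDiffAt_nullMap
    (hf : ContDiff ℝ ∞ (fun q : M × (Fin (2 * m) → Fin N → ℝ) => f q.1 q.2))
    {u : (ℝ × (ℝ × M)) × ((Fin (2 * m) → Fin N → ℂ) × ℂ)} (h : IsSmoothStripeAt f U u.1.2) :
    ContDiffAt ℝ ∞ (nullMap f U) u := by
  have h1 : ContDiffAt ℝ ∞ (fun u : (ℝ × (ℝ × M)) × ((Fin (2 * m) → Fin N → ℂ) × ℂ) =>
      (2 * Real.pi / u.1.2.1, (u.1.2.2, u.2.2, U u.1.2 0, u.2.1))) u := by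
    refine ContDiffAt.prodMk (contDiffAt_const.div ?_ h.pos.ne') (ContDiffAt.prodMk ?_
      (ContDiffAt.prodMk ?_ (ContDiffAt.prodMk ?_ ?_)))
    · exact (contDiff_fst.comp (contDiff_snd.comp contDiff_fst)).contDiffAt
    · exact (contDiff_snd.comp (contDiff_snd.comp contDiff_fst)).contDiffAt
    · exact (contDiff_snd.comp contDiff_snd).contDiffAt
    · exact ContDiffAt.comp (g := fun q => U q 0) (f := fun u => u.1.2) u h.smooth
        (contDiff_snd.comp contDiff_fst).contDiffAt
    · exact (contDiff_fst.comp contDiff_snd).contDiffAt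
  have h2 := contDiffAt_flow (contDiff_augField hf)
    (mem_flowDomain_augField hf u.2.2 h.sol.sol (2 * Real.pi / u.1.2.1) u.2.1)
  have h3 := ContDiffAt.comp (g := flow (augField f)) u h2 h1
  have h4 : ContDiff ℝ ∞ fun p : M × ℂ × (Fin (2 * m) → Fin N → ℝ) × (Fin (2 * m) → Fin N → ℂ) =>
      p.2.2.2 := contDiff_snd.comp (contDiff_snd.comp contDiff_snd)
  have h5 : ContDiff ℝ ∞ fun u : (ℝ × (ℝ × M)) × ((Fin (2 * m) → Fin N → ℂ) × ℂ) =>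
      multiplier u.1.1 • u.2.1 :=
    (contDiff_multiplier.comp (contDiff_fst.comp contDiff_fst)).smul
      (contDiff_fst.comp contDiff_snd)
  exact (h4.contDiffAt.comp u h3).sub h5.contDiffAt

theorem nullMap_smul
    (hf : ContDiff ℝ ∞ (fun q : M × (Fin (2 * m) → Fin N → ℝ) => f q.1 q.2))
    (h : IsSmoothStripeAt f U q) (σ : ℝ) (z c : ℂ) (Y : Fin (2 * m) → Fin N → ℂ) :
    nullMap f U ((σ, q), (c • Y, z)) = c • nullMap f U ((σ, q), (Y, z)) := by
  simp only [nullMap]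
  rw [mono_smul hf z h.sol.sol, smul_sub, smul_comm]

theorem nullMap_eq_zero_of_isLinSol
    (hf : ContDiff ℝ ∞ (fun q : M × (Fin (2 * m) → Fin N → ℝ) => f q.1 q.2))
    (h : IsSmoothStripeAt f U q) {σ : ℝ} {z : ℂ} {Y : ℝ → Fin (2 * m) → Fin N → ℂ}
    (hY : IsLinSol (f q.2) (U q) z 0 Y) (hper : Y (2 * Real.pi / q.1) = multiplier σ • Y 0) :
    nullMap f U ((σ, q), (Y 0, z)) = 0 := by
  simp only [nullMap]
  rw [mono_eq hf h.sol.sol hY, hper, sub_self]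

theorem exists_isLinSol_of_nullMap
    (hf : ContDiff ℝ ∞ (fun q : M × (Fin (2 * m) → Fin N → ℝ) => f q.1 q.2))
    (h : IsSmoothStripeAt f U q) {σ : ℝ} {z : ℂ} {Y : Fin (2 * m) → Fin N → ℂ}
    (hY : nullMap f U ((σ, q), (Y, z)) = 0) :
    ∃ y, IsLinSol (f q.2) (U q) z 0 y ∧ y 0 = Y ∧ ∀ x, y (x + 2 * Real.pi / q.1) =
      multiplier σ • y x := by
  have h1 := isLinSol_mono hf z h.sol.sol Y
  have h2 : mono f 0 q.2 z (U q 0) Y = Y := mono_zero hf _ _ _ _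
  refine ⟨_, h1, h2, h1.floquet (contDiff_apply_param hf q.2) h.sol.continuous h.sol.periodic
    (by simp) ?_⟩
  rw [h2]
  exact sub_eq_zero.1 hY

theorem isBlochEigenvalue_iff_nullMap
    (hf : ContDiff ℝ ∞ (fun q : M × (Fin (2 * m) → Fin N → ℝ) => f q.1 q.2))
    (h : IsSmoothStripeAt f U q) (ℓ : ℝ) (z : ℂ) :
    IsBlochEigenvalue (f q.2) q.1 (fun ξ => U q (ξ / q.1) 0) ℓ z ↔
      ∃ Y, Y ≠ 0 ∧ nullMap f U ((ℓ / q.1, q), (Y, z)) = 0 := by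
  have hg := contDiff_apply_param hf q.2
  rw [isBlochEigenvalue_iff hg h.pos.ne' (h.sol.jet_eq hg h.pos) h.sol.continuous h.sol.periodic]
  constructor
  · rintro ⟨Y, hY, hY0, hper⟩
    refine ⟨Y 0, fun h0 => hY0 ?_, nullMap_eq_zero_of_isLinSol hf h hY hper⟩
    have h1 := hY.smul 0
    rw [zero_smul, zero_smul] at h1
    exact hY.unique hg h.sol.continuous h1 (x := 0) (by simpa using h0)
  · rintro ⟨Y, hY0, hY⟩
    obtain ⟨y, hy, rfl, hper⟩ := exists_isLinSol_of_nullMap hf h hY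
    refine ⟨y, hy, fun h0 => hY0 (by rw [h0]; rfl), ?_⟩
    have := hper 0
    rwa [zero_add] at this

/-- Reflection maps Floquet solutions with exponent `σ` to those with exponent `-σ`, for the same
spectral parameter. -/
theorem nullMap_reflect
    (hf : ContDiff ℝ ∞ (fun q : M × (Fin (2 * m) → Fin N → ℝ) => f q.1 q.2))
    (hsymm : ∀ μ U, f μ (reflectJet U) = f μ U)
    (h : IsSmoothStripeAt f U q) {σ : ℝ} {z : ℂ} {Y : Fin (2 * m) → Fin N → ℂ}
    (hY : nullMap f U ((σ, q), (Y, z)) = 0) :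
    nullMap f U ((-σ, q), (reflectC Y, z)) = 0 := by
  obtain ⟨y, hy, rfl, hper⟩ := exists_isLinSol_of_nullMap hf h hY
  have h1 := hy.reflect (hsymm q.2) (contDiff_apply_param hf q.2) h.sol.reflect
  have h2 := nullMap_eq_zero_of_isLinSol hf h (σ := -σ) h1 (by
    have h3 := hper (-(2 * Real.pi / q.1))
    rw [neg_add_cancel] at h3
    rw [neg_zero, h3, ← reflectC_smul, smul_smul, multiplier_neg,
      inv_mul_cancel₀ (multiplier_ne_zero σ), one_smul])
  simpa using h2

/-- Complex conjugation maps Floquet solutions with exponent `σ` to those with exponent `-σ`, for the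
conjugate spectral parameter. -/
theorem nullMap_star
    (hf : ContDiff ℝ ∞ (fun q : M × (Fin (2 * m) → Fin N → ℝ) => f q.1 q.2))
    (h : IsSmoothStripeAt f U q) {σ : ℝ} {z : ℂ} {Y : Fin (2 * m) → Fin N → ℂ}
    (hY : nullMap f U ((σ, q), (Y, z)) = 0) :
    nullMap f U ((-σ, q), (star Y, star z)) = 0 := by
  obtain ⟨y, hy, rfl, hper⟩ := exists_isLinSol_of_nullMap hf h hY
  refine nullMap_eq_zero_of_isLinSol hf h (σ := -σ) hy.star ?_
  have h3 := hper 0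
  rw [zero_add] at h3
  rw [h3, star_smul, star_multiplier]

theorem fderiv_nullMap
    (hf : ContDiff ℝ ∞ (fun q : M × (Fin (2 * m) → Fin N → ℝ) => f q.1 q.2))
    (h : IsSmoothStripeAt f U q) (σ : ℝ) (z δz : ℂ) (Y δY : Fin (2 * m) → Fin N → ℂ) :
    fderiv ℝ (nullMap f U) ((σ, q), (Y, z)) (0, (δY, δz)) =
      (fderiv ℝ (flow (augField f)) (2 * Real.pi / q.1, (q.2, z, U q 0, Y))
        (0, (0, δz, 0, δY))).2.2.2 - multiplier σ • δY := by
  have h0 : HasDerivAt (fun s : ℝ => (((σ, q), (Y, z)) :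
      (ℝ × (ℝ × M)) × ((Fin (2 * m) → Fin N → ℂ) × ℂ)) + s • (0, (δY, δz))) (0, (δY, δz)) 0 := by
    simpa using ((hasDerivAt_id (0 : ℝ)).smul_const (((0 : ℝ × (ℝ × M)), (δY, δz)))).const_add
      (((σ, q), (Y, z)) : (ℝ × (ℝ × M)) × ((Fin (2 * m) → Fin N → ℂ) × ℂ))
  have h1 : HasDerivAt (fun s : ℝ => nullMap f U ((((σ, q), (Y, z)) :
      (ℝ × (ℝ × M)) × ((Fin (2 * m) → Fin N → ℂ) × ℂ)) + s • (0, (δY, δz))))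
      (fderiv ℝ (nullMap f U) ((σ, q), (Y, z)) (0, (δY, δz))) 0 := by
    refine HasFDerivAt.comp_hasDerivAt (l := nullMap f U) 0 ?_ h0
    rw [zero_smul, add_zero]
    exact ((contDiffAt_nullMap hf (u := ((σ, q), (Y, z))) h).differentiableAt
      (by simp)).hasFDerivAt
  have h2 : HasDerivAt (fun s : ℝ => (2 * Real.pi / q.1, (q.2, z, U q 0, Y)) +
      s • ((0 : ℝ), ((0 : M), δz, (0 : Fin (2 * m) → Fin N → ℝ), δY)))
      (0, (0, δz, 0, δY)) 0 := by
    simpa using ((hasDerivAt_id (0 : ℝ)).smul_const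
      ((0 : ℝ), ((0 : M), δz, (0 : Fin (2 * m) → Fin N → ℝ), δY))).const_add
      (2 * Real.pi / q.1, (q.2, z, U q 0, Y))
  have h3 : HasDerivAt (fun s : ℝ => flow (augField f) ((2 * Real.pi / q.1, (q.2, z, U q 0, Y)) +
      s • ((0 : ℝ), ((0 : M), δz, (0 : Fin (2 * m) → Fin N → ℝ), δY))))
      (fderiv ℝ (flow (augField f)) (2 * Real.pi / q.1, (q.2, z, U q 0, Y))
        (0, (0, δz, 0, δY))) 0 := by
    refine HasFDerivAt.comp_hasDerivAt (l := flow (augField f)) 0 ?_ h2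
    rw [zero_smul, add_zero]
    exact ((contDiffAt_flow (contDiff_augField hf)
      (mem_flowDomain_augField hf z h.sol.sol (2 * Real.pi / q.1) Y)).differentiableAt
      (by simp)).hasFDerivAt
  have h4 := hasFDerivAt_snd.comp_hasDerivAt 0
    (hasFDerivAt_snd.comp_hasDerivAt 0 (hasFDerivAt_snd.comp_hasDerivAt 0 h3))
  have h5 : HasDerivAt (fun s : ℝ => multiplier σ • (Y + s • δY)) (multiplier σ • δY) 0 := by
    have h6 : HasDerivAt (fun s : ℝ => Y + s • δY) δY 0 := by
      simpa using ((hasDerivAt_id (0 : ℝ)).smul_const δY).const_add Y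
    exact h6.const_smul (multiplier σ)
  have h7 := h4.sub h5
  refine h1.unique (h7.congr_of_eventuallyEq (Eventually.of_forall fun s => ?_))
  simp only [nullMap, mono, Pi.sub_apply, Function.comp_apply, Prod.mk_add_mk, Prod.smul_mk,
    smul_zero, add_zero]

/-- A null vector of the derivative of `nullMap` is a periodic solution of the linear system that is
forced by a multiple of the solution with the initial data `Y`. -/
theorem exists_isLinSol_of_fderiv_nullMap
    (hf : ContDiff ℝ ∞ (fun q : M × (Fin (2 * m) → Fin N → ℝ) => f q.1 q.2))
    (h : IsSmoothStripeAt f U q) {y : ℝ → Fin (2 * m) → Fin N → ℂ}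
    (hy : IsLinSol (f q.2) (U q) 0 0 y) (δz : ℂ) (δY : Fin (2 * m) → Fin N → ℂ) :
    ∃ D, IsLinSol (f q.2) (U q) 0 (fun t => δz • y t 0) D ∧ D 0 = δY ∧
      fderiv ℝ (nullMap f U) ((0, q), (y 0, 0)) (0, (δY, δz)) = D (2 * Real.pi / q.1) - D 0 := by
  have h1 := isLinSol_fderiv_mono hf 0 h.sol.sol (y 0) δz δY
  simp only [mono_eq hf h.sol.sol hy] at h1
  have h2 := fderiv_mono_zero hf q.2 0 (U q 0) (y 0) δz δY
  exact ⟨_, h1, h2, by rw [fderiv_nullMap hf h, multiplier_zero, one_smul, h2]⟩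

end NullMap

/-! ### Uniform bounds for the coefficients -/

section CoefficientBound

variable {m N : ℕ} [NeZero m] {M : Type} [NormedAddCommGroup M] [NormedSpace ℝ M]
  [FiniteDimensional ℝ M] {f : M → (Fin (2 * m) → Fin N → ℝ) → Fin N → ℝ}
  {U : ℝ × M → ℝ → Fin (2 * m) → Fin N → ℝ}

omit [NeZero m] [FiniteDimensional ℝ M] in
theorem continuous_coeffMat_apply
    (hf : ContDiff ℝ ∞ (fun q : M × (Fin (2 * m) → Fin N → ℝ) => f q.1 q.2)) :
    Continuous fun p : M × (Fin (2 * m) → Fin N → ℝ) =>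
      fun (j : Fin (2 * m)) (a b : Fin N) => coeffMat (f p.1) p.2 j a b := by
  refine continuous_pi fun j => continuous_pi fun a => continuous_pi fun b => ?_
  have h0 : ContDiff ℝ ∞ (fun q : M × (Fin (2 * m) → Fin N → ℝ) => fderiv ℝ (f q.1) q.2) :=
    ContDiff.fderiv (f := fun (q : M × (Fin (2 * m) → Fin N → ℝ)) (U : Fin (2 * m) → Fin N → ℝ) =>
      f q.1 U) (g := fun q => q.2)
      (hf.comp ((contDiff_fst.comp contDiff_fst).prodMk contDiff_snd)) contDiff_snd (by simp)
  exact Complex.continuous_ofReal.comp ((continuous_apply a).comp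
    (h0.continuous.clm_apply continuous_const))

/-- The coefficients of the Bloch operators are bounded locally uniformly in the parameters. -/
theorem eventually_coeff_bound
    (hf : ContDiff ℝ ∞ (fun q : M × (Fin (2 * m) → Fin N → ℝ) => f q.1 q.2)) {q₀ : ℝ × M}
    (h : ∀ᶠ q in 𝓝 q₀, IsSmoothStripeAt f U q) :
    ∃ C : ℝ, ∀ᶠ q in 𝓝 q₀, ∀ ξ j a b,
      ‖coeff (f q.2) q.1 (fun ξ => U q (ξ / q.1) 0) j ξ a b‖ ≤ C := by
  set S : M × (Fin (2 * m) → Fin N → ℝ) → Fin (2 * m) → Fin N → Fin N → ℂ :=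
    fun p j a b => coeffMat (f p.1) p.2 j a b with hS
  have hSc : Continuous S := continuous_coeffMat_apply hf
  have hg := h.self_of_nhds
  have hc0 : Continuous fun ξ => S (q₀.2, U q₀ (ξ / q₀.1)) :=
    hSc.comp (continuous_const.prodMk (hg.sol.continuous.comp (continuous_id.div_const _)))
  obtain ⟨C, hC⟩ := isCompact_Icc.exists_bound_of_continuousOn
    (hc0.continuousOn (s := Icc 0 (2 * Real.pi)))
  refine ⟨C + 1, ?_⟩
  have h1 : ∀ᶠ q in 𝓝 q₀, ∀ ξ ∈ Icc 0 (2 * Real.pi),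
      ‖S ((flow (jetField f)) (ξ / q.1, (q.2, U q 0)))‖ < C + 1 := by
    refine isCompact_Icc.eventually_forall_of_forall_eventually fun ξ hξ => ?_
    have h2 := flow_jetField_of_isJetSol hf hg.sol.sol (ξ / q₀.1)
    have h3 : ContinuousAt (fun p : (ℝ × M) × ℝ => (p.2 / p.1.1, (p.1.2, U p.1 0))) (q₀, ξ) := by
      refine ContinuousAt.prodMk (continuousAt_snd.div
        (continuousAt_fst.comp continuousAt_fst) hg.pos.ne')
        (ContinuousAt.prodMk (continuousAt_snd.comp continuousAt_fst) ?_)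
      exact ContinuousAt.comp (g := fun q => U q 0) (f := Prod.fst) (x := (q₀, ξ))
        hg.smooth.continuousAt continuousAt_fst
    have h4 := ContinuousAt.comp (g := flow (jetField f)) (x := (q₀, ξ))
      (contDiffAt_flow (contDiff_jetField hf) h2.1).continuousAt h3
    have h5 := (hSc.continuousAt.comp h4).norm
    refine h5.eventually_lt_const ?_
    change ‖S (flow (jetField f) (ξ / q₀.1, (q₀.2, U q₀ 0)))‖ < C + 1
    rw [h2.2]
    linarith [hC ξ hξ]
  filter_upwards [h1, h] with q hq hq2 ξ j a b
  have hper : Function.Periodic (fun ξ => U q (ξ / q.1)) (2 * Real.pi) := by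
    intro ξ
    simp only [add_div]
    exact hq2.sol.periodic _
  obtain ⟨y, hy, hy'⟩ := hper.exists_mem_Ico₀ Real.two_pi_pos ξ
  have h6 := hq y (Ico_subset_Icc_self hy)
  rw [(flow_jetField_of_isJetSol hf hq2.sol.sol (y / q.1)).2, ← hy'] at h6
  have h7 : coeff (f q.2) q.1 (fun ξ => U q (ξ / q.1) 0) j ξ a b = S (q.2, U q (ξ / q.1)) j a b := by
    simp only [coeff, hS, coeffMat, hq2.sol.jet_eq (contDiff_apply_param hf q.2) hq2.pos ξ]
  rw [h7]
  exact ((norm_le_pi_norm _ b).trans ((norm_le_pi_norm _ a).trans (norm_le_pi_norm _ j))).trans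
    h6.le

end CoefficientBound

/-! ### Stability is an open condition -/

section StableOpen

variable {m N : ℕ} [NeZero m] {M : Type} [NormedAddCommGroup M] [NormedSpace ℝ M]
  [FiniteDimensional ℝ M] {f : M → (Fin (2 * m) → Fin N → ℝ) → Fin N → ℝ}
  {U : ℝ × M → ℝ → Fin (2 * m) → Fin N → ℝ} {q₀ : ℝ × M}

/-- A property that holds near a point holds along continuous maps that take the value at that
point. -/
theorem eventually_comp_of_continuous {X Z : Type} [TopologicalSpace X] [TopologicalSpace Z]
    {x₀ : X} {z₀ : Z} {P : Z → Prop} (h : ∀ᶠ z in 𝓝 z₀, P z) {g : X → Z} (hg : Continuous g)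
    (hx : g x₀ = z₀) : ∀ᶠ x in 𝓝 x₀, P (g x) :=
  (hg.tendsto' x₀ z₀ hx).eventually h

/-- The critical Floquet eigenvalue of a stable stripe, and its eigenvector, continue smoothly. -/
theorem exists_critical_branch
    (hf : ContDiff ℝ ∞ (fun q : M × (Fin (2 * m) → Fin N → ℝ) => f q.1 q.2))
    (h : ∀ᶠ q in 𝓝 q₀, IsSmoothStripeAt f U q)
    (hst : IsStableStripe (f q₀.2) q₀.1 (fun ξ => U q₀ (ξ / q₀.1) 0)) :
    ∃ (η : ℝ × (ℝ × M) → Fin (2 * m) → Fin N → ℂ) (ζ : ℝ × (ℝ × M) → ℂ),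
      ζ (0, q₀) = 0 ∧ (∀ᶠ p in 𝓝 ((0 : ℝ), q₀), ContDiffAt ℝ ∞ ζ p) ∧
      (∀ᶠ p in 𝓝 ((0 : ℝ), q₀), η p ≠ 0 ∧ nullMap f U (p, (η p, ζ p)) = 0) ∧
      (∀ᶠ r in 𝓝 (((0 : ℝ), q₀), (0 : ℂ)), ∀ Y, Y ≠ 0 → nullMap f U (r.1, (Y, r.2)) = 0 →
        r.2 = ζ r.1 ∧ ∃ c : ℂ, c ≠ 0 ∧ Y = c • η r.1) ∧
      (∀ᶠ p in 𝓝 ((0 : ℝ), q₀), ∀ Y z,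
        fderiv ℝ (nullMap f U) (p, (η p, ζ p)) (0, (Y, z)) = 0 → z = 0) := by
  have hq₀ := h.self_of_nhds
  have hg := contDiff_apply_param hf q₀.2
  have hlin := isLinSol_transJet hg hq₀.sol
  have hkernel := (kernel_iff hg hq₀.pos hq₀.sol).1 hst.kernel
  have hsimple := mt (simple_iff hg hq₀.pos hq₀.sol).2 hst.simple
  have htper : transJet (U q₀) (2 * Real.pi / q₀.1) = transJet (U q₀) 0 := by
    have := transJet_period hq₀.sol 0
    rwa [zero_add] at this
  have hnc : ∃ x, U q₀ x 0 ≠ U q₀ 0 0 := by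
    obtain ⟨ξ, hξ⟩ := hst.isStripe.nonconstant
    exact ⟨ξ / q₀.1, by simpa using hξ⟩
  refine exists_simple_branch (A := nullMap f U) (w₀ := transJet (U q₀) 0) (fun Y => ?_) ?_
    ((transJet_ne_zero_iff hg hq₀.sol).2 hnc) ?_ (fun Y hY => ?_) (fun δY δz hδ => ?_)
  · exact (eventually_comp_of_continuous h (g := fun u : (ℝ × (ℝ × M)) × ((Fin (2 * m) → Fin N → ℂ) × ℂ) =>
      u.1.2) (by fun_prop) rfl).mono fun u hu => contDiffAt_nullMap hf hu
  · exact (eventually_comp_of_continuous h (g := fun r : (ℝ × (ℝ × M)) × ℂ => r.1.2) (by fun_prop) rfl).mono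
      fun r hr c Y => nullMap_smul hf hr r.1.1 r.2 c Y
  · exact nullMap_eq_zero_of_isLinSol hf hq₀ hlin (by rw [multiplier_zero, one_smul, htper])
  · obtain ⟨y, hy, rfl, hper⟩ := exists_isLinSol_of_nullMap hf hq₀ hY
    obtain ⟨c, rfl⟩ := hkernel y hy (by
      have := hper 0
      rwa [zero_add, multiplier_zero, one_smul] at this)
    exact ⟨c, rfl⟩
  · obtain ⟨D, hD, hD0, hD'⟩ := exists_isLinSol_of_fderiv_nullMap hf hq₀ hlin δz δY
    rw [hδ] at hD'
    have hper := (sub_eq_zero.1 hD'.symm)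
    have hz : δz = 0 := by
      by_contra hz
      refine hsimple ⟨δz⁻¹ • D, ?_, by simp [hper]⟩
      have h1 := hD.smul δz⁻¹
      have h2 : δz⁻¹ • (fun t => δz • transJet (U q₀) t 0) = fun t => transJet (U q₀) t 0 := by
        ext1 t
        rw [Pi.smul_apply, inv_smul_smul₀ hz]
      rwa [h2] at h1
    refine ⟨hz, ?_⟩
    have h3 : (fun t => δz • transJet (U q₀) t 0) = 0 := by
      ext1 t
      rw [hz, zero_smul]
      rfl
    rw [h3] at hD
    obtain ⟨c, rfl⟩ := hkernel D hD hper
    exact ⟨c, hD0.symm⟩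

/-- Away from the critical eigenvalue, there is no unstable spectrum in compact sets. -/
theorem eventually_no_unstable
    (hf : ContDiff ℝ ∞ (fun q : M × (Fin (2 * m) → Fin N → ℝ) => f q.1 q.2))
    (h : ∀ᶠ q in 𝓝 q₀, IsSmoothStripeAt f U q)
    (hst : IsStableStripe (f q₀.2) q₀.1 (fun ξ => U q₀ (ξ / q₀.1) 0)) {σ : ℝ} {z : ℂ}
    (hσ : |σ| ≤ 1 / 2) (hz : 0 ≤ z.re) (h0 : (σ, z) ≠ (0, 0)) :
    ∀ᶠ r : (ℝ × M) × (ℝ × ℂ) in 𝓝 (q₀, (σ, z)), ∀ Y, Y ≠ 0 →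
      nullMap f U ((r.2.1, r.1), (Y, r.2.2)) ≠ 0 := by
  have hq₀ := h.self_of_nhds
  refine eventually_forall_ne_zero (A := fun u : ((ℝ × M) × (ℝ × ℂ)) × (Fin (2 * m) → Fin N → ℂ) =>
    nullMap f U ((u.1.2.1, u.1.1), (u.2, u.1.2.2))) (fun Y => ?_) ?_ ?_
  · refine ContinuousAt.comp (g := nullMap f U)
      (f := fun u : ((ℝ × M) × (ℝ × ℂ)) × (Fin (2 * m) → Fin N → ℂ) =>
        ((u.1.2.1, u.1.1), (u.2, u.1.2.2))) (contDiffAt_nullMap hf ?_).continuousAt ?_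
    · exact hq₀
    · have : Continuous fun u : ((ℝ × M) × (ℝ × ℂ)) × (Fin (2 * m) → Fin N → ℂ) =>
        ((u.1.2.1, u.1.1), (u.2, u.1.2.2)) := by fun_prop
      exact this.continuousAt
  · exact (eventually_comp_of_continuous h (g := fun r : (ℝ × M) × (ℝ × ℂ) => r.1) (by fun_prop) rfl).mono
      fun r hr c Y => nullMap_smul hf hr r.2.1 r.2.2 c Y
  · intro Y hY hA
    have h1 : IsBlochEigenvalue (f q₀.2) q₀.1 (fun ξ => U q₀ (ξ / q₀.1) 0) (σ * q₀.1) z := by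
      rw [isBlochEigenvalue_iff_nullMap hf hq₀, mul_div_cancel_right₀ _ hq₀.pos.ne']
      exact ⟨Y, hY, hA⟩
    rcases hst.spectrum _ _ h1 with h2 | ⟨h2, n, hn⟩
    · linarith
    · have h3 : σ = n := mul_right_cancel₀ hq₀.pos.ne' hn
      have h4 : n = 0 := by
        rw [h3] at hσ
        have h5 : |(n : ℝ)| < 1 := by linarith
        rw [← Int.cast_abs] at h5
        have h6 : |n| < 1 := by exact_mod_cast h5
        exact Int.abs_lt_one_iff.1 h6
      exact h0 (by rw [h2, h3, h4, Int.cast_zero])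

omit [NeZero m] in
theorem iteratedDeriv_two_comp_mul_left (c : ℝ) (h : ℝ → ℝ) :
    iteratedDeriv 2 (fun x => h (c * x)) 0 = c ^ 2 * iteratedDeriv 2 h 0 := by
  have h2 : ∀ h : ℝ → ℝ, iteratedDeriv 2 h = deriv (deriv h) := fun h => by
    rw [iteratedDeriv_succ, iteratedDeriv_one]
  rw [h2, h2]
  have h1 : deriv (fun x => h (c * x)) = fun x => c * deriv h (c * x) :=
    funext fun x => deriv_comp_mul_left c h x
  rw [h1, deriv_const_mul_field, deriv_comp_mul_left c (deriv h), mul_zero, smul_eq_mul]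
  ring

/-- Stability is an open condition along smooth families of stripe solutions. -/
theorem eventually_isStableStripe
    (hf : ContDiff ℝ ∞ (fun q : M × (Fin (2 * m) → Fin N → ℝ) => f q.1 q.2))
    (hsymm : ∀ μ U, f μ (reflectJet U) = f μ U)
    (h : ∀ᶠ q in 𝓝 q₀, IsSmoothStripeAt f U q)
    (hst : IsStableStripe (f q₀.2) q₀.1 (fun ξ => U q₀ (ξ / q₀.1) 0)) :
    ∀ᶠ q in 𝓝 q₀, IsStableStripe (f q.2) q.1 (fun ξ => U q (ξ / q.1) 0) := by
  have hq₀ := h.self_of_nhds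
  obtain ⟨η, ζ, hζ0, hζc, hηζ, huniq, hsimp⟩ := exists_critical_branch hf h hst
  have hζcont : ContinuousAt ζ (0, q₀) := hζc.self_of_nhds.continuousAt
  have hemb : Tendsto (fun q : ℝ × M => ((0 : ℝ), q)) (𝓝 q₀) (𝓝 (0, q₀)) :=
    (continuous_const.prodMk continuous_id).tendsto _
  have hneg : Tendsto (fun p : ℝ × (ℝ × M) => (-p.1, p.2)) (𝓝 ((0 : ℝ), q₀)) (𝓝 (0, q₀)) := by
    have h1 : Continuous fun p : ℝ × (ℝ × M) => (-p.1, p.2) := by fun_prop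
    have h2 := h1.tendsto ((0 : ℝ), q₀)
    simpa using h2
  have hgood : ∀ᶠ p in 𝓝 ((0 : ℝ), q₀), IsSmoothStripeAt f U p.2 :=
    eventually_comp_of_continuous h continuous_snd rfl
  -- The translation mode persists.
  have htrans : ∀ᶠ q in 𝓝 q₀, transJet (U q) 0 ≠ 0 := by
    have h1 : ∃ x, U q₀ x 0 ≠ U q₀ 0 0 := by
      obtain ⟨ξ, hξ⟩ := hst.isStripe.nonconstant
      exact ⟨ξ / q₀.1, by simpa using hξ⟩
    have h2 := (transJet_ne_zero_iff (contDiff_apply_param hf q₀.2) hq₀.sol).2 h1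
    have h3 : ContinuousAt (fun q => complexJet m N (jetField f (q.2, U q 0)).2) q₀ := by
      have h4 : ContinuousAt (fun q : ℝ × M => (q.2, U q 0)) q₀ :=
        continuousAt_snd.prodMk hq₀.smooth.continuousAt
      have h5 := ContinuousAt.comp (g := jetField f) (x := q₀)
        (contDiff_jetField hf).continuous.continuousAt h4
      exact (complexJet m N).continuous.continuousAt.comp (continuousAt_snd.comp h5)
    have h6 : ∀ {q}, IsSmoothStripeAt f U q →
        complexJet m N (jetField f (q.2, U q 0)).2 = transJet (U q) 0 := fun hq => by
      rw [transJet, (hq.sol.sol 0).deriv]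
      rfl
    have h7 := h3.eventually_ne (by rw [h6 hq₀]; exact h2)
    filter_upwards [h7, h] with q hq hq'
    rwa [h6 hq'] at hq
  have htnull : ∀ q, IsSmoothStripeAt f U q →
      nullMap f U (((0 : ℝ), q), (transJet (U q) 0, 0)) = 0 := fun q hq =>
    nullMap_eq_zero_of_isLinSol hf hq
      (isLinSol_transJet (contDiff_apply_param hf q.2) hq.sol) (by
      have := transJet_period hq.sol 0
      rw [zero_add] at this
      rw [multiplier_zero, one_smul, this])
  have hemb' : Tendsto (fun q : ℝ × M => (((0 : ℝ), q), (0 : ℂ))) (𝓝 q₀) (𝓝 ((0, q₀), 0)) :=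
    ((continuous_const.prodMk continuous_id).prodMk continuous_const).tendsto _
  -- The translation mode is a null vector for `z = 0`, so it lies on the branch.
  have hbase : ∀ᶠ q in 𝓝 q₀, ζ (0, q) = 0 ∧ ∃ c : ℂ, c ≠ 0 ∧ transJet (U q) 0 = c • η (0, q) := by
    filter_upwards [hemb'.eventually huniq, h, htrans] with q h1 h2 h3
    obtain ⟨h4, h5⟩ := h1 _ h3 (htnull q h2)
    exact ⟨h4.symm, h5⟩
  -- Reflection and complex conjugation make the branch even and real.
  have hsym : ∀ᶠ p in 𝓝 ((0 : ℝ), q₀), ζ (-p.1, p.2) = ζ p ∧ star (ζ p) = ζ (-p.1, p.2) := by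
    have h1 : Tendsto (fun p : ℝ × (ℝ × M) => ((-p.1, p.2), ζ p)) (𝓝 ((0 : ℝ), q₀))
        (𝓝 ((0, q₀), 0)) := by
      refine hneg.prodMk_nhds ?_
      have := hζcont.tendsto
      rwa [hζ0] at this
    have h2 : Tendsto (fun p : ℝ × (ℝ × M) => ((-p.1, p.2), star (ζ p))) (𝓝 ((0 : ℝ), q₀))
        (𝓝 ((0, q₀), 0)) := by
      refine hneg.prodMk_nhds ?_
      have := (continuous_star.continuousAt.comp hζcont).tendsto
      simpa [hζ0, Function.comp_def] using this
    filter_upwards [h1.eventually huniq, h2.eventually huniq, hηζ, hgood] with p h3 h4 h5 h6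
    have h7 : reflectC (η p) ≠ 0 := by
      intro h8
      refine h5.1 ?_
      ext1 j
      have h9 := congrFun h8 j
      simpa [reflectC] using h9
    exact ⟨(h3 _ h7 (nullMap_reflect hf hsymm h6 h5.2)).1.symm,
      (h4 _ (star_ne_zero.2 h5.1) (nullMap_star hf h6 h5.2)).1⟩
  set κ : ℝ × (ℝ × M) → ℝ := fun p => (ζ p).re with hκ
  have hκζ : ∀ᶠ p in 𝓝 ((0 : ℝ), q₀), ((κ p : ℝ) : ℂ) = ζ p := by
    filter_upwards [hsym] with p hp
    exact Complex.conj_eq_iff_re.1 (hp.2.trans hp.1)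
  have hκc : ∀ᶠ p in 𝓝 ((0 : ℝ), q₀), ContDiffAt ℝ ∞ κ p :=
    hζc.mono fun p hp => Complex.reCLM.contDiff.contDiffAt.comp p hp
  have hscale : ∀ q : ℝ × M, iteratedDeriv 2 (fun ℓ : ℝ => κ (ℓ / q.1, q)) 0 =
      (q.1⁻¹) ^ 2 * iteratedDeriv 2 (fun σ => κ (σ, q)) 0 := by
    intro q
    rw [← iteratedDeriv_two_comp_mul_left]
    simp only [div_eq_inv_mul]
  have hline : ∀ q : ℝ × M, ContDiffAt ℝ ∞ κ (0, q) → ContDiffAt ℝ ∞ (fun σ => κ (σ, q)) 0 :=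
    fun q hq => ContDiffAt.comp (g := κ) (f := fun σ : ℝ => (σ, q)) 0 hq
      (contDiffAt_id.prodMk contDiffAt_const)
  -- By uniqueness, `κ` is the branch of the stability assumption, up to the scaling `ℓ = k σ`.
  have hcurv0 : iteratedDeriv 2 (fun σ => κ (σ, q₀)) 0 < 0 := by
    obtain ⟨b, hbc, hb0, hbe, hb2⟩ := hst.branch
    have h1 : ∀ᶠ ℓ in 𝓝 (0 : ℝ), b ℓ = κ (ℓ / q₀.1, q₀) := by
      have h2 : Tendsto (fun ℓ : ℝ => ((ℓ / q₀.1, q₀), ((b ℓ : ℝ) : ℂ))) (𝓝 0)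
          (𝓝 ((0, q₀), 0)) := by
        refine Tendsto.prodMk_nhds (Tendsto.prodMk_nhds ?_ tendsto_const_nhds) ?_
        · have h3 : Continuous fun ℓ : ℝ => ℓ / q₀.1 := continuous_id.div_const _
          simpa using h3.tendsto 0
        · have h3 := (Complex.continuous_ofReal.continuousAt.comp hbc.continuousAt).tendsto
          simpa [hb0, Function.comp_def] using h3
      filter_upwards [hbe, h2.eventually huniq] with ℓ h4 h5
      obtain ⟨Y, hY, hA⟩ := (isBlochEigenvalue_iff_nullMap hf hq₀ _ _).1 h4
      have h6 := (h5 Y hY hA).1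
      exact (Complex.ofReal_re (b ℓ)).symm.trans (congrArg Complex.re h6)
    have h7 : iteratedDeriv 2 b 0 = iteratedDeriv 2 (fun ℓ => κ (ℓ / q₀.1, q₀)) 0 :=
      Filter.EventuallyEq.iteratedDeriv_eq 2 h1
    rw [h7, hscale q₀] at hb2
    have h8 : 0 < (q₀.1⁻¹) ^ 2 := by have := hq₀.pos; positivity
    exact neg_of_mul_neg_right hb2 h8.le
  obtain ⟨hκneg, hκcurv⟩ := eventually_neg_of_even hκc (by
    filter_upwards [hbase] with q hq
    rw [hκ]
    simp [hq.1]) (by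
    filter_upwards [hsym] with p hp
    rw [hκ]
    simp only [hp.1]) hcurv0
  -- There is no unstable spectrum for bounded spectral parameters.
  obtain ⟨C, hC⟩ := eventually_coeff_bound hf h
  set R : ℝ := max 1 ((2 * m * N * (2 * m * N * C ^ 2)) ^ m) with hR
  have hspec : ∀ᶠ q in 𝓝 q₀, ∀ s ∈ {s : ℝ × ℂ | |s.1| ≤ 1 / 2 ∧ ‖s.2‖ ≤ R ∧ 0 ≤ s.2.re},
      0 ≤ s.2.re → ∀ Y, Y ≠ 0 → nullMap f U ((s.1, q), (Y, s.2)) = 0 → s = (0, 0) := by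
    have hK : IsCompact {s : ℝ × ℂ | |s.1| ≤ 1 / 2 ∧ ‖s.2‖ ≤ R ∧ 0 ≤ s.2.re} := by
      have c1 : Continuous fun s : ℝ × ℂ => |s.1| := by fun_prop
      have c2 : Continuous fun s : ℝ × ℂ => ‖s.2‖ := by fun_prop
      have c3 : Continuous fun s : ℝ × ℂ => s.2.re := by fun_prop
      refine ((isCompact_closedBall (0 : ℝ) (1 / 2)).prod
        (isCompact_closedBall (0 : ℂ) R)).of_isClosed_subset ?_ ?_
      · exact (isClosed_le c1 continuous_const).inter
          ((isClosed_le c2 continuous_const).inter (isClosed_le continuous_const c3))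
      · rintro s ⟨h1, h2, -⟩
        exact ⟨by simpa using h1, by simpa using h2⟩
    refine hK.eventually_forall_of_forall_eventually fun s hs => ?_
    -- Near the critical point all eigenvalues are on the branch, which is negative for `σ ≠ 0`.
    by_cases hs0 : s = (0, 0)
    · have h1 : Tendsto (fun r : (ℝ × M) × (ℝ × ℂ) => ((r.2.1, r.1), r.2.2)) (𝓝 (q₀, s))
          (𝓝 ((0, q₀), 0)) := by
        have h2 : Continuous fun r : (ℝ × M) × (ℝ × ℂ) => ((r.2.1, r.1), r.2.2) := by fun_prop
        rw [hs0]
        exact h2.tendsto (q₀, ((0 : ℝ), (0 : ℂ)))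
      have h4 : Tendsto (fun r : (ℝ × M) × (ℝ × ℂ) => (r.2.1, r.1)) (𝓝 (q₀, s))
          (𝓝 (0, q₀)) := by
        rw [hs0]
        have h2 : Continuous fun r : (ℝ × M) × (ℝ × ℂ) => (r.2.1, r.1) := by fun_prop
        exact h2.tendsto (q₀, ((0 : ℝ), (0 : ℂ)))
      filter_upwards [h1.eventually huniq, h4.eventually hκneg,
        eventually_comp_of_continuous hbase continuous_fst rfl] with r h5 h6 h7 hre Y hY hA
      have h8 := (h5 Y hY hA).1
      by_cases h9 : r.2.1 = 0
      · rw [h9, h7.1] at h8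
        exact Prod.ext h9 h8
      · have h10 : (ζ (r.2.1, r.1)).re < 0 := h6 h9
        rw [← h8] at h10
        linarith
    · filter_upwards [eventually_no_unstable hf h hst hs.1 hs.2.2 hs0] with r hr _ Y hY hA
      exact absurd hA (hr Y hY)
  filter_upwards [h, htrans, hbase, hspec, hC, hκcurv, hemb.eventually hκc,
    hemb.eventually hsimp, hemb.eventually hηζ, hemb'.eventually huniq,
    hemb.eventually hκζ.eventually_nhds, hemb.eventually hηζ.eventually_nhds] with
    q hq ht hb hsp hCq hcurv hκq hsimpq hηq huq hκζq hηζq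
  have hg := contDiff_apply_param hf q.2
  have hlin := isLinSol_transJet hg hq.sol
  obtain ⟨hζq, c, hc0, hc⟩ := hb
  refine ⟨hq.sol.isStripe hg.continuous hq.pos ((transJet_ne_zero_iff hg hq.sol).1 ht), ?_, ?_, ?_,
    fun ℓ => κ (ℓ / q.1, q), ?_, ?_, ?_, ?_⟩
  · intro ℓ z hz
    by_cases hre : z.re < 0
    · exact Or.inl hre
    · right
      have hre' := not_lt.1 hre
      have hR' := norm_le_of_isBlochEigenvalue (NeZero.pos m) hCq hre' hz
      obtain ⟨Y, hY, hA⟩ := (isBlochEigenvalue_iff_nullMap hf hq ℓ z).1 hz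
      -- Floquet multipliers only depend on the class of `ℓ / k` modulo `1`.
      have hA' : nullMap f U ((ℓ / q.1 - round (ℓ / q.1), q), (Y, z)) = 0 := by
        rw [← hA]
        simp only [nullMap, multiplier_sub_intCast]
      have h1 := hsp (ℓ / q.1 - round (ℓ / q.1), z) ⟨abs_sub_round _, hR', hre'⟩ hre' Y hY hA'
      obtain ⟨h2, h3⟩ := Prod.mk.inj h1
      refine ⟨h3, round (ℓ / q.1), ?_⟩
      rw [← sub_eq_zero.1 h2, div_mul_cancel₀ _ hq.pos.ne']
  · rw [kernel_iff hg hq.pos hq.sol]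
    intro Y hY hper
    by_cases hY0 : Y 0 = 0
    · refine ⟨0, ?_⟩
      have h1 := hY.smul 0
      rw [zero_smul, zero_smul] at h1
      exact (hY.unique hg hq.sol.continuous h1 (x := 0) (by simpa using hY0)).trans
        (zero_smul ℂ (transJet (U q))).symm
    · obtain ⟨-, d, -, hd⟩ := huq (Y 0) hY0 (nullMap_eq_zero_of_isLinSol hf hq hY (by
        rw [multiplier_zero, one_smul, hper]))
      refine ⟨d * c⁻¹, ?_⟩
      have h1 := hlin.smul (d * c⁻¹)
      rw [smul_zero] at h1
      refine hY.unique hg hq.sol.continuous h1 (x := 0) ?_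
      rw [Pi.smul_apply, hc, hd, smul_smul, mul_assoc, inv_mul_cancel₀ hc0, mul_one]
  · rw [simple_iff hg hq.pos hq.sol]
    rintro ⟨Y, hY, hper⟩
    have h1 := hlin.smul c⁻¹
    rw [smul_zero] at h1
    obtain ⟨D, hD, hD0, hD'⟩ := exists_isLinSol_of_fderiv_nullMap hf hq h1 c (Y 0)
    have h2 : (fun t => c • (c⁻¹ • transJet (U q)) t 0) = fun t => transJet (U q) t 0 := by
      ext1 t
      simp only [Pi.smul_apply]
      rw [smul_inv_smul₀ hc0]
    rw [h2] at hD
    rw [hD.unique hg hq.sol.continuous hY hD0, hper, sub_self, Pi.smul_apply, hc,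
      inv_smul_smul₀ hc0, ← hζq] at hD'
    exact hc0 (hsimpq _ _ hD')
  · refine ContDiffAt.comp (g := fun σ => κ (σ, q)) (f := fun ℓ : ℝ => ℓ / q.1) 0 ?_
      (contDiff_id.div_const q.1).contDiffAt
    rw [zero_div]
    exact hline q hκq
  · simp [hκ, hζq]
  · have h1 : Tendsto (fun ℓ : ℝ => (ℓ / q.1, q)) (𝓝 0) (𝓝 (0, q)) := by
      have h2 : Continuous fun ℓ : ℝ => (ℓ / q.1, q) :=
        (continuous_id.div_const _).prodMk continuous_const
      simpa using h2.tendsto 0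
    filter_upwards [h1.eventually hκζq, h1.eventually hηζq] with ℓ h3 h4
    rw [isBlochEigenvalue_iff_nullMap hf hq, h3]
    exact ⟨_, h4.1, h4.2⟩
  · rw [hscale q]
    have h8 : 0 < (q.1⁻¹) ^ 2 := by have := hq.pos; positivity
    exact mul_neg_of_pos_of_neg h8 hcurv

end StableOpen

/-! ### Local continuation of stable stripes -/

section Continuation

variable {m N : ℕ} [NeZero m] {M : Type} [NormedAddCommGroup M] [NormedSpace ℝ M]
  [FiniteDimensional ℝ M] {f : M → (Fin (2 * m) → Fin N → ℝ) → Fin N → ℝ}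

omit [NeZero m] in
theorem reflectC_complexJet (V : Fin (2 * m) → Fin N → ℝ) :
    reflectC (complexJet m N V) = complexJet m N (reflectJet V) := by
  ext j b
  simp [reflectC, reflectJet]

omit [NeZero m] in
/-- The translation mode is odd. -/
theorem reflectC_transJet {g : (Fin (2 * m) → Fin N → ℝ) → Fin N → ℝ} {k : ℝ}
    {U : ℝ → Fin (2 * m) → Fin N → ℝ} (hU : IsStripeSol g k U) :
    reflectC (transJet U 0) = -transJet U 0 := by
  have h0 : HasDerivAt U (deriv U 0) 0 := (hU.sol 0).differentiableAt.hasDerivAt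
  have h1 : HasDerivAt (fun x => U (-x)) (-deriv U 0) 0 := by
    have h0' : HasDerivAt U (deriv U 0) (-0) := by rwa [neg_zero]
    exact (h0'.scomp (0 : ℝ) (hasDerivAt_neg (0 : ℝ))).congr_deriv (neg_one_smul ℝ _)
  have h2 : HasDerivAt (fun x => reflectL m N (U x)) (reflectL m N (deriv U 0)) 0 :=
    (reflectL m N).hasFDerivAt.comp_hasDerivAt 0 h0
  have h3 : (fun x => U (-x)) = fun x => reflectL m N (U x) := funext hU.reflect
  rw [h3] at h1
  have h4 := h2.unique h1
  rw [reflectL_apply] at h4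
  rw [transJet, reflectC_complexJet, h4, map_neg]

/-- The variational equation: derivatives of the flow in the initial jet solve the linearization. -/
theorem isLinSol_fderiv_flow
    (hf : ContDiff ℝ ∞ (fun q : M × (Fin (2 * m) → Fin N → ℝ) => f q.1 q.2)) {μ : M}
    {U : ℝ → Fin (2 * m) → Fin N → ℝ} (hU : IsJetSol (f μ) U) (δ : Fin (2 * m) → Fin N → ℝ) :
    IsLinSol (f μ) U 0 0
      (fun t => complexJet m N (fderiv ℝ (flow (jetField f)) (t, (μ, U 0)) (0, (0, δ))).2) := by
  have hF := contDiff_jetField hf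
  refine isLinSol_complexJet fun t => ?_
  have h := flow_jetField_of_isJetSol hf hU t
  have h1 := hasDerivAt_fderiv_flow hF h.1 (0, δ)
  set H := fderiv ℝ (flow (jetField f)) (t, (μ, U 0)) (0, (0, δ)) with hH
  have h2 : H.1 = 0 := by
    have h3 := fderiv_flow_semiconj hF (F' := fun _ : M => (0 : M)) contDiff_const
      (ContinuousLinearMap.fst ℝ M _) (fun _ => rfl) h.1 (0, δ)
    have h4 : flow (fun _ : M => (0 : M)) = fun p => p.2 :=
      funext fun p => flow_zero_field p.1 p.2
    rw [h4, fderiv_snd] at h3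
    exact h3
  have h5 := hasFDerivAt_snd.comp_hasDerivAt t h1
  refine h5.congr_deriv ?_
  rw [h.2]
  have h6 : H = (0, H.2) := Prod.ext h2 rfl
  rw [h6]
  -- The derivative of the vector field in the direction of the jet, computed along a line.
  have h7 : HasFDerivAt (fun V => jetField f (μ, V))
      ((fderiv ℝ (jetField f) (μ, U t)) ∘L ContinuousLinearMap.inr ℝ M _) (U t) :=
    HasFDerivAt.comp (g := jetField f) (U t) ((hF.differentiable (by simp)) _).hasFDerivAt
      (hasFDerivAt_prodMk_right μ (U t))
  have h8 : HasFDerivAt (fun V => (jetField f (μ, V)).2)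
      (ContinuousLinearMap.snd ℝ M _ ∘L
        ((fderiv ℝ (jetField f) (μ, U t)) ∘L ContinuousLinearMap.inr ℝ M _)) (U t) :=
    hasFDerivAt_snd.comp (U t) h7
  have h9 : HasDerivAt (fun s : ℝ => U t + s • H.2) H.2 0 := by
    simpa using ((hasDerivAt_id (0 : ℝ)).smul_const H.2).const_add (U t)
  have h10 : HasDerivAt (fun s : ℝ => (jetField f (μ, U t + s • H.2)).2)
      (fderiv ℝ (jetField f) (μ, U t) (0, H.2)).2 0 := by
    refine HasFDerivAt.comp_hasDerivAt (l := fun V => (jetField f (μ, V)).2)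
      (l' := ContinuousLinearMap.snd ℝ M _ ∘L
        ((fderiv ℝ (jetField f) (μ, U t)) ∘L ContinuousLinearMap.inr ℝ M _)) 0 ?_ h9
    rw [zero_smul, add_zero]
    exact h8
  have h11 : HasDerivAt (fun s : ℝ => (-1 : ℝ) ^ m • f μ (U t + s • H.2))
      ((-1 : ℝ) ^ m • fderiv ℝ (f μ) (U t) H.2) 0 := by
    refine HasDerivAt.const_smul ((-1 : ℝ) ^ m) ?_
    refine HasFDerivAt.comp_hasDerivAt (l := f μ) 0 ?_ h9
    rw [zero_smul, add_zero]
    exact (((contDiff_apply_param hf μ).differentiable (by simp)) _).hasFDerivAt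
  have h12 : HasDerivAt (fun s : ℝ => (jetField f (μ, U t + s • H.2)).2)
      (shiftJet H.2 ((-1 : ℝ) ^ m • fderiv ℝ (f μ) (U t) H.2)) 0 := by
    rw [hasDerivAt_pi]
    intro j
    simp only [jetField, shiftJet]
    split_ifs with hj
    · exact (hasDerivAt_pi.1 h9) _
    · exact h11
  exact h10.unique h12

theorem jet_comp_mul_zero {k : ℝ} (hk : k ≠ 0) (v : ℝ → Fin N → ℝ) :
    (fun ξ => (fun x => jet m k v (k * x)) (ξ / k) 0) = v := by
  ext1 ξ
  simp [jet, mul_div_cancel₀ ξ hk]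

/-- Stable stripes continue to a locally unique smooth family of solutions of the shooting
problem: the linearized shooting problem has only the trivial solution, as the kernel of the
linearization at the stripe is spanned by the translation mode, which is odd. -/
theorem exists_smooth_zeros
    (hf : ContDiff ℝ ∞ (fun q : M × (Fin (2 * m) → Fin N → ℝ) => f q.1 q.2))
    (hsymm : ∀ μ U, f μ (reflectJet U) = f μ U) {q₀ : ℝ × M} {v₀ : ℝ → Fin N → ℝ}
    (hst : IsStableStripe (f q₀.2) q₀.1 v₀) :
    ∃ ψ : ℝ × M → Fin m → Fin N → ℝ, ψ q₀ = evenPart m N (jet m q₀.1 v₀ 0) ∧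
      (∀ᶠ q in 𝓝 q₀, ContDiffAt ℝ ∞ ψ q) ∧
      ∀ᶠ u in 𝓝 (q₀, evenPart m N (jet m q₀.1 v₀ 0)),
        (IsZero f u.1.1 u.1.2 u.2 ↔ ψ u.1 = u.2) := by
  have hk := hst.isStripe.wavenumber_pos
  have hF := contDiff_jetField hf
  have hg := contDiff_apply_param hf q₀.2
  set U : ℝ → Fin (2 * m) → Fin N → ℝ := fun x => jet m q₀.1 v₀ (q₀.1 * x) with hUdef
  have hU : IsStripeSol (f q₀.2) q₀.1 U := hst.isStripe.isStripeSol
  have hv₀ : v₀ = fun ξ => U (ξ / q₀.1) 0 := (jet_comp_mul_zero hk.ne' v₀).symm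
  have hU0 : jet m q₀.1 v₀ 0 = U 0 := by simp [hUdef]
  rw [hU0]
  obtain ⟨ha, hz⟩ := hU.isZero hf
  set a₀ := evenPart m N (U 0) with ha₀
  have hkernel := (kernel_iff hg hk hU).1 (by rw [← hv₀]; exact hst.kernel)
  set G : (ℝ × M) × (Fin m → Fin N → ℝ) → Fin m → Fin N → ℝ := fun u =>
    oddPart m N (flow (jetField f) (Real.pi / u.1.1, (u.1.2, evenJet m N u.2))).2 with hG
  have hdata : ∀ u : (ℝ × M) × (Fin m → Fin N → ℝ), u.1.1 ≠ 0 → ContDiffAt ℝ ∞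
      (fun u : (ℝ × M) × (Fin m → Fin N → ℝ) => (Real.pi / u.1.1, (u.1.2, evenJet m N u.2))) u :=
    fun u hu => (contDiffAt_const.div (contDiff_fst.comp contDiff_fst).contDiffAt hu).prodMk
      ((contDiff_snd.comp contDiff_fst).contDiffAt.prodMk
        ((evenJet m N).contDiff.comp contDiff_snd).contDiffAt)
  have hdom : ∀ᶠ u : (ℝ × M) × (Fin m → Fin N → ℝ) in 𝓝 (q₀, a₀), u.1.1 ≠ 0 ∧
      (Real.pi / u.1.1, (u.1.2, evenJet m N u.2)) ∈ flowDomain (jetField f) := by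
    have h1 : Continuous fun u : (ℝ × M) × (Fin m → Fin N → ℝ) => u.1.1 := by fun_prop
    exact (h1.continuousAt.eventually_ne hk.ne').and
      ((hdata (q₀, a₀) hk.ne').continuousAt.eventually
        ((isOpen_flowDomain hF).mem_nhds hz.1))
  have hGsm : ∀ u : (ℝ × M) × (Fin m → Fin N → ℝ), (u.1.1 ≠ 0 ∧
      (Real.pi / u.1.1, (u.1.2, evenJet m N u.2)) ∈ flowDomain (jetField f)) →
      ContDiffAt ℝ ∞ G u := by
    rintro u ⟨h1, h2⟩
    have h3 := ContDiffAt.comp (g := flow (jetField f)) u (contDiffAt_flow hF h2) (hdata u h1)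
    exact (oddPart m N).contDiff.contDiffAt.comp u (contDiffAt_snd.comp u h3)
  have hinv : (fderiv ℝ G (q₀, a₀) ∘L ContinuousLinearMap.inr ℝ (ℝ × M)
      (Fin m → Fin N → ℝ)).IsInvertible := by
    refine isInvertible_of_injective rfl _ fun δ hδ => ?_
    set Y : ℝ → Fin (2 * m) → Fin N → ℂ := fun t => complexJet m N
      (fderiv ℝ (flow (jetField f)) (t, (q₀.2, U 0)) (0, (0, evenJet m N δ))).2 with hY
    have hYlin : IsLinSol (f q₀.2) U 0 0 Y := isLinSol_fderiv_flow hf hU.sol _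
    have hY0 : Y 0 = complexJet m N (evenJet m N δ) := by
      simp only [hY]
      rw [fderiv_flow_zero hF]
    have hodd : oddPart m N (fderiv ℝ (flow (jetField f)) (Real.pi / q₀.1, (q₀.2, U 0))
        (0, (0, evenJet m N δ))).2 = 0 := by
      rw [← hδ, ContinuousLinearMap.comp_apply, ContinuousLinearMap.inr_apply]
      have h1 : HasFDerivAt (fun a : Fin m → Fin N → ℝ =>
          (Real.pi / q₀.1, (q₀.2, evenJet m N a)))
          ((ContinuousLinearMap.inr ℝ ℝ (M × (Fin (2 * m) → Fin N → ℝ))) ∘L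
            (ContinuousLinearMap.inr ℝ M (Fin (2 * m) → Fin N → ℝ)) ∘L (evenJet m N)) a₀ :=
        (hasFDerivAt_prodMk_right (Real.pi / q₀.1) (q₀.2, evenJet m N a₀)).comp a₀
          ((hasFDerivAt_prodMk_right q₀.2 (evenJet m N a₀)).comp a₀ (evenJet m N).hasFDerivAt)
      have h2 := HasFDerivAt.comp (g := flow (jetField f)) a₀
        ((contDiffAt_flow hF hz.1).differentiableAt (by simp)).hasFDerivAt h1
      have h3 := ((oddPart m N).hasFDerivAt.comp _ (hasFDerivAt_snd.comp a₀ h2))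
      have h4 : HasFDerivAt (fun a => G (q₀, a))
          (fderiv ℝ G (q₀, a₀) ∘L ContinuousLinearMap.inr ℝ (ℝ × M) (Fin m → Fin N → ℝ)) a₀ :=
        HasFDerivAt.comp (g := G) a₀ ((hGsm _ hdom.self_of_nhds).differentiableAt
          (by simp)).hasFDerivAt (hasFDerivAt_prodMk_right q₀ a₀)
      have h5 := congrArg (fun L : (Fin m → Fin N → ℝ) →L[ℝ] (Fin m → Fin N → ℝ) => L δ)
        (h3.unique h4)
      rw [← ha]
      exact h5
    -- `Y` is even about `0`, because its initial jet is, and about the half period, because its odd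
    -- part vanishes there. Hence it is periodic.
    have hrefl : ∀ x, reflectC (Y (-x)) = Y x := by
      have h1 := hYlin.reflect (hsymm q₀.2) hg hU.reflect
      have h2 := h1.unique hg hU.continuous hYlin (x := 0) (by
        rw [neg_zero, hY0, reflectC_complexJet, reflectJet_evenJet])
      exact congrFun h2
    have hhalf : reflectC (Y (Real.pi / q₀.1)) = Y (Real.pi / q₀.1) := by
      simp only [hY]
      rw [reflectC_complexJet, (reflectJet_eq_self_iff _).2 hodd]
    have hper : Y (2 * Real.pi / q₀.1) = Y 0 := by
      have h1 := hYlin.comp_add hU.periodic (fun _ => rfl)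
      have h2 := h1.unique hg hU.continuous hYlin (x := -(Real.pi / q₀.1)) (by
        have h3 : -(Real.pi / q₀.1) + 2 * Real.pi / q₀.1 = Real.pi / q₀.1 := by ring
        rw [h3, ← hhalf]
        have h4 := hrefl (-(Real.pi / q₀.1))
        rwa [neg_neg] at h4)
      have h5 := congrFun h2 0
      simpa using h5
    -- `Y` is even and a multiple of the odd translation mode, so it vanishes.
    obtain ⟨c, hc⟩ := hkernel Y hYlin hper
    have h6 : Y 0 = -Y 0 := by
      have h7 := hrefl 0
      rw [neg_zero, hc, Pi.smul_apply, reflectC_smul, reflectC_transJet hU, smul_neg] at h7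
      rw [hc, Pi.smul_apply, h7]
    have h8 : Y 0 = 0 := self_eq_neg.1 h6
    rw [hY0] at h8
    have h9 : evenJet m N δ = 0 := by
      ext j b
      have := congrFun (congrFun h8 j) b
      simpa using this
    rw [← evenPart_evenJet (m := m) (N := N) δ, h9, map_zero]
  obtain ⟨ψ, h1, h2, h3⟩ := exists_smooth_implicit (H := G) (hdom.mono hGsm) hz.2 hinv
  refine ⟨ψ, h1, h2, ?_⟩
  filter_upwards [h3, hdom] with u hu hu'
  rw [← hu]
  exact ⟨fun h => h.2, fun h => ⟨hu'.2, h⟩⟩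

/-- A stable stripe belongs to a locally unique smooth family of stable stripes. -/
theorem exists_stable_family
    (hf : ContDiff ℝ ∞ (fun q : M × (Fin (2 * m) → Fin N → ℝ) => f q.1 q.2))
    (hsymm : ∀ μ U, f μ (reflectJet U) = f μ U) {q₀ : ℝ × M} {v₀ : ℝ → Fin N → ℝ}
    (hst : IsStableStripe (f q₀.2) q₀.1 v₀) :
    ∃ ψ : ℝ × M → Fin m → Fin N → ℝ, ψ q₀ = evenPart m N (jet m q₀.1 v₀ 0) ∧
      profile f q₀.1 q₀.2 (ψ q₀) = v₀ ∧ ContinuousAt ψ q₀ ∧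
      (∀ᶠ u in 𝓝 (q₀, evenPart m N (jet m q₀.1 v₀ 0)),
        (IsZero f u.1.1 u.1.2 u.2 ↔ ψ u.1 = u.2)) ∧
      ∀ᶠ q in 𝓝 q₀, IsStableStripe (f q.2) q.1 (profile f q.1 q.2 (ψ q)) ∧
        ∀ ξ, ContDiffAt ℝ ∞ (fun p : (ℝ × M) × ℝ => profile f p.1.1 p.1.2 (ψ p.1) p.2) (q, ξ) := by
  have hk := hst.isStripe.wavenumber_pos
  obtain ⟨ψ, hψ0, hψc, hψ⟩ := exists_smooth_zeros hf hsymm hst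
  have hψcont : ContinuousAt ψ q₀ := hψc.self_of_nhds.continuousAt
  have hzero : ∀ᶠ q in 𝓝 q₀, IsZero f q.1 q.2 (ψ q) := by
    have h1 : Tendsto (fun q => (q, ψ q)) (𝓝 q₀) (𝓝 (q₀, evenPart m N (jet m q₀.1 v₀ 0))) := by
      rw [← hψ0]
      exact (continuousAt_id.prodMk hψcont : ContinuousAt (fun q => (q, ψ q)) q₀).tendsto
    filter_upwards [h1.eventually hψ] with q hq using hq.2 rfl
  have hpos : ∀ᶠ q : ℝ × M in 𝓝 q₀, 0 < q.1 := continuousAt_fst.eventually_const_lt hk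
  have hex : ∀ q : ℝ × M, ∃ U : ℝ → Fin (2 * m) → Fin N → ℝ,
      0 < q.1 → IsZero f q.1 q.2 (ψ q) → IsStripeSol (f q.2) q.1 U ∧ U 0 = evenJet m N (ψ q) := by
    intro q
    by_cases h : 0 < q.1 ∧ IsZero f q.1 q.2 (ψ q)
    · obtain ⟨U, hU⟩ := exists_isStripeSol_of_isZero hf hsymm h.1 h.2
      exact ⟨U, fun _ _ => hU⟩
    · exact ⟨0, fun h1 h2 => absurd ⟨h1, h2⟩ h⟩
  choose U hU using hex
  have hsmooth : ∀ᶠ q in 𝓝 q₀, IsSmoothStripeAt f U q ∧ U q 0 = evenJet m N (ψ q) := by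
    filter_upwards [(hzero.and hpos).eventually_nhds, hψc] with q h1 h2
    have h3 := h1.self_of_nhds
    refine ⟨⟨h3.2, (hU q h3.2 h3.1).1, ?_⟩, (hU q h3.2 h3.1).2⟩
    refine ((evenJet m N).contDiff.contDiffAt.comp q h2).congr_of_eventuallyEq ?_
    filter_upwards [h1] with p hp using (hU p hp.2 hp.1).2
  have hprof : ∀ q, IsSmoothStripeAt f U q ∧ U q 0 = evenJet m N (ψ q) →
      profile f q.1 q.2 (ψ q) = fun ξ => U q (ξ / q.1) 0 := fun q hq =>
    hq.1.sol.profile_eq hf hq.2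
  have hprof0 : profile f q₀.1 q₀.2 (ψ q₀) = v₀ := by
    have h1 := hst.isStripe.isStripeSol
    have h2 := h1.isZero hf
    rw [h1.profile_eq hf (a := ψ q₀) (by
      rw [hψ0]
      have h3 := h2.1
      rw [mul_zero] at h3
      simp only [mul_zero, h3])]
    exact jet_comp_mul_zero hk.ne' v₀
  have hstable := eventually_isStableStripe hf hsymm (hsmooth.mono fun _ h => h.1) (by
    rw [← hprof q₀ hsmooth.self_of_nhds, hprof0]
    exact hst)
  refine ⟨ψ, hψ0, hprof0, hψcont, hψ, ?_⟩
  filter_upwards [hstable, hsmooth, hψc] with q h1 h2 h3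
  refine ⟨by rw [hprof q h2]; exact h1, fun ξ => ?_⟩
  have h4 : ContDiffAt ℝ ∞ (fun p : (ℝ × M) × ℝ =>
      (p.2 / p.1.1, (p.1.2, evenJet m N (ψ p.1)))) (q, ξ) := by
    refine ContDiffAt.prodMk (contDiffAt_snd.div
      (contDiff_fst.comp contDiff_fst).contDiffAt h2.1.pos.ne')
      ((contDiff_snd.comp contDiff_fst).contDiffAt.prodMk ?_)
    exact (evenJet m N).contDiff.contDiffAt.comp _
      (ContDiffAt.comp (g := ψ) (f := Prod.fst) (q, ξ) h3 contDiffAt_fst)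
  have h5 := (flow_jetField_of_isJetSol hf h2.1.sol.sol (ξ / q.1)).1
  rw [h2.2] at h5
  have h6 := ContDiffAt.comp (g := flow (jetField f)) (q, ξ)
    (contDiffAt_flow (contDiff_jetField hf) h5) h4
  exact (contDiffAt_pi.1 (contDiffAt_snd.comp (q, ξ) h6)) 0

end Continuation

/-! ### Cutoff in the parameter -/

section Cutoff

variable {m N p : ℕ}

/-- Near a given parameter, a nonlinearity that is defined on an open set of parameters agrees with
a globally smooth and reflection symmetric one. -/
theorem exists_cutoff {Λ : Set (Fin p → ℝ)} (hΛ : IsOpen Λ)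
    {f : (Fin p → ℝ) → (Fin (2 * m) → Fin N → ℝ) → Fin N → ℝ}
    (hf : ContDiffOn ℝ ∞
      (fun q : (Fin p → ℝ) × (Fin (2 * m) → Fin N → ℝ) => f q.1 q.2) (Λ ×ˢ Set.univ))
    (hsymm : ∀ μ ∈ Λ, ∀ U, f μ (reflectJet U) = f μ U) {μ₀ : Fin p → ℝ} (hμ₀ : μ₀ ∈ Λ) :
    ∃ F : (Fin p → ℝ) → (Fin (2 * m) → Fin N → ℝ) → Fin N → ℝ,
      ContDiff ℝ ∞ (fun q : (Fin p → ℝ) × (Fin (2 * m) → Fin N → ℝ) => F q.1 q.2) ∧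
      (∀ μ U, F μ (reflectJet U) = F μ U) ∧ ∀ᶠ μ in 𝓝 μ₀, μ ∈ Λ ∧ F μ = f μ := by
  obtain ⟨ε, hε, hball⟩ := Metric.nhds_basis_closedBall.mem_iff.1 (hΛ.mem_nhds hμ₀)
  set χ : ContDiffBump μ₀ := ⟨ε / 2, ε, by positivity, by linarith⟩ with hχ
  have hsupp : tsupport χ ⊆ Λ := by
    rw [χ.tsupport_eq]
    exact hball
  refine ⟨fun μ U => χ μ • f μ U, ?_, fun μ U => ?_, ?_⟩
  · rw [contDiff_iff_contDiffAt]
    rintro ⟨μ, V⟩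
    by_cases hμ : μ ∈ Λ
    · have h1 : ContDiffAt ℝ ∞ (fun q : (Fin p → ℝ) × (Fin (2 * m) → Fin N → ℝ) => χ q.1) (μ, V) :=
        (χ.contDiff.comp contDiff_fst).contDiffAt
      exact h1.smul (hf.contDiffAt ((hΛ.prod isOpen_univ).mem_nhds ⟨hμ, trivial⟩))
    · have h1 : (tsupport χ)ᶜ ∈ 𝓝 μ :=
        (isClosed_tsupport χ).isOpen_compl.mem_nhds fun h => hμ (hsupp h)
      refine (contDiffAt_const (c := (0 : Fin N → ℝ))).congr_of_eventuallyEq ?_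
      have h2 : ∀ᶠ q : (Fin p → ℝ) × (Fin (2 * m) → Fin N → ℝ) in 𝓝 (μ, V), q.1 ∈ (tsupport χ)ᶜ :=
        continuousAt_fst.eventually h1
      filter_upwards [h2] with q hq
      rw [image_eq_zero_of_notMem_tsupport hq, zero_smul]
  · by_cases hμ : μ ∈ Λ
    · simp only [hsymm μ hμ]
    · have h1 : χ μ = 0 := image_eq_zero_of_notMem_tsupport fun h => hμ (hsupp h)
      simp only [h1, zero_smul]
  · filter_upwards [hΛ.mem_nhds hμ₀, χ.eventuallyEq_one] with μ h1 h2
    refine ⟨h1, ?_⟩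
    ext1 U
    rw [h2]
    simp

end Cutoff

/-! ### Selection of nearest zeros -/

section Selection

variable {m N : ℕ} [NeZero m] {M : Type} [NormedAddCommGroup M] [NormedSpace ℝ M]
  [FiniteDimensional ℝ M] {f : M → (Fin (2 * m) → Fin N → ℝ) → Fin N → ℝ}

/-- `a` is a solution of the shooting problem closest to the given data `b`. -/
def IsNearestZero (f : M → (Fin (2 * m) → Fin N → ℝ) → Fin N → ℝ) (b : Fin m → Fin N → ℝ)
    (q : ℝ × M) (a : Fin m → Fin N → ℝ) : Prop :=
  IsZero f q.1 q.2 a ∧ ∀ a', IsZero f q.1 q.2 a' → dist a b ≤ dist a' b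

omit [NeZero m] [FiniteDimensional ℝ M] in
/-- A locally unique continuous branch of zeros through `b q₀` consists of the zeros nearest to
`b q`, for any continuous `b`. -/
theorem eventually_isNearestZero_iff {q₀ : ℝ × M} {b ψ : ℝ × M → Fin m → Fin N → ℝ}
    (hb : ContinuousAt b q₀) (hψc : ContinuousAt ψ q₀) (hψ0 : ψ q₀ = b q₀)
    (hψ : ∀ᶠ u in 𝓝 (q₀, b q₀), (IsZero f u.1.1 u.1.2 u.2 ↔ ψ u.1 = u.2)) :
    ∀ᶠ q in 𝓝 q₀, ∀ a, IsNearestZero f (b q) q a ↔ a = ψ q := by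
  obtain ⟨s, hs, t, ht, hst⟩ := mem_nhds_prod_iff.1 hψ
  obtain ⟨r, hr, hrt⟩ := Metric.mem_nhds_iff.1 ht
  have h1 : ∀ᶠ q in 𝓝 q₀, dist (b q) (b q₀) < r / 4 :=
    hb.eventually (Metric.ball_mem_nhds _ (by positivity))
  have h2 : ∀ᶠ q in 𝓝 q₀, dist (ψ q) (b q₀) < r / 4 := by
    rw [← hψ0]
    exact hψc.eventually (Metric.ball_mem_nhds _ (by positivity))
  filter_upwards [h1, h2, hs] with q h3 h4 h5
  have hz : IsZero f q.1 q.2 (ψ q) := by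
    have h6 : (q, ψ q) ∈ s ×ˢ t :=
      ⟨h5, hrt (Metric.mem_ball.2 (h4.trans (by linarith)))⟩
    exact (hst h6).2 rfl
  have h7 : dist (ψ q) (b q) < r / 2 := by
    have := dist_triangle_right (ψ q) (b q) (b q₀)
    linarith
  have huniq : ∀ a, IsZero f q.1 q.2 a → dist a (b q) ≤ dist (ψ q) (b q) → a = ψ q := by
    intro a ha hd
    have h8 : dist a (b q₀) < r := by
      have := dist_triangle a (b q) (b q₀)
      linarith
    have h9 : (q, a) ∈ s ×ˢ t := ⟨h5, hrt (Metric.mem_ball.2 h8)⟩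
    exact ((hst h9).1 ha).symm
  intro a
  constructor
  · rintro ⟨ha, hmin⟩
    exact huniq a ha (hmin _ hz)
  · rintro rfl
    refine ⟨hz, fun a' ha' => ?_⟩
    by_contra! hlt
    rw [huniq a' ha' hlt.le] at hlt
    exact lt_irrefl _ hlt

end Selection

/-! ### Persistence of families -/

section Persistence

variable {m N p : ℕ} [NeZero m] {Λ : Set (Fin p → ℝ)}
  {f F : (Fin p → ℝ) → (Fin (2 * m) → Fin N → ℝ) → Fin N → ℝ} {μ₀ : Fin p → ℝ}

/-- A stable stripe belongs to a smooth family of stable stripes at the same system parameter. -/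
theorem IsStableStripe.exists_family
    (hF : ContDiff ℝ ∞ (fun q : (Fin p → ℝ) × (Fin (2 * m) → Fin N → ℝ) => F q.1 q.2))
    (hFsymm : ∀ μ U, F μ (reflectJet U) = F μ U) {k₀ : ℝ} {v₀ : ℝ → Fin N → ℝ}
    (hst : IsStableStripe (F μ₀) k₀ v₀) :
    ∃ ε > 0, ∃ u : ℝ → ℝ → Fin N → ℝ, u k₀ = v₀ ∧
      ContDiffOn ℝ ∞ (fun q : ℝ × ℝ => u q.1 q.2) (Ioo (k₀ - ε) (k₀ + ε) ×ˢ univ) ∧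
      ∀ k ∈ Ioo (k₀ - ε) (k₀ + ε), IsStableStripe (F μ₀) k (u k) := by
  obtain ⟨ψ, -, hprof, -, -, hψ⟩ :=
    exists_stable_family (q₀ := (k₀, μ₀)) hF hFsymm hst
  have h1 : Tendsto (fun k : ℝ => (k, μ₀)) (𝓝 k₀) (𝓝 (k₀, μ₀)) :=
    (continuous_id.prodMk continuous_const).tendsto _
  obtain ⟨ε, hε, h2⟩ := Metric.eventually_nhds_iff_ball.1 (h1.eventually hψ)
  rw [Real.ball_eq_Ioo] at h2
  refine ⟨ε, hε, fun k => profile F k μ₀ (ψ (k, μ₀)), hprof, ?_, fun k hk => (h2 k hk).1⟩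
  rintro ⟨k, ξ⟩ ⟨hk, -⟩
  refine ContDiffAt.contDiffWithinAt ?_
  exact ContDiffAt.comp (g := fun r : (ℝ × (Fin p → ℝ)) × ℝ =>
    profile F r.1.1 r.1.2 (ψ r.1) r.2) (f := fun q : ℝ × ℝ => ((q.1, μ₀), q.2)) (k, ξ)
    ((h2 k hk).2 ξ) ((contDiffAt_fst.prodMk contDiffAt_const).prodMk contDiffAt_snd)

/-- Families of stable stripes persist. The nonlinearity `F` is a globally smooth one that agrees
with `f` for parameters near `μ₀`. -/
theorem IsStableFamily.exists_persistent_family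
    (hF : ContDiff ℝ ∞ (fun q : (Fin p → ℝ) × (Fin (2 * m) → Fin N → ℝ) => F q.1 q.2))
    (hFsymm : ∀ μ U, F μ (reflectJet U) = F μ U)
    (hFf : ∀ᶠ μ in 𝓝 μ₀, μ ∈ Λ ∧ F μ = f μ) {kmin kmax : ℝ} {v : ℝ → ℝ → Fin N → ℝ}
    (hv : IsStableFamily (f μ₀) kmin kmax v) :
    ∃ (W : Set (ℝ × (Fin p → ℝ))) (u : ℝ → (Fin p → ℝ) → ℝ → Fin N → ℝ),
      IsOpen W ∧ W ⊆ Ioo kmin kmax ×ˢ Λ ∧ (∀ k ∈ Ioo kmin kmax, (k, μ₀) ∈ W) ∧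
      (∀ μ, OrdConnected {k | (k, μ) ∈ W}) ∧ (∀ k ∈ Ioo kmin kmax, u k μ₀ = v k) ∧
      ContDiffOn ℝ ∞ (fun q : (ℝ × (Fin p → ℝ)) × ℝ => u q.1.1 q.1.2 q.2) (W ×ˢ univ) ∧
      ∀ q ∈ W, IsStableStripe (f q.2) q.1 (u q.1 q.2) := by
  have hF0 : F μ₀ = f μ₀ := hFf.self_of_nhds.2
  set b : ℝ × (Fin p → ℝ) → Fin m → Fin N → ℝ := fun q =>
    evenPart m N (jet m q.1 (v q.1) 0) with hb
  have hbc : ∀ k ∈ Ioo kmin kmax, ContinuousAt b (k, μ₀) := by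
    intro k hk
    have h1 : ContinuousAt (fun k => jet m k (v k) 0) k := by
      rw [continuousAt_pi]
      intro j
      refine ContinuousAt.smul (continuousAt_id.pow _) ?_
      have h2 := (hv.continuousOn j j.2.le).continuousAt
        ((isOpen_Ioo.prod isOpen_univ).mem_nhds (mk_mem_prod hk (mem_univ (0 : ℝ))))
      exact ContinuousAt.comp (f := fun k : ℝ => (k, (0 : ℝ))) (x := k) h2
        (continuousAt_id.prodMk continuousAt_const)
    have h3 : ContinuousAt (fun q : ℝ × (Fin p → ℝ) => jet m q.1 (v q.1) 0) (k, μ₀) :=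
      ContinuousAt.comp (g := fun k => jet m k (v k) 0) (x := (k, μ₀)) h1 continuousAt_fst
    exact (evenPart m N).continuous.continuousAt.comp h3
  classical
  -- A global selection, which coincides with the locally unique smooth branches.
  set sel : ℝ × (Fin p → ℝ) → Fin m → Fin N → ℝ := fun q =>
    if h : ∃ a, IsNearestZero F (b q) q a then h.choose else 0 with hsel
  have hlocal : ∀ k ∈ Ioo kmin kmax, profile F k μ₀ (sel (k, μ₀)) = v k ∧
      ∀ᶠ q in 𝓝 (k, μ₀), IsStableStripe (F q.2) q.1
        (profile F q.1 q.2 (sel q)) ∧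
        ∀ ξ, ContDiffAt ℝ ∞ (fun r : (ℝ × (Fin p → ℝ)) × ℝ =>
          profile F r.1.1 r.1.2 (sel r.1) r.2) (q, ξ) := by
    intro k hk
    have hst := hv.stable k hk
    rw [← hF0] at hst
    obtain ⟨ψ, hψ0, hprof, hψc, huniq, hψ⟩ :=
      exists_stable_family (q₀ := (k, μ₀)) hF hFsymm hst
    have h1 : ∀ᶠ q in 𝓝 (k, μ₀), sel q = ψ q := by
      filter_upwards [eventually_isNearestZero_iff (hbc k hk) hψc hψ0 huniq] with q hq
      have hex : ∃ a, IsNearestZero F (b q) q a := ⟨ψ q, (hq _).2 rfl⟩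
      simp only [hsel, dif_pos hex]
      exact (hq _).1 hex.choose_spec
    refine ⟨by rw [h1.self_of_nhds]; exact hprof, ?_⟩
    filter_upwards [h1.eventually_nhds, hψ] with q h2 h3
    refine ⟨by rw [h2.self_of_nhds]; exact h3.1, fun ξ => (h3.2 ξ).congr_of_eventuallyEq ?_⟩
    have h4 : ∀ᶠ r : (ℝ × (Fin p → ℝ)) × ℝ in 𝓝 (q, ξ), sel r.1 = ψ r.1 :=
      (continuousAt_fst (p := (q, ξ))).eventually h2
    filter_upwards [h4] with r hr
    rw [hr]
  obtain ⟨W, hWo, hWS, hWJ, hWμ, hWc⟩ := exists_isOpen_ordConnected_slices hv.lt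
    (S := {q | (q.2 ∈ Λ ∧ F q.2 = f q.2) ∧ IsStableStripe (F q.2) q.1
        (profile F q.1 q.2 (sel q)) ∧
        ∀ ξ, ContDiffAt ℝ ∞ (fun r : (ℝ × (Fin p → ℝ)) × ℝ =>
          profile F r.1.1 r.1.2 (sel r.1) r.2) (q, ξ)}) (μ₀ := μ₀) (fun k hk =>
    ((continuousAt_snd (p := (k, μ₀))).eventually hFf).and (hlocal k hk).2)
  refine ⟨W, fun k μ => profile F k μ (sel (k, μ)), hWo,
    fun q hq => ⟨(hWJ hq).1, (hWS hq).1.1⟩, hWμ, hWc, fun k hk => (hlocal k hk).1, ?_, ?_⟩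
  · rintro ⟨q, ξ⟩ ⟨hq, -⟩
    exact ((hWS hq).2.2 ξ).contDiffWithinAt
  · intro q hq
    obtain ⟨⟨-, h1⟩, h2, -⟩ := hWS hq
    rw [← h1]
    exact h2

end Persistence

end Stripes

theorem lemma2p1 (m N p : ℕ) (hm : 1 ≤ m)
    -- the open set of system parameters, and the nonlinearities
    (Λ : Set (Fin p → ℝ)) (hΛ : IsOpen Λ)
    (f : (Fin p → ℝ) → (Fin (2 * m) → Fin N → ℝ) → Fin N → ℝ)
    (hf : ContDiffOn ℝ ∞
      (fun q : (Fin p → ℝ) × (Fin (2 * m) → Fin N → ℝ) => f q.1 q.2) (Λ ×ˢ Set.univ))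
    (hsymm : ∀ μ ∈ Λ, ∀ U, f μ (Stripes.reflectJet U) = f μ U)
    (μ₀ : Fin p → ℝ) (hμ₀ : μ₀ ∈ Λ) :
    -- a stable stripe lies in a smooth local family of stable stripes
    (∀ (k₀ : ℝ) (v₀ : ℝ → Fin N → ℝ), Stripes.IsStableStripe (f μ₀) k₀ v₀ →
      ∃ ε > 0, ∃ u : ℝ → ℝ → Fin N → ℝ,
        u k₀ = v₀ ∧
        ContDiffOn ℝ ∞ (fun q : ℝ × ℝ => u q.1 q.2)
          (Set.Ioo (k₀ - ε) (k₀ + ε) ×ˢ Set.univ) ∧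
        ∀ k ∈ Set.Ioo (k₀ - ε) (k₀ + ε), Stripes.IsStableStripe (f μ₀) k (u k)) ∧
    -- families of stable stripes persist and depend smoothly on the system parameters
    (∀ (kmin kmax : ℝ) (v : ℝ → ℝ → Fin N → ℝ), Stripes.IsStableFamily (f μ₀) kmin kmax v →
      ∃ (W : Set (ℝ × (Fin p → ℝ))) (u : ℝ → (Fin p → ℝ) → ℝ → Fin N → ℝ),
        IsOpen W ∧ W ⊆ Set.Ioo kmin kmax ×ˢ Λ ∧
        (∀ k ∈ Set.Ioo kmin kmax, (k, μ₀) ∈ W) ∧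
        (∀ μ, Set.OrdConnected {k | (k, μ) ∈ W}) ∧
        (∀ k ∈ Set.Ioo kmin kmax, u k μ₀ = v k) ∧
        ContDiffOn ℝ ∞ (fun q : (ℝ × (Fin p → ℝ)) × ℝ => u q.1.1 q.1.2 q.2)
          (W ×ˢ Set.univ) ∧
        ∀ q ∈ W, Stripes.IsStableStripe (f q.2) q.1 (u q.1 q.2)) := by
  have : NeZero m := ⟨by omega⟩
  obtain ⟨F, hF, hFsymm, hFf⟩ := Stripes.exists_cutoff hΛ hf hsymm hμ₀
  refine ⟨fun k₀ v₀ hst => ?_, fun kmin kmax v hv => hv.exists_persistent_family hF hFsymm hFf⟩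
  rw [← hFf.self_of_nhds.2] at hst ⊢
  exact hst.exists_family hF hFsymm
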